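/- Let $\mathbb F$ be a field, $d\ge 0$ an integer, and $A=\mathbb F[u]/(u^3)$, regarded as a superalgebra with $u$ odd. Write $\bar v\in\{0,1\}$ for the parity of a homogeneous element $v$. Let $A\wr_{\mathrm s}\mathfrak S_d$ be the wreath superproduct: the vector space $A^{\otimes d}\otimes\mathbb F\mathfrak S_d$, where $A^{\otimes d}$ is multiplied by the super tensor product rule $(a_1\otimes b_1)(a_2\otimes b_2)=(-1)^{\bar b_1\bar a_2}a_1a_2\otimes b_1b_2$ and $$(1^{\otimes d};\sigma)(v_1\otimes\cdots\otimes v_d;\pi)=(-1)^{[\sigma;v_1,\dots,v_d]}(v_{\sigma^{-1}(1)}\otimes\cdots\otimes v_{\sigma^{-1}(d)};\sigma\pi),$$ $$[\sigma;v_1,\dots,v_d]=|\{(i,j): 1\le i<j\le d,\ \sigma(i)>\sigma(j),\ \bar v_i=\bar v_j=1\}|,$$ for $\sigma,\pi\in\mathfrak S_d$ and homogeneous $v_1,\dots,v_d\in A$. For an $\mathbb F\mathfrak S_d$-module $W$ let $T(\mathbb F,W)$ be the $A\wr_{\mathrm s}\mathfrak S_d$-module $W$ on which $\mathfrak S_d$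 acts as given and every copy of $u$ acts as $0$. (1) Suppose $\mathbb F$ has characteristic $0$. For partitions $\nu,\pi$ of $d$ let $c_{\nu,\pi}$ be the multiplicity of $T(\mathbb F,S^\nu)$ as a composition factor of the projective cover of $T(\mathbb F,S^\pi)$, where $S^\nu$ denotes the Specht module. Then for every partition $\nu$ of $d$ we have $c_{\nu,\nu}\ge 2d+1$, with equality if and only if $\nu=(d)$ or $\nu=(1^d)$. (2) Suppose $\mathbb F$ has characteristic $3$ and $d\ge 3$. For $3$-regular partitions $\mu,\pi$ of $d$ (partitions in which no positive part occurs three or more times) let $\bar c_{\mu,\pi}$ be the multiplicity of $T(\mathbb F,D^\mu)$ as a composition factor of the projective cover of $T(\mathbb F,D^\pi)$, where $D^\mu=S^\mu/(S^\mu\cap (S^\mu)^\perp)$ denotes the James module, the orthogonal complement being taken for the standard bilinear form on the permutation module on $\mu$-tabloids, in which $S^\mu$ lies. Then $\bar c_{\mu,\mu}>2d+1$ for every $3$-regular partition $\mu$ of $d$. -/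

import Mathlib

/-! ## The wreath superproduct `A ≀ₛ 𝔖_d` for `A = F[u]/(u³)`, `u` odd

`A^{⊗d} ⊗ F𝔖_d` has the basis `(u^{e₁} ⊗ ⋯ ⊗ u^{e_d} ; σ)` with `eᵢ ∈ {0, 1, 2}` and `σ ∈ 𝔖_d`; the
tensor factor `u^e` has the parity of `e`. Multiplication is given on this basis. -/

namespace WreathSuper

/-- The basis element `(u^{e₁} ⊗ ⋯ ⊗ u^{e_d} ; σ)` is indexed by the pair `(e, σ)`. -/
abbrev Idx (d : ℕ) : Type := (Fin d → Fin 3) × Equiv.Perm (Fin d)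

/-- Number of sign changes in the tensor product rule
`(u^{e₁} ⊗ ⋯ ⊗ u^{e_d}) (u^{g₁} ⊗ ⋯ ⊗ u^{g_d}) = ± u^{e₁ + g₁} ⊗ ⋯ ⊗ u^{e_d + g_d}`:
every odd factor `u^{g_j}` passes the odd factors `u^{e_i}` with `j < i`. -/
def tensorSign {d : ℕ} (e g : Fin d → ℕ) : ℕ :=
  (Finset.univ.filter fun p : Fin d × Fin d => p.2 < p.1 ∧ Odd (e p.1) ∧ Odd (g p.2)).card

/-- The number `[σ; v₁, …, v_d]` for `v_i = u^{f_i}`: the number of pairs `i < j` with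
`σ i > σ j` and `v_i`, `v_j` both odd. -/
def permSign {d : ℕ} (σ : Equiv.Perm (Fin d)) (f : Fin d → ℕ) : ℕ :=
  (Finset.univ.filter fun p : Fin d × Fin d =>
    p.1 < p.2 ∧ σ p.2 < σ p.1 ∧ Odd (f p.1) ∧ Odd (f p.2)).card

end WreathSuper

/-- The underlying vector space `A^{⊗d} ⊗ F𝔖_d` of the wreath superproduct. -/
def WreathSuper (F : Type*) [Field F] (d : ℕ) : Type _ := WreathSuper.Idx d →₀ F

namespace WreathSuper

noncomputable section

variable {F : Type*} [Field F] {d : ℕ}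

instance : AddCommGroup (WreathSuper F d) := inferInstanceAs (AddCommGroup (Idx d →₀ F))

instance : Module F (WreathSuper F d) := inferInstanceAs (Module F (Idx d →₀ F))

/-- The basis element with index `(e, σ)`. -/
def basis (F : Type*) [Field F] {d : ℕ} (a : Idx d) : WreathSuper F d := Finsupp.single a (1 : F)

/-- The linear map with prescribed values on the basis. -/
def lift {M : Type*} [AddCommMonoid M] [Module F M] (φ : Idx d → M) : WreathSuper F d →ₗ[F] M :=
  (Finsupp.linearCombination F φ : (Idx d →₀ F) →ₗ[F] M)

lemma lift_basis {M : Type*} [AddCommMonoid M] [Module F M] (φ : Idx d → M) (a : Idx d) :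
    lift φ (basis F a) = φ a :=
  (Finsupp.linearCombination_single F (1 : F) a).trans (one_smul F (φ a))

/-- The element `(u^{n₁} ⊗ ⋯ ⊗ u^{n_d} ; σ)` for arbitrary exponents: it is zero as soon as some
exponent is at least `3`. -/
def mono (F : Type*) [Field F] {d : ℕ} (n : Fin d → ℕ) (σ : Equiv.Perm (Fin d)) :
    WreathSuper F d :=
  if h : ∀ i, n i < 3 then basis F (fun i => ⟨n i, h i⟩, σ) else 0

/-- The exponents of `v_{σ⁻¹(1)} ⊗ ⋯ ⊗ v_{σ⁻¹(d)}` where `v_i = u^{f_i}`. -/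
def permute (σ : Equiv.Perm (Fin d)) (f : Fin d → ℕ) : Fin d → ℕ := fun i => f (σ⁻¹ i)

/-- The exponent of `-1` in the product `(u^e ; σ) (u^f ; π)`. -/
def signExp (e : Fin d → ℕ) (σ : Equiv.Perm (Fin d)) (f : Fin d → ℕ) : ℕ :=
  permSign σ f + tensorSign e (permute σ f)

/-- The product of two basis elements:
`(u^e ; σ) (u^f ; π) = (u^e ; 1) ((1 ; σ) (u^f ; π))`, where
`(1 ; σ) (u^f ; π) = (-1)^[σ; u^f] (u^{f_{σ⁻¹(1)}} ⊗ ⋯ ⊗ u^{f_{σ⁻¹(d)}} ; σ π)`. -/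
def basisMul (a b : Idx d) : WreathSuper F d :=
  (-1 : F) ^ signExp (fun i => a.1 i) a.2 (fun i => b.1 i) •
    mono F ((fun i => (a.1 i : ℕ)) + permute a.2 (fun i => b.1 i)) (a.2 * b.2)

/-- The bilinear extension of `basisMul`. -/
def mulHom (F : Type*) [Field F] (d : ℕ) :
    WreathSuper F d →ₗ[F] WreathSuper F d →ₗ[F] WreathSuper F d :=
  lift fun a => lift fun b => basisMul a b

instance : Mul (WreathSuper F d) := ⟨fun x y => mulHom F d x y⟩

instance : One (WreathSuper F d) := ⟨mono F 0 1⟩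

/-! ### Verification of the ring axioms -/

lemma permute_apply (σ : Equiv.Perm (Fin d)) (f : Fin d → ℕ) (i : Fin d) :
    permute σ f (σ i) = f i :=
  congrArg f (σ.symm_apply_apply i)

/-- `tensorSign` modulo `2`. -/
def tz (e g : Fin d → ℕ) : ZMod 2 :=
  ∑ p : Fin d × Fin d, if p.2 < p.1 then (e p.1 : ZMod 2) * g p.2 else 0

/-- `permSign` modulo `2`. -/
def pz (σ : Equiv.Perm (Fin d)) (f : Fin d → ℕ) : ZMod 2 :=
  ∑ p : Fin d × Fin d, if p.1 < p.2 ∧ σ p.2 < σ p.1 then (f p.1 : ZMod 2) * f p.2 else 0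

lemma odd_mul_cast (a b : ℕ) :
    (if Odd a ∧ Odd b then (1 : ZMod 2) else 0) = (a : ZMod 2) * b := by
  rcases Nat.even_or_odd a with ha | ha <;> rcases Nat.even_or_odd b with hb | hb
  · simp [Nat.not_odd_iff_even.mpr ha, (ZMod.natCast_eq_zero_iff_even).mpr ha]
  · simp [Nat.not_odd_iff_even.mpr ha, (ZMod.natCast_eq_zero_iff_even).mpr ha]
  · simp [Nat.not_odd_iff_even.mpr hb, (ZMod.natCast_eq_zero_iff_even).mpr hb]
  · simp [ha, hb, (ZMod.natCast_eq_one_iff_odd).mpr ha, (ZMod.natCast_eq_one_iff_odd).mpr hb]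

lemma tensorSign_cast (e g : Fin d → ℕ) : (tensorSign e g : ZMod 2) = tz e g := by
  unfold tensorSign tz
  rw [Finset.card_filter, Nat.cast_sum]
  refine Finset.sum_congr rfl fun p _ => ?_
  by_cases h : p.2 < p.1
  · simp [h, ← odd_mul_cast]
  · simp [h]

lemma permSign_cast (σ : Equiv.Perm (Fin d)) (f : Fin d → ℕ) :
    (permSign σ f : ZMod 2) = pz σ f := by
  unfold permSign pz
  rw [Finset.card_filter, Nat.cast_sum]
  refine Finset.sum_congr rfl fun p _ => ?_
  by_cases h : p.1 < p.2 ∧ σ p.2 < σ p.1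
  · simp [h, ← odd_mul_cast]
  · rw [if_neg h, if_neg]
    · simp
    · rintro ⟨h1, h2, -⟩
      exact h ⟨h1, h2⟩

/-- A double sum vanishes when its terms cancel under exchange of the two indices. -/
lemma sum_swap_zero (G : Fin d × Fin d → ZMod 2) (h : ∀ i j, G (i, j) + G (j, i) = 0)
    (h0 : ∀ i, G (i, i) = 0) : ∑ p, G p = 0 := by
  refine Finset.sum_involution (fun p _ => p.swap) ?_ ?_ ?_ ?_
  · rintro ⟨i, j⟩ _; exact h i j
  · rintro ⟨i, j⟩ _ hne heq
    apply hne
    simp only [Prod.swap_prod_mk, Prod.mk.injEq] at heq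
    obtain ⟨rfl, -⟩ := heq
    exact h0 _
  · simp
  · simp

lemma two_zmod (x : ZMod 2) : x + x = 0 := CharTwo.add_self_eq_zero x

lemma tz_add_left (e e' g : Fin d → ℕ) : tz (e + e') g = tz e g + tz e' g := by
  unfold tz
  rw [← Finset.sum_add_distrib]
  refine Finset.sum_congr rfl fun p _ => ?_
  split_ifs <;> simp [add_mul]

lemma tz_add_right (e g g' : Fin d → ℕ) : tz e (g + g') = tz e g + tz e g' := by
  unfold tz
  rw [← Finset.sum_add_distrib]
  refine Finset.sum_congr rfl fun p _ => ?_
  split_ifs <;> simp [mul_add]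

/-- Reindexing a double sum by a permutation. -/
lemma sum_reindex (σ : Equiv.Perm (Fin d)) (G : Fin d × Fin d → ZMod 2) :
    ∑ p, G p = ∑ p : Fin d × Fin d, G (σ p.1, σ p.2) :=
  ((Equiv.prodCongr σ σ).sum_comp G).symm

lemma eq_of_add_add_eq_zero {x y z : ZMod 2} (h : x + (y + z) = 0) : x = y + z := by
  linear_combination h - two_zmod (y + z)

lemma pz_add (σ : Equiv.Perm (Fin d)) (f h : Fin d → ℕ) :
    pz σ (f + h) = pz σ f + pz σ h + (tz (permute σ f) (permute σ h) + tz f h) := by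
  apply eq_of_add_add_eq_zero
  unfold pz tz
  rw [sum_reindex σ (fun p : Fin d × Fin d =>
    if p.2 < p.1 then (permute σ f p.1 : ZMod 2) * permute σ h p.2 else 0)]
  simp only [← Finset.sum_add_distrib]
  apply sum_swap_zero
  · intro i j
    simp only [permute_apply, Pi.add_apply, Nat.cast_add]
    have h2 : (2 : ZMod 2) = 0 := rfl
    rcases lt_trichotomy i j with hij | rfl | hij
    · have := σ.injective.ne hij.ne
      rcases lt_or_gt_of_ne this with hs | hs
      · simp only [hij, hs, hij.not_gt, hs.not_gt, and_true, and_false, if_true, if_false]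
        linear_combination ((f j : ZMod 2) * h i) * h2
      · simp only [hij, hs, hij.not_gt, hs.not_gt, and_self, if_true, if_false]
        linear_combination ((f i : ZMod 2) * f j + h i * h j + f i * h j + f j * h i) * h2
    · simp
    · have := σ.injective.ne hij.ne
      rcases lt_or_gt_of_ne this with hs | hs
      · simp only [hij, hs, hij.not_gt, hs.not_gt, and_true, and_false, if_true, if_false]
        linear_combination ((f i : ZMod 2) * h j) * h2
      · simp only [hij, hs, hij.not_gt, hs.not_gt, and_self, if_true, if_false]
        linear_combination ((f i : ZMod 2) * f j + h i * h j + f i * h j + f j * h i) * h2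
  · intro i
    simp

lemma pz_mul (σ π : Equiv.Perm (Fin d)) (g : Fin d → ℕ) :
    pz (σ * π) g = pz π g + pz σ (permute π g) := by
  apply eq_of_add_add_eq_zero
  unfold pz
  rw [sum_reindex π (fun p : Fin d × Fin d =>
    if p.1 < p.2 ∧ σ p.2 < σ p.1 then (permute π g p.1 : ZMod 2) * permute π g p.2 else 0)]
  simp only [← Finset.sum_add_distrib]
  apply sum_swap_zero
  · intro i j
    simp only [permute_apply, Equiv.Perm.coe_mul, Function.comp_apply]
    have h2 : (2 : ZMod 2) = 0 := rfl
    by_cases hij : i = j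
    · subst hij; simp
    · have h1 := π.injective.ne hij
      have h3 := σ.injective.ne h1
      rcases lt_or_gt_of_ne hij with a | a <;> rcases lt_or_gt_of_ne h1 with b | b <;>
        rcases lt_or_gt_of_ne h3 with c | c <;>
        simp only [a, b, c, a.not_gt, b.not_gt, c.not_gt, and_true, and_false, and_self,
          if_true, if_false] <;>
        first
        | (ring1)
        | linear_combination ((g i : ZMod 2) * g j) * h2
  · intro i
    simp

lemma permute_mul (σ π : Equiv.Perm (Fin d)) (f : Fin d → ℕ) :
    permute (σ * π) f = permute σ (permute π f) := by
  funext i; simp [permute, mul_inv_rev]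

lemma permute_add (σ : Equiv.Perm (Fin d)) (f g : Fin d → ℕ) :
    permute σ (f + g) = permute σ f + permute σ g := rfl

lemma neg_one_pow_congr {m n : ℕ} (h : (m : ZMod 2) = n) : (-1 : F) ^ m = (-1 : F) ^ n := by
  have h' : m % 2 = n % 2 := (ZMod.natCast_eq_natCast_iff' m n 2).mp h
  rw [← Nat.div_add_mod m 2, ← Nat.div_add_mod n 2, h']
  simp [pow_add, pow_mul]

lemma signExp_assoc (e f g : Fin d → ℕ) (σ π : Equiv.Perm (Fin d)) :
    (-1 : F) ^ (signExp e σ f + signExp (e + permute σ f) (σ * π) g) =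
      (-1 : F) ^ (signExp f π g + signExp e σ (f + permute π g)) := by
  apply neg_one_pow_congr
  simp only [signExp, Nat.cast_add, tensorSign_cast, permSign_cast, permute_add, permute_mul,
    tz_add_left, tz_add_right, pz_add, pz_mul]
  linear_combination - two_zmod (tz f (permute π g))

lemma mul_def (x y : WreathSuper F d) : x * y = mulHom F d x y := rfl

lemma basis_mul_basis (a b : Idx d) : basis F a * basis F b = basisMul a b := by
  rw [mul_def, mulHom, lift_basis, lift_basis]

/-- The product of two monomials, with no restriction on the exponents. -/
lemma mono_mul_mono (e f : Fin d → ℕ) (σ π : Equiv.Perm (Fin d)) :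
    mono F e σ * mono F f π =
      (-1 : F) ^ signExp e σ f • mono F (e + permute σ f) (σ * π) := by
  by_cases he : ∀ i, e i < 3
  · by_cases hf : ∀ i, f i < 3
    · have h1 : mono F e σ = basis F (fun i => (⟨e i, he i⟩ : Fin 3), σ) := dif_pos he
      have h2 : mono F f π = basis F (fun i => (⟨f i, hf i⟩ : Fin 3), π) := dif_pos hf
      rw [h1, h2, basis_mul_basis]
      rfl
    · have h2 : mono F f π = 0 := dif_neg hf
      have h3 : mono F (e + permute σ f) (σ * π) = 0 := by
        apply dif_neg
        intro h
        apply hf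
        intro i
        have := h (σ i)
        simp only [permute_apply, Pi.add_apply] at this
        omega
      rw [h2, h3, mul_def, map_zero, smul_zero]
  · have h1 : mono F e σ = 0 := dif_neg he
    have h3 : mono F (e + permute σ f) (σ * π) = 0 := by
      apply dif_neg
      intro h
      apply he
      intro i
      have := h i
      simp only [Pi.add_apply] at this
      omega
    rw [h1, h3, mul_def, map_zero, smul_zero, LinearMap.zero_apply]

lemma basis_eq_mono (a : Idx d) : basis F a = mono F (fun i => a.1 i) a.2 := by
  have h : ∀ i, (fun i => (a.1 i : ℕ)) i < 3 := fun i => (a.1 i).isLt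
  unfold mono
  rw [dif_pos h]

/-- Linear maps out of the wreath superproduct are determined on the basis. -/
lemma hom_ext {M : Type*} [AddCommMonoid M] [Module F M] {φ ψ : WreathSuper F d →ₗ[F] M}
    (h : ∀ e σ, φ (mono F e σ) = ψ (mono F e σ)) : φ = ψ := by
  refine Finsupp.lhom_ext' fun a => LinearMap.ext_ring ?_
  change φ (basis F a) = ψ (basis F a)
  rw [basis_eq_mono]
  exact h _ _

lemma smul_mul' (c : F) (x y : WreathSuper F d) : (c • x) * y = c • (x * y) := by
  simp [mul_def]

lemma mul_smul' (c : F) (x y : WreathSuper F d) : x * (c • y) = c • (x * y) := by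
  simp [mul_def]

lemma mul_assoc' (x y z : WreathSuper F d) : x * y * z = x * (y * z) := by
  let L : WreathSuper F d →ₗ[F] WreathSuper F d →ₗ[F] WreathSuper F d →ₗ[F] WreathSuper F d :=
    (mulHom F d).compr₂ (mulHom F d)
  let R : WreathSuper F d →ₗ[F] WreathSuper F d →ₗ[F] WreathSuper F d →ₗ[F] WreathSuper F d :=
    ((LinearMap.llcomp F (WreathSuper F d) (WreathSuper F d) (WreathSuper F d)).flip
      ∘ₗ (mulHom F d)).flip ∘ₗ (mulHom F d)
  have : L = R := by
    refine hom_ext fun e σ => hom_ext fun f π => hom_ext fun g ρ => ?_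
    change mono F e σ * mono F f π * mono F g ρ = mono F e σ * (mono F f π * mono F g ρ)
    rw [mono_mul_mono, mono_mul_mono, smul_mul', mul_smul', mono_mul_mono, mono_mul_mono,
      smul_smul, smul_smul, ← pow_add, ← pow_add, signExp_assoc, permute_add, permute_mul,
      mul_assoc, add_assoc]
  exact congrArg (fun T => T x y z) this

lemma tz_zero_left (g : Fin d → ℕ) : tz 0 g = 0 := by simp [tz]

lemma tz_zero_right (g : Fin d → ℕ) : tz g 0 = 0 := by simp [tz]

lemma pz_one (g : Fin d → ℕ) : pz 1 g = 0 := by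
  unfold pz
  refine Finset.sum_eq_zero fun p _ => if_neg ?_
  rintro ⟨h1, h2⟩
  exact h1.not_gt h2

lemma pz_zero (σ : Equiv.Perm (Fin d)) : pz σ 0 = 0 := by simp [pz]

lemma one_mul' (x : WreathSuper F d) : 1 * x = x := by
  have : mulHom F d 1 = LinearMap.id := by
    refine hom_ext fun f π => ?_
    change mono F 0 1 * mono F f π = mono F f π
    have hs : (-1 : F) ^ signExp (0 : Fin d → ℕ) 1 f = 1 := by
      refine Eq.trans ?_ (pow_zero (-1 : F))
      apply neg_one_pow_congr
      simp [signExp, tensorSign_cast, permSign_cast, tz_zero_left, pz_one]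
    rw [mono_mul_mono, hs, one_smul, one_mul, zero_add]
    rfl
  exact congrArg (fun T => T x) this

lemma mul_one' (x : WreathSuper F d) : x * 1 = x := by
  have : (mulHom F d).flip 1 = LinearMap.id := by
    refine hom_ext fun f π => ?_
    change mono F f π * mono F 0 1 = mono F f π
    have hp : permute π (0 : Fin d → ℕ) = 0 := rfl
    have hs : (-1 : F) ^ signExp f π 0 = 1 := by
      refine Eq.trans ?_ (pow_zero (-1 : F))
      apply neg_one_pow_congr
      simp [signExp, tensorSign_cast, permSign_cast, hp, tz_zero_right, pz_zero]
    rw [mono_mul_mono, hs, one_smul, mul_one, hp, add_zero]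
  exact congrArg (fun T => T x) this

instance : Ring (WreathSuper F d) :=
  { (inferInstance : AddCommGroup (WreathSuper F d)),
    (inferInstance : Mul (WreathSuper F d)), (inferInstance : One (WreathSuper F d)) with
    left_distrib := fun x y z => map_add (mulHom F d x) y z
    right_distrib := fun x y z => by simp [mul_def]
    zero_mul := fun x => by simp [mul_def]
    mul_zero := fun x => by simp [mul_def]
    mul_assoc := mul_assoc'
    one_mul := one_mul'
    mul_one := mul_one' }

instance : Algebra F (WreathSuper F d) := Algebra.ofModule smul_mul' mul_smul'

/-! ### The modules `T(F, W)` -/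

/-- The linear map sending `(1 ⊗ ⋯ ⊗ 1 ; σ)` to `σ` and every other basis element to `0`. -/
def augLin (F : Type*) [Field F] (d : ℕ) :
    WreathSuper F d →ₗ[F] MonoidAlgebra F (Equiv.Perm (Fin d)) :=
  lift fun a => if a.1 = 0 then MonoidAlgebra.of F (Equiv.Perm (Fin d)) a.2 else 0

lemma augLin_mono (e : Fin d → ℕ) (σ : Equiv.Perm (Fin d)) :
    augLin F d (mono F e σ) =
      if e = 0 then MonoidAlgebra.of F (Equiv.Perm (Fin d)) σ else 0 := by
  by_cases he : ∀ i, e i < 3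
  · have h1 : mono F e σ = basis F (fun i => (⟨e i, he i⟩ : Fin 3), σ) := dif_pos he
    rw [h1, augLin, lift_basis]
    congr 1
    simp [funext_iff, Fin.ext_iff]
  · have h1 : mono F e σ = 0 := dif_neg he
    rw [h1, map_zero, if_neg]
    rintro rfl
    simp at he

/-- The surjection `A ≀ₛ 𝔖_d → F𝔖_d` that kills every `u` and is the identity on `𝔖_d`. -/
def aug (F : Type*) [Field F] (d : ℕ) :
    WreathSuper F d →+* MonoidAlgebra F (Equiv.Perm (Fin d)) :=
  { (augLin F d).toAddMonoidHom with
    map_one' := by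
      change augLin F d (mono F 0 1) = 1
      rw [augLin_mono, if_pos rfl, map_one]
    map_mul' := by
      have : (mulHom F d).compr₂ (augLin F d) =
          (LinearMap.mul F (MonoidAlgebra F (Equiv.Perm (Fin d)))).compl₁₂
            (augLin F d) (augLin F d) := by
        refine hom_ext fun e σ => hom_ext fun f π => ?_
        change augLin F d (mono F e σ * mono F f π) =
          augLin F d (mono F e σ) * augLin F d (mono F f π)
        rw [mono_mul_mono, map_smul, augLin_mono, augLin_mono, augLin_mono]
        by_cases he : e = 0
        · by_cases hf : f = 0
          · subst he hf
            have hp : permute σ (0 : Fin d → ℕ) = 0 := rfl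
            have hs : (-1 : F) ^ signExp (0 : Fin d → ℕ) σ 0 = 1 := by
              refine Eq.trans ?_ (pow_zero (-1 : F))
              apply neg_one_pow_congr
              simp [signExp, tensorSign_cast, permSign_cast, hp, tz_zero_right, pz_zero]
            simp [hs, hp]
          · rw [if_neg hf, mul_zero, if_neg, smul_zero]
            intro h
            apply hf
            funext i
            have := congrFun h (σ i)
            simp only [permute_apply, Pi.add_apply, Pi.zero_apply] at this
            simp only [Pi.zero_apply]
            omega
        · rw [if_neg he, zero_mul, if_neg, smul_zero]
          intro h
          apply he
          funext i
          have := congrFun h i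
          simp only [Pi.add_apply, Pi.zero_apply] at this
          simp only [Pi.zero_apply]
          omega
      intro x y
      exact congrArg (fun T => T x y) this }

end

end WreathSuper

/-- The `A ≀ₛ 𝔖_d`-module `T(F, W)`: the `F𝔖_d`-module `W` on which every `u` acts as `0`. -/
def TTriv (F : Type*) [Field F] (_d : ℕ) (W : Type*) : Type _ := W

namespace TTriv

noncomputable section

variable {F : Type*} [Field F] {d : ℕ} {W : Type*} [AddCommGroup W]

instance : AddCommGroup (TTriv F d W) := inferInstanceAs (AddCommGroup W)

instance [Module (MonoidAlgebra F (Equiv.Perm (Fin d))) W] :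
    Module (WreathSuper F d) (TTriv F d W) :=
  Module.compHom W (WreathSuper.aug F d)

end

end TTriv

/-! ## Specht modules and James modules of `F𝔖_d` -/

namespace Nat.Partition

variable {d : ℕ}

/-- The length of row `i` (counted from `0`) of a partition: its `i`-th part in weakly decreasing
order, and `0` beyond its last part. -/
def rowLength (ν : Nat.Partition d) (i : ℕ) : ℕ := (ν.parts.sort (· ≥ ·)).getD i 0

/-- The nodes `(r, c)` of the Young diagram (rows and columns counted from `0`). -/
abbrev Node (ν : Nat.Partition d) : Type := {p : ℕ × ℕ // p.2 < ν.rowLength p.1}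

/-- A `ν`-tableau: a bijective filling of the nodes by the `d` letters. -/
abbrev Tableau (ν : Nat.Partition d) : Type := ν.Node ≃ Fin d

/-- A `ν`-tabloid: it records the row of each letter, row `i` containing `ν_i` letters. -/
abbrev Tabloid (ν : Nat.Partition d) : Type :=
  {r : Fin d → ℕ // ∀ i, (Finset.univ.filter fun x => r x = i).card = ν.rowLength i}

instance (ν : Nat.Partition d) : MulAction (Equiv.Perm (Fin d)) ν.Tabloid where
  smul σ r := ⟨fun x => r.1 (σ⁻¹ x), fun i => by
    rw [← r.2 i]
    refine Finset.card_bij (fun x _ => σ⁻¹ x) ?_ ?_ ?_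
    · intro x hx; simpa using hx
    · intro x _ y _ h; exact σ⁻¹.injective h
    · intro y hy
      exact ⟨σ y, by simpa using hy, by simp⟩⟩
  one_smul r := rfl
  mul_smul σ π r := Subtype.ext (funext fun x => by
    change r.1 ((σ * π)⁻¹ x) = r.1 (π⁻¹ (σ⁻¹ x))
    rw [mul_inv_rev, Equiv.Perm.mul_apply])

/-- The row of a letter in a tableau. -/
def Tableau.row {ν : Nat.Partition d} (t : ν.Tableau) (x : Fin d) : ℕ := (t.symm x).1.1

/-- The column of a letter in a tableau. -/
def Tableau.col {ν : Nat.Partition d} (t : ν.Tableau) (x : Fin d) : ℕ := (t.symm x).1.2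

/-- The tabloid `{t}` of a tableau `t`. -/
def Tableau.tabloid {ν : Nat.Partition d} (t : ν.Tableau) : ν.Tabloid :=
  ⟨t.row, fun i => by
    rw [← Finset.card_range (ν.rowLength i)]
    refine Finset.card_bij (fun x _ => t.col x) ?_ ?_ ?_
    · intro x hx
      simp only [Finset.mem_filter, Finset.mem_univ, true_and] at hx
      subst hx
      exact Finset.mem_range.mpr (t.symm x).2
    · intro x hx y hy h
      simp only [Finset.mem_filter, Finset.mem_univ, true_and] at hx hy
      exact t.symm.injective (Subtype.ext (Prod.ext (hx.trans hy.symm) h))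
    · intro c hc
      refine ⟨t ⟨(i, c), Finset.mem_range.mp hc⟩, ?_, ?_⟩
      · refine Finset.mem_filter.mpr ⟨Finset.mem_univ _, ?_⟩
        simp [Tableau.row]
      · simp [Tableau.col]⟩

noncomputable section

variable (F : Type*) [Field F]

/-- The linear action of `𝔖_d` permuting the tabloids. -/
def tabloidRep (ν : Nat.Partition d) :
    Representation F (Equiv.Perm (Fin d)) (ν.Tabloid →₀ F) where
  toFun σ := Finsupp.lmapDomain F F (σ • ·)
  map_one' := by ext; simp
  map_mul' σ π := by ext; simp [mul_smul]

/-- The permutation module `M^ν` with basis the `ν`-tabloids, as an `F𝔖_d`-module. -/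
def PermModule (ν : Nat.Partition d) : Type _ := ν.Tabloid →₀ F

instance (ν : Nat.Partition d) : AddCommGroup (PermModule F ν) :=
  inferInstanceAs (AddCommGroup (ν.Tabloid →₀ F))

instance (ν : Nat.Partition d) : Module F (PermModule F ν) :=
  inferInstanceAs (Module F (ν.Tabloid →₀ F))

instance (ν : Nat.Partition d) :
    Module (MonoidAlgebra F (Equiv.Perm (Fin d))) (PermModule F ν) :=
  Module.compHom (ν.Tabloid →₀ F) (tabloidRep F ν).asAlgebraHom.toRingHom

/-- The polytabloid `e_t = ∑ sgn(π) {π t}`, the sum over the column stabiliser of `t`. -/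
def polytabloid {ν : Nat.Partition d} (t : ν.Tableau) : PermModule F ν :=
  (∑ π ∈ Finset.univ.filter fun π : Equiv.Perm (Fin d) => ∀ x, t.col (π x) = t.col x,
    Finsupp.single (π • t.tabloid) ((Equiv.Perm.sign π : ℤ) : F) : ν.Tabloid →₀ F)

/-- The Specht module `S^ν`: the submodule of `M^ν` generated by the polytabloids. -/
def specht (ν : Nat.Partition d) :
    Submodule (MonoidAlgebra F (Equiv.Perm (Fin d))) (PermModule F ν) :=
  Submodule.span _ (Set.range (polytabloid F (ν := ν)))

/-- The bilinear form on `M^ν` for which the tabloids are orthonormal. -/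
def form (ν : Nat.Partition d) : PermModule F ν →ₗ[F] PermModule F ν →ₗ[F] F :=
  (Finsupp.linearCombination F fun r : ν.Tabloid => (Finsupp.lapply r : (ν.Tabloid →₀ F) →ₗ[F] F) :
    (ν.Tabloid →₀ F) →ₗ[F] (ν.Tabloid →₀ F) →ₗ[F] F)

lemma form_single {F : Type*} [Field F] (ν : Nat.Partition d) (r s : ν.Tabloid) (a b : F) :
    form F ν (Finsupp.single r a : ν.Tabloid →₀ F) (Finsupp.single s b : ν.Tabloid →₀ F) =
      if s = r then a * b else 0 := by
  change Finsupp.linearCombination F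
    (fun r : ν.Tabloid => (Finsupp.lapply r : (ν.Tabloid →₀ F) →ₗ[F] F)) (Finsupp.single r a)
    (Finsupp.single s b) = _
  rw [Finsupp.linearCombination_single, LinearMap.smul_apply, Finsupp.lapply_apply,
    Finsupp.single_apply, smul_eq_mul, mul_ite, mul_zero]

lemma form_rep {F : Type*} [Field F] (ν : Nat.Partition d) (g : Equiv.Perm (Fin d)) (x y : ν.Tabloid →₀ F) :
    form F ν (tabloidRep F ν g x : ν.Tabloid →₀ F) y =
      form F ν x (tabloidRep F ν g⁻¹ y : ν.Tabloid →₀ F) := by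
  let B : (ν.Tabloid →₀ F) →ₗ[F] (ν.Tabloid →₀ F) →ₗ[F] F := form F ν
  have h : B ∘ₗ tabloidRep F ν g = B.compl₂ (tabloidRep F ν g⁻¹) := by
    refine Finsupp.lhom_ext' fun r => LinearMap.ext_ring (Finsupp.lhom_ext' fun s =>
      LinearMap.ext_ring ?_)
    change form F ν (Finsupp.mapDomain (g • ·) (Finsupp.single r 1)) (Finsupp.single s 1) =
      form F ν (Finsupp.single r 1) (Finsupp.mapDomain (g⁻¹ • ·) (Finsupp.single s 1))
    rw [Finsupp.mapDomain_single, Finsupp.mapDomain_single, form_single, form_single]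
    congr 1
    exact propext inv_smul_eq_iff.symm
  exact congrArg (fun T => T x y) h

/-- The orthogonal complement `S^ν⊥` of the Specht module in `M^ν`. -/
def spechtPerp (ν : Nat.Partition d) :
    Submodule (MonoidAlgebra F (Equiv.Perm (Fin d))) (PermModule F ν) where
  carrier := {x | ∀ y ∈ specht F ν, form F ν x y = 0}
  zero_mem' := fun y _ => by simp
  add_mem' := fun {x x'} hx hx' y hy => by simp [hx y hy, hx' y hy]
  smul_mem' := fun a x hx => by
    have key : ∀ (g : Equiv.Perm (Fin d)) (y : PermModule F ν), y ∈ specht F ν →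
        form F ν (tabloidRep F ν g x : ν.Tabloid →₀ F) y = 0 := by
      intro g y hy
      refine (form_rep ν g x y).trans (hx _ ?_)
      have := (specht F ν).smul_mem (MonoidAlgebra.of F _ g⁻¹) hy
      rwa [show MonoidAlgebra.of F _ g⁻¹ • y = (tabloidRep F ν g⁻¹ y : ν.Tabloid →₀ F) from
        congrArg (fun T => T y) ((tabloidRep F ν).asAlgebraHom_of g⁻¹)] at this
    intro y hy
    let L : MonoidAlgebra F (Equiv.Perm (Fin d)) →ₗ[F] F :=
      ((form F ν).flip y) ∘ₗ
        (LinearMap.applyₗ (R := F) (M := ν.Tabloid →₀ F) (M₂ := ν.Tabloid →₀ F) x) ∘ₗ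
          (tabloidRep F ν).asAlgebraHom.toLinearMap
    have hL : L = 0 := by
      ext g
      change form F ν ((tabloidRep F ν).asAlgebraHom (MonoidAlgebra.single g 1) x :
        ν.Tabloid →₀ F) y = 0
      rw [Representation.asAlgebraHom_single_one]
      exact key g y hy
    exact congrArg (fun T => T a) hL

/-- The module `D^μ = S^μ / (S^μ ∩ S^μ⊥)`; in characteristic `p` these modules for `μ` `p`-regular
are the James modules, the simple `F𝔖_d`-modules. -/
abbrev James (μ : Nat.Partition d) : Type _ :=
  specht F μ ⧸ (spechtPerp F μ).comap (specht F μ).subtype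

end

end Nat.Partition

/-! ## Composition multiplicities, projective covers and Cartan invariants -/

universe u

noncomputable section

/-- The composition multiplicity `[M : S]`: the number of factors isomorphic to `S` in a composition
series `0 = M₀ < ⋯ < M_n = M` (it does not depend on the series, by the Jordan–Hölder theorem). The
value is `0` if `M` has no composition series. -/
def compositionMultiplicity (R : Type*) [Ring R] (M S : Type*) [AddCommGroup M] [Module R M]
    [AddCommGroup S] [Module R S] : ℕ :=
  open Classical in
  if h : ∃ s : CompositionSeries (Submodule R M), s.head = ⊥ ∧ s.last = ⊤ then
    (Finset.univ.filter fun i : Fin h.choose.length =>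
      Nonempty ((h.choose i.succ ⧸
        (h.choose i.castSucc).comap (h.choose i.succ).subtype) ≃ₗ[R] S)).card
  else 0

/-- A projective cover of an `R`-module `M`: a projective module with a surjection onto `M` whose
kernel is superfluous. -/
structure ProjectiveCover (R : Type u) [Ring R] (M : Type u) [AddCommGroup M] [Module R M] where
  /-- The projective module. -/
  carrier : Type u
  [addCommGroup : AddCommGroup carrier]
  [module : Module R carrier]
  projective : Module.Projective R carrier
  /-- The covering map. -/
  toFun : carrier →ₗ[R] M
  surjective : Function.Surjective toFun
  superfluous : ∀ N : Submodule R carrier, N ⊔ LinearMap.ker toFun = ⊤ → N = ⊤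

attribute [instance] ProjectiveCover.addCommGroup ProjectiveCover.module

/-- The Cartan invariant of two simple `R`-modules `S`, `T`: the multiplicity of `S` as a
composition factor of the projective cover of `T` (which is unique up to isomorphism). The value is
`0` if `T` has no projective cover. -/
def cartanInvariant (R : Type u) [Ring R] (S T : Type u) [AddCommGroup S] [Module R S]
    [AddCommGroup T] [Module R T] : ℕ :=
  open Classical in
  if h : Nonempty (ProjectiveCover R T) then compositionMultiplicity R h.some.carrier S else 0

/-- The entry `c_{ν,π}` of the Cartan matrix of `A ≀ₛ 𝔖_d` in characteristic `0`: the multiplicity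
of `T(F, S^ν)` in the projective cover of `T(F, S^π)`. -/
def wreathCartan (F : Type u) [Field F] {d : ℕ} (ν π : Nat.Partition d) : ℕ :=
  cartanInvariant (WreathSuper F d) (TTriv F d (ν.specht F)) (TTriv F d (π.specht F))

/-- The entry `c_{μ,π}` (`μ`, `π` both `p`-regular) of the Cartan matrix of `A ≀ₛ 𝔖_d` in
characteristic `p`: the multiplicity of `T(F, D^μ)` in the projective cover of `T(F, D^π)`. -/
def wreathCartanModular (F : Type u) [Field F] {d : ℕ} (μ π : Nat.Partition d) : ℕ :=
  cartanInvariant (WreathSuper F d) (TTriv F d (μ.James F)) (TTriv F d (π.James F))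

end

/-! ## Projective covers over Artinian rings -/

/-! Write B for the wreath superproduct. The grading by total degree in u makes the kernel of the
augmentation B → F𝔖_d nilpotent, so the simple B-modules are the inflations T(F, W) of the simple
F𝔖_d-modules W, and an idempotent e of the group algebra that singles out W also singles out T(F, W)
(`exists_idempotent`). Since M ↦ eM is exact, [P : T(F, W)] · dim eW = dim eP
(`compositionMultiplicity_mul_eq`), which turns a Cartan invariant into a dimension.

Lower bound. The projective cover of T(F, W) maps onto the module induced from W, which is A^{⊗d} ⊗
W as a vector space and is realised as B modulo the left ideal generated by the annihilator of a
vector w ≠ 0. An 𝔖_d-equivariant map from it onto W^m shows that the invariant is at least m. In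
each degree 0, …, 2d the monomials with at most one odd factor are permuted without signs, so adding
up their coefficients is equivariant; this gives m = 2d + 1 (`le_cartanInvariant`). On monomials
with two factors 1 and all others u² there is a second equivariant map, which twists the coefficient
by the transposition of the two factors 1. It is independent of the first unless that transposition
acts on W as 1 or -1 (`lt_cartanInvariant_of_swap`).

There remain the W on which all transpositions act as ±1, that is, the linear characters. In
characteristic 0 let e be the idempotent of the character. A monomial with two odd factors is killed
under e by exchanging them, and the other monomials contribute one vector per degree, so the
invariant is at most 2d + 1 (`SwapsActAsSign.cartanInvariant_le`). In characteristic 3 the sum of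
all monomials with two factors 1, one factor u and all others u² has 3·C(d,3) terms. It is nonzero
and fixed by e, yet the degree maps kill it, so the invariant exceeds 2d + 1
(`SwapsActAsSign.lt_cartanInvariant`).

Simplicity of the modules in question comes from James' submodule theorem
(`specht_le_or_le_spechtPerp`) together with a nonzero value of the form on S^ν: a polytabloid
paired with itself in characteristic 0, and with its row reversal in characteristic 3. Finally
`swapsActAsSign_specht_iff` identifies the Specht modules on which transpositions act as ±1. -/

/-- A complemented submodule of a projective module is projective. -/
lemma Module.Projective.of_isCompl {A : Type*} [Ring A] {M : Type*} [AddCommGroup M] [Module A M]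
    [Module.Projective A M] {U V : Submodule A M} (h : IsCompl U V) : Module.Projective A U :=
  Module.Projective.of_split U.subtype (U.projectionOnto V h) (by
    ext x; simp)

/-- Finitely generated cyclic modules over an Artinian ring have projective covers. -/
theorem exists_projectiveCover {A : Type u} [Ring A] [IsArtinianRing A] {T : Type u}
    [AddCommGroup T] [Module A T] (π : A →ₗ[A] T) (hπ : Function.Surjective π) :
    Nonempty (ProjectiveCover A T) := by
  -- The cover is a projective left ideal that is minimal among those mapping onto T.
  let C : Set (Submodule A A) := {P | Module.Projective A P ∧ P.map π = ⊤}
  have hC : C.Nonempty := by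
    refine ⟨⊤, Module.Projective.of_isCompl isCompl_top_bot, ?_⟩
    rw [Submodule.map_top, LinearMap.range_eq_top.2 hπ]
  obtain ⟨P, ⟨hP, hPT⟩, hmin⟩ := (wellFounded_lt (α := Submodule A A)).has_min C hC
  have hsurj : Function.Surjective (π ∘ₗ P.subtype) := by
    rw [← LinearMap.range_eq_top, LinearMap.range_comp, Submodule.range_subtype, hPT]
  refine ⟨⟨P, hP, π ∘ₗ P.subtype, hsurj, fun N hN => ?_⟩⟩
  have hNs : Function.Surjective ((π ∘ₗ P.subtype) ∘ₗ N.subtype) := by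
    intro t
    obtain ⟨p, rfl⟩ := hsurj t
    obtain ⟨n, hn, k, hk, rfl⟩ := Submodule.mem_sup.1 (hN ▸ Submodule.mem_top (x := p))
    refine ⟨⟨n, hn⟩, ?_⟩
    rw [map_add, LinearMap.mem_ker.1 hk, add_zero]
    rfl
  -- Lifting P → T through N → T gives an endomorphism φ of P over T with image in N.
  obtain ⟨f, hf⟩ := Module.projective_lifting_property _ (π ∘ₗ P.subtype) hNs
  let φ : Module.End A P := N.subtype ∘ₗ f
  have hφ : (π ∘ₗ P.subtype) ∘ₗ φ = π ∘ₗ P.subtype := hf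
  have hφn : ∀ n : ℕ, (π ∘ₗ P.subtype) ∘ₗ (φ ^ n) = π ∘ₗ P.subtype := by
    intro n
    induction n with
    | zero => rfl
    | succ n ih =>
      rw [pow_succ', Module.End.mul_eq_comp, ← LinearMap.comp_assoc, hφ, ih]
  -- Fitting's lemma: the image of φ^n is a direct summand of P, hence projective, and it still maps
  -- onto T. Minimality makes it all of P. The condition n ≥ 1 keeps this image inside N.
  obtain ⟨n, hn, hn1⟩ :=
    (φ.eventually_isCompl_ker_pow_range_pow.and (Filter.eventually_ge_atTop 1)).exists
  have hproj : Module.Projective A (LinearMap.range (φ ^ n)) :=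
    Module.Projective.of_isCompl hn.symm
  have htop : LinearMap.range (φ ^ n) = ⊤ := by
    by_contra hne
    refine hmin ((LinearMap.range (φ ^ n)).map P.subtype) ⟨?_, ?_⟩ ?_
    · exact Module.Projective.of_equiv
        (Submodule.equivMapOfInjective P.subtype P.injective_subtype _)
    · rw [← Submodule.map_comp, ← LinearMap.range_comp, hφn, LinearMap.range_eq_top.2 hsurj]
    · refine lt_of_le_of_ne (Submodule.map_subtype_le _ _) fun h => hne ?_
      apply Submodule.map_injective_of_injective P.injective_subtype
      rw [h, Submodule.map_top, Submodule.range_subtype]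
  rw [eq_top_iff, ← htop]
  obtain ⟨m, rfl⟩ := Nat.exists_eq_add_of_le' hn1
  rw [pow_succ', Module.End.mul_eq_comp, LinearMap.comp_assoc]
  exact (LinearMap.range_comp_le_range _ _).trans N.range_subtype.le

lemma exists_surjective_of_isSimpleModule (A : Type*) [Ring A] (T : Type*) [AddCommGroup T]
    [Module A T] [IsSimpleModule A T] {w : T} (hw : w ≠ 0) (t : T) : ∃ a : A, a • w = t := by
  have h : Submodule.span A {w} = ⊤ :=
    (eq_bot_or_eq_top _).resolve_left fun h => hw (Submodule.span_singleton_eq_bot.1 h)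
  exact Submodule.mem_span_singleton.1 (h ▸ Submodule.mem_top)

/-- For a simple module `W` over an Artinian ring there is an idempotent which does not annihilate
`W` and annihilates every simple module that is not isomorphic to `W`. -/
theorem exists_idempotent_of_isSimpleModule {A : Type u} [Ring A] [IsArtinianRing A] (W : Type u)
    [AddCommGroup W] [Module A W] [IsSimpleModule A W] :
    ∃ e : A, IsIdempotentElem e ∧ (∃ w : W, e • w ≠ 0) ∧
      ∀ (S : Type u) [AddCommGroup S] [Module A S] [IsSimpleModule A S],
        (∃ x : S, e • x ≠ 0) → Nonempty (S ≃ₗ[A] W) := by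
  have := IsSimpleModule.nontrivial A W
  obtain ⟨w, hw⟩ := exists_ne (0 : W)
  obtain ⟨P⟩ := exists_projectiveCover (LinearMap.toSpanSingleton A W w)
    fun t => exists_surjective_of_isSimpleModule A W hw t
  have := P.projective
  obtain ⟨p, hp⟩ := P.surjective w
  have hspan : Submodule.span A {p} = ⊤ := by
    refine P.superfluous _ (eq_top_iff.2 fun x _ => ?_)
    obtain ⟨a, ha⟩ := exists_surjective_of_isSimpleModule A W hw (P.toFun x)
    refine Submodule.mem_sup.2 ⟨a • p, Submodule.smul_mem _ _ (Submodule.mem_span_singleton_self p),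
      x - a • p, ?_, by abel⟩
    rw [LinearMap.mem_ker, map_sub, map_smul, hp, ha, sub_self]
  -- The surjection a ↦ a • p splits, so P is a summand of A; the idempotent is the image s p of its
  -- generator.
  obtain ⟨s, hs⟩ := Module.projective_lifting_property (LinearMap.toSpanSingleton A P.carrier p)
    (.id) (fun x => Submodule.mem_span_singleton.1 (hspan ▸ Submodule.mem_top (x := x)))
  have hs' : s p • p = p := congrArg (fun f => f p) hs
  refine ⟨s p, ?_, ⟨w, ?_⟩, ?_⟩
  · change s p * s p = s p
    rw [← smul_eq_mul, ← map_smul, hs']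
  · rwa [← hp, ← map_smul, hs', hp]
  · rintro S _ _ _ ⟨x, hx⟩
    let g : P.carrier →ₗ[A] S := LinearMap.toSpanSingleton A S x ∘ₗ s
    have hg : g ≠ 0 := fun h => hx (by simpa [g] using congrArg (fun f => f p) h)
    have hgs : Function.Surjective g := LinearMap.surjective_of_ne_zero hg
    -- Both kernels are maximal submodules of P. If they differed they would span P, against the
    -- superfluity of one of them.
    have hker : LinearMap.ker g = LinearMap.ker P.toFun := by
      have h1 : IsCoatom (LinearMap.ker g) := by
        rw [← isSimpleModule_iff_isCoatom]
        exact IsSimpleModule.congr (g.quotKerEquivOfSurjective hgs)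
      have h2 : IsCoatom (LinearMap.ker P.toFun) := by
        rw [← isSimpleModule_iff_isCoatom]
        exact IsSimpleModule.congr (P.toFun.quotKerEquivOfSurjective P.surjective)
      by_contra hne
      exact h1.1 (P.superfluous _ (h1.codisjoint_of_ne h2 hne).eq_top)
    exact ⟨(g.quotKerEquivOfSurjective hgs).symm ≪≫ₗ Submodule.quotEquivOfEq _ _ hker ≪≫ₗ
      P.toFun.quotKerEquivOfSurjective P.surjective⟩

/-! ## Composition multiplicities and idempotents -/

section IdempotentDimension

open Module

variable {F : Type*} [Field F] {A : Type*} [Ring A] [Algebra F A]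
  {M : Type*} [AddCommGroup M] [Module F M] [Module A M] [IsScalarTower F A M]
  {M' : Type*} [AddCommGroup M'] [Module F M'] [Module A M'] [IsScalarTower F A M']

/-- The subspace `e M` of an `A`-module `M`. -/
abbrev idemPart (F : Type*) [Field F] {A : Type*} [Ring A] [Algebra F A] (e : A)
    (M : Type*) [AddCommGroup M] [Module F M] [Module A M] [IsScalarTower F A M] : Submodule F M :=
  LinearMap.range (Algebra.lsmul F F M e)

lemma mem_idemPart {e : A} (he : IsIdempotentElem e) {x : M} :
    x ∈ idemPart F e M ↔ e • x = x := by
  constructor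
  · rintro ⟨y, rfl⟩
    change e • e • y = e • y
    rw [smul_smul, he.eq]
  · exact fun h => ⟨x, h⟩

lemma LinearEquiv.finrank_idemPart_eq (e : A) (f : M ≃ₗ[A] M') :
    finrank F (idemPart F e M) = finrank F (idemPart F e M') := by
  have h : idemPart F e M' = (idemPart F e M).map (f.restrictScalars F : M →ₗ[F] M') := by
    ext y
    constructor
    · rintro ⟨x, rfl⟩
      exact ⟨e • f.symm x, ⟨f.symm x, rfl⟩, by simp⟩
    · rintro ⟨_, ⟨x, rfl⟩, rfl⟩
      exact ⟨f x, by simp⟩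
  rw [h]
  exact (LinearEquiv.finrank_map_eq (f.restrictScalars F) _).symm

/-- The functor M ↦ eM is exact: an element of eM that lies in N is fixed by e, hence lies in eN. -/
lemma finrank_idemPart_add [Module.Finite F M] {e : A} (he : IsIdempotentElem e)
    (N : Submodule A M) :
    finrank F (idemPart F e M) =
      finrank F (idemPart F e N) + finrank F (idemPart F e (M ⧸ N)) := by
  let q : idemPart F e M →ₗ[F] M ⧸ N := (N.mkQ.restrictScalars F) ∘ₗ (idemPart F e M).subtype
  have hr : LinearMap.range q = idemPart F e (M ⧸ N) := by
    ext y
    constructor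
    · rintro ⟨⟨_, ⟨x, rfl⟩⟩, rfl⟩
      exact ⟨N.mkQ x, by simp [q]⟩
    · rintro ⟨y, rfl⟩
      obtain ⟨x, rfl⟩ := N.mkQ_surjective y
      exact ⟨⟨e • x, ⟨x, rfl⟩⟩, by simp [q]⟩
  let j : idemPart F e N →ₗ[F] idemPart F e M :=
    LinearMap.codRestrict _ ((N.subtype.restrictScalars F) ∘ₗ (idemPart F e N).subtype) (by
      rintro ⟨_, ⟨x, rfl⟩⟩
      exact ⟨x, rfl⟩)
  have hj : Function.Injective j := by
    intro x y h
    exact Subtype.ext (Subtype.ext (congrArg (fun z : idemPart F e M => (z : M)) h))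
  have hk : LinearMap.ker q = LinearMap.range j := by
    ext ⟨y, hy⟩
    constructor
    · intro h
      have hN : y ∈ N := (Submodule.Quotient.mk_eq_zero N).1 h
      refine ⟨⟨⟨y, hN⟩, (mem_idemPart he).2 (Subtype.ext ((mem_idemPart he).1 hy))⟩, rfl⟩
    · rintro ⟨⟨⟨x, hx⟩, _⟩, h⟩
      have : x = y := congrArg Subtype.val h
      subst this
      exact (Submodule.Quotient.mk_eq_zero N).2 hx
  have := LinearMap.finrank_range_add_finrank_ker q
  rw [hr, hk, LinearMap.finrank_range_of_inj hj] at this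
  omega

lemma Fin.telescope : ∀ {n : ℕ} (g : Fin (n + 1) → ℕ) (h : Fin n → ℕ),
    (∀ i, g i.succ = g i.castSucc + h i) → g (Fin.last n) = g 0 + ∑ i, h i
  | 0, g, h, _ => by simp
  | n + 1, g, h, H => by
    have := Fin.telescope (fun i => g i.castSucc) (fun i => h i.castSucc) fun i => by
      have := H i.castSucc
      simpa using this
    rw [Fin.sum_univ_castSucc, ← add_assoc]
    have h1 := H (Fin.last n)
    rw [Fin.succ_last] at h1
    rw [h1, this]
    simp

lemma finrank_idemPart_compositionSeries [Module.Finite F M] {e : A} (he : IsIdempotentElem e)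
    (s : CompositionSeries (Submodule A M)) (h0 : s.head = ⊥) (h1 : s.last = ⊤) :
    finrank F (idemPart F e M) = ∑ i : Fin s.length,
      finrank F (idemPart F e (s i.succ ⧸ (s i.castSucc).comap (s i.succ).subtype)) := by
  have hstep : ∀ i : Fin s.length, finrank F (idemPart F e (s i.succ)) =
      finrank F (idemPart F e (s i.castSucc)) +
      finrank F (idemPart F e (s i.succ ⧸ (s i.castSucc).comap (s i.succ).subtype)) := by
    intro i
    have := Module.Finite.of_injective ((s i.succ).subtype.restrictScalars F)
      (s i.succ).injective_subtype
    rw [finrank_idemPart_add he ((s i.castSucc).comap (s i.succ).subtype)]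
    congr 1
    exact LinearEquiv.finrank_idemPart_eq e
      (Submodule.comapSubtypeEquivOfLe (s.strictMono i.castSucc_lt_succ).le)
  have h := Fin.telescope (fun i => finrank F (idemPart F e (s i))) _ hstep
  have hl : s (Fin.last _) = ⊤ := h1
  have hh : s 0 = ⊥ := h0
  have hz : finrank F (idemPart F e (s 0)) = 0 := by
    have : Subsingleton (s 0) := by rw [hh]; infer_instance
    exact finrank_zero_of_subsingleton
  have ht : finrank F (idemPart F e (s (Fin.last _))) = finrank F (idemPart F e M) := by
    rw [hl]
    exact LinearEquiv.finrank_idemPart_eq e Submodule.topEquiv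
  rw [← ht, h, hz, zero_add]

lemma exists_compositionSeries_of_finite (F : Type*) [Field F] {A : Type*} [Ring A] [Algebra F A]
    (M : Type*) [AddCommGroup M] [Module F M] [Module A M] [IsScalarTower F A M]
    [Module.Finite F M] :
    ∃ s : CompositionSeries (Submodule A M), s.head = ⊥ ∧ s.last = ⊤ := by
  have : IsNoetherian A M := isNoetherian_of_tower F inferInstance
  have : IsArtinian A M := isArtinian_of_tower F inferInstance
  exact exists_compositionSeries_of_isNoetherian_isArtinian A M

/-- The multiplicity of `T` in `M` is at most `dim eM / dim eT`. -/
theorem compositionMultiplicity_mul_le [Module.Finite F M] {e : A} (he : IsIdempotentElem e) :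
    compositionMultiplicity A M M' * finrank F (idemPart F e M') ≤ finrank F (idemPart F e M) := by
  classical
  have h := exists_compositionSeries_of_finite F (A := A) M
  rw [compositionMultiplicity, dif_pos h,
    finrank_idemPart_compositionSeries he h.choose h.choose_spec.1 h.choose_spec.2,
    ← smul_eq_mul, ← Finset.sum_const]
  refine le_trans (Finset.sum_le_sum fun i hi => ?_) (Finset.sum_le_sum_of_subset
    (Finset.filter_subset _ _))
  obtain ⟨f⟩ := (Finset.mem_filter.1 hi).2
  exact (LinearEquiv.finrank_idemPart_eq e f).ge

/-- The multiplicity of `T` in `M` is `dim eM / dim eT` if `e` annihilates the simple modules that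
are not isomorphic to `T`. -/
theorem compositionMultiplicity_mul_eq {F A M M' : Type u} [Field F] [Ring A] [Algebra F A]
    [AddCommGroup M] [Module F M] [Module A M] [IsScalarTower F A M]
    [AddCommGroup M'] [Module F M'] [Module A M'] [IsScalarTower F A M']
    [Module.Finite F M] {e : A} (he : IsIdempotentElem e)
    (hS : ∀ (S : Type u) [AddCommGroup S] [Module A S] [IsSimpleModule A S],
        (∃ x : S, e • x ≠ 0) → Nonempty (S ≃ₗ[A] M')) :
    compositionMultiplicity A M M' * finrank F (idemPart F e M') = finrank F (idemPart F e M) := by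
  classical
  refine (compositionMultiplicity_mul_le he).antisymm ?_
  have h := exists_compositionSeries_of_finite F (A := A) M
  rw [compositionMultiplicity, dif_pos h]
  generalize h.choose = s, h.choose_spec = hs
  obtain ⟨h0, h1⟩ := hs
  rw [finrank_idemPart_compositionSeries he s h0 h1,
    ← smul_eq_mul, ← Finset.sum_const, Finset.sum_filter]
  refine Finset.sum_le_sum fun i _ => ?_
  split_ifs with hi
  · obtain ⟨f⟩ := hi
    exact (LinearEquiv.finrank_idemPart_eq e f).le
  · have hs : IsSimpleModule A (s i.succ ⧸ (s i.castSucc).comap (s i.succ).subtype) :=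
      (covBy_iff_quot_is_simple (s.strictMono i.castSucc_lt_succ).le).1 (s.step i)
    have hz : idemPart F e (s i.succ ⧸ (s i.castSucc).comap (s i.succ).subtype) = ⊥ := by
      rw [LinearMap.range_eq_bot]
      refine LinearMap.ext fun x => ?_
      by_contra hx
      exact hi (hS _ ⟨x, hx⟩)
    rw [hz, finrank_bot]

end IdempotentDimension

/-! ## The radical of the wreath superproduct -/

namespace WreathSuper

noncomputable section

variable {F : Type*} [Field F] {d : ℕ}

instance : Module.Finite F (WreathSuper F d) := inferInstanceAs (Module.Finite F (Idx d →₀ F))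

lemma mono_zero_mul_mono (σ : Equiv.Perm (Fin d)) (f : Fin d → ℕ) (π : Equiv.Perm (Fin d)) :
    mono F 0 σ * mono F f π = (-1 : F) ^ permSign σ f • mono F (permute σ f) (σ * π) := by
  rw [mono_mul_mono, zero_add]
  congr 1
  apply neg_one_pow_congr
  simp [signExp, tensorSign_cast, tz_zero_left]

lemma permute_zero (σ : Equiv.Perm (Fin d)) : permute σ (0 : Fin d → ℕ) = 0 := rfl

lemma mono_mul_mono_zero (e : Fin d → ℕ) (σ π : Equiv.Perm (Fin d)) :
    mono F e σ * mono F 0 π = mono F e (σ * π) := by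
  rw [mono_mul_mono, permute_zero, add_zero]
  convert one_smul F _
  refine Eq.trans ?_ (pow_zero (-1 : F))
  apply neg_one_pow_congr
  simp [signExp, tensorSign_cast, permSign_cast, permute_zero, tz_zero_right, pz_zero]

/-- The embedding of the group algebra in the wreath superproduct. -/
def iota (F : Type*) [Field F] (d : ℕ) :
    MonoidAlgebra F (Equiv.Perm (Fin d)) →ₐ[F] WreathSuper F d :=
  MonoidAlgebra.lift F (WreathSuper F d) (Equiv.Perm (Fin d))
    { toFun := fun σ => mono F 0 σ
      map_one' := rfl
      map_mul' := fun σ π => (mono_mul_mono_zero 0 σ π).symm }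

lemma iota_of (σ : Equiv.Perm (Fin d)) : iota F d (MonoidAlgebra.of F _ σ) = mono F 0 σ := by
  rw [iota, MonoidAlgebra.lift_of]
  rfl

lemma aug_smul (c : F) (r : WreathSuper F d) : aug F d (c • r) = c • aug F d r :=
  (augLin F d).map_smul c r

lemma aug_mono (e : Fin d → ℕ) (σ : Equiv.Perm (Fin d)) :
    aug F d (mono F e σ) = if e = 0 then MonoidAlgebra.of F (Equiv.Perm (Fin d)) σ else 0 :=
  augLin_mono e σ

lemma aug_iota (a : MonoidAlgebra F (Equiv.Perm (Fin d))) : aug F d (iota F d a) = a := by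
  have : augLin F d ∘ₗ (iota F d).toLinearMap = LinearMap.id := by
    ext σ : 2
    change aug F d (iota F d (MonoidAlgebra.of F _ σ)) = MonoidAlgebra.of F _ σ
    rw [iota_of, aug_mono, if_pos rfl]
  exact congrArg (fun f => f a) this

/-- The span of the basis elements of degree at least `k`. -/
def degGE (F : Type*) [Field F] (d k : ℕ) : Submodule F (WreathSuper F d) :=
  Submodule.span F {x | ∃ e : Fin d → ℕ, ∃ σ, k ≤ ∑ i, e i ∧ x = mono F e σ}

lemma degGE_mul_le (k l : ℕ) : degGE F d k * degGE F d l ≤ degGE F d (k + l) := by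
  rw [degGE, degGE, Submodule.span_mul_span, Submodule.span_le]
  rintro _ ⟨_, ⟨e, σ, he, rfl⟩, _, ⟨f, π, hf, rfl⟩, rfl⟩
  change mono F e σ * mono F f π ∈ _
  rw [mono_mul_mono]
  refine Submodule.smul_mem _ _ (Submodule.subset_span ⟨_, _, ?_, rfl⟩)
  have : ∑ i, permute σ f i = ∑ i, f i := Equiv.sum_comp (σ⁻¹) f
  simp only [Pi.add_apply, Finset.sum_add_distrib, this]
  omega

/-- Each of the d factors contributes degree at most 2, because u³ = 0. -/
lemma degGE_eq_bot : degGE F d (2 * d + 1) = ⊥ := by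
  rw [degGE, Submodule.span_eq_bot]
  rintro _ ⟨e, σ, he, rfl⟩
  refine dif_neg fun h => ?_
  have : ∑ i, e i ≤ ∑ _i : Fin d, 2 := Finset.sum_le_sum fun i _ => Nat.le_of_lt_succ (h i)
  simp at this
  omega

lemma sub_iota_aug_mem (r : WreathSuper F d) : r - iota F d (aug F d r) ∈ degGE F d 1 := by
  have : (degGE F d 1).mkQ ∘ₗ (LinearMap.id - (iota F d).toLinearMap ∘ₗ augLin F d) = 0 := by
    refine hom_ext fun e σ => ?_
    change (degGE F d 1).mkQ (mono F e σ - iota F d (aug F d (mono F e σ))) = 0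
    rw [aug_mono]
    split_ifs with h
    · rw [h, iota_of, sub_self, map_zero]
    · rw [map_zero, sub_zero, Submodule.mkQ_apply, Submodule.Quotient.mk_eq_zero]
      refine Submodule.subset_span ⟨e, σ, ?_, rfl⟩
      by_contra hs
      refine h (funext fun i => ?_)
      have := Finset.sum_eq_zero_iff.1 (Nat.lt_one_iff.1 (not_le.1 hs)) i (Finset.mem_univ i)
      exact this
  exact (Submodule.Quotient.mk_eq_zero _).1 (congrArg (fun f => f r) this)

/-- The kernel of the augmentation consists of elements of positive degree, and degrees add up under
multiplication. -/
lemma isNilpotent_of_aug_eq_zero {r : WreathSuper F d} (hr : aug F d r = 0) : IsNilpotent r := by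
  have h1 : r ∈ degGE F d 1 := by
    have := sub_iota_aug_mem r
    rwa [hr, map_zero, sub_zero] at this
  have hn : ∀ n : ℕ, r ^ (n + 1) ∈ degGE F d (n + 1) := by
    intro n
    induction n with
    | zero => simpa using h1
    | succ n ih =>
      rw [pow_succ]
      exact degGE_mul_le _ _ (Submodule.mul_mem_mul ih h1)
  refine ⟨2 * d + 1, ?_⟩
  have := hn (2 * d)
  rwa [degGE_eq_bot, Submodule.mem_bot] at this

/-- The kernel of the augmentation annihilates all simple modules. -/
lemma smul_eq_zero_of_aug_eq_zero {S : Type*} [AddCommGroup S] [Module (WreathSuper F d) S]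
    [IsSimpleModule (WreathSuper F d) S] {r : WreathSuper F d} (hr : aug F d r = 0) (x : S) :
    r • x = 0 := by
  by_contra hx
  -- Simplicity brings r • x back to x by some a. Then 1 - a * r kills x, although it is a unit
  -- because a * r is nilpotent.
  obtain ⟨a, ha⟩ := exists_surjective_of_isSimpleModule (WreathSuper F d) S hx x
  have hu : IsUnit (1 - a * r) := by
    refine IsNilpotent.isUnit_one_sub (isNilpotent_of_aug_eq_zero ?_)
    rw [map_mul, hr, mul_zero]
  obtain ⟨b, hb⟩ := hu.exists_left_inv
  apply hx
  have : (1 - a * r) • x = 0 := by rw [sub_smul, one_smul, mul_smul, ha, sub_self]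
  rw [← one_smul (WreathSuper F d) x, ← hb, mul_smul, this, smul_zero, smul_zero]

lemma smul_eq_iota_aug_smul {S : Type*} [AddCommGroup S] [Module (WreathSuper F d) S]
    [IsSimpleModule (WreathSuper F d) S] (r : WreathSuper F d) (x : S) :
    r • x = iota F d (aug F d r) • x := by
  rw [← sub_eq_zero, ← sub_smul]
  exact smul_eq_zero_of_aug_eq_zero (by rw [map_sub, aug_iota, sub_self]) x

end

end WreathSuper

namespace TTriv

/-- The element `w` of `W`, viewed in `T(F, W)`. -/
def mk {F : Type*} [Field F] {d : ℕ} {W : Type*} (w : W) : TTriv F d W := w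

variable {F : Type*} [Field F] {d : ℕ} {W : Type*} [AddCommGroup W]
  [Module (MonoidAlgebra F (Equiv.Perm (Fin d))) W]

lemma smul_mk (r : WreathSuper F d) (w : W) :
    r • (mk w : TTriv F d W) = mk (WreathSuper.aug F d r • w) := rfl

instance [IsSimpleModule (MonoidAlgebra F (Equiv.Perm (Fin d))) W] :
    IsSimpleModule (WreathSuper F d) (TTriv F d W) := by
  have : Nontrivial (TTriv F d W) :=
    IsSimpleModule.nontrivial (MonoidAlgebra F (Equiv.Perm (Fin d))) W
  refine isSimpleModule_iff_toSpanSingleton_surjective.2 ⟨this, fun w hw x => ?_⟩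
  let w' : W := w
  have hw' : w' ≠ 0 := hw
  obtain ⟨a, ha⟩ := exists_surjective_of_isSimpleModule
    (MonoidAlgebra F (Equiv.Perm (Fin d))) W hw' x
  refine ⟨WreathSuper.iota F d a, ?_⟩
  change WreathSuper.aug F d (WreathSuper.iota F d a) • w' = x
  rw [WreathSuper.aug_iota]
  exact ha

end TTriv

namespace WreathSuper

/-- There is an idempotent of the group algebra which detects `T(F, W)` among all simple modules of
the wreath superproduct. -/
theorem exists_idempotent {F : Type u} [Field F] {d : ℕ} (W : Type u) [AddCommGroup W]
    [Module (MonoidAlgebra F (Equiv.Perm (Fin d))) W]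
    [IsSimpleModule (MonoidAlgebra F (Equiv.Perm (Fin d))) W] :
    ∃ e : MonoidAlgebra F (Equiv.Perm (Fin d)), IsIdempotentElem e ∧ (∃ w : W, e • w ≠ 0) ∧
      ∀ (S : Type u) [AddCommGroup S] [Module (WreathSuper F d) S]
        [IsSimpleModule (WreathSuper F d) S],
        (∃ x : S, iota F d e • x ≠ 0) → Nonempty (S ≃ₗ[WreathSuper F d] TTriv F d W) := by
  have : IsArtinianRing (MonoidAlgebra F (Equiv.Perm (Fin d))) :=
    IsArtinianRing.of_finite F _
  obtain ⟨e, he, hw, hS⟩ := exists_idempotent_of_isSimpleModule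
    (A := MonoidAlgebra F (Equiv.Perm (Fin d))) W
  refine ⟨e, he, hw, ?_⟩
  intro S _ _ _ hx
  -- S is restricted to the group algebra. It stays simple, because every r acts on S like `iota` of
  -- its augmentation.
  let inst : Module (MonoidAlgebra F (Equiv.Perm (Fin d))) S :=
    Module.compHom S (iota F d).toRingHom
  have hsm : ∀ (a : MonoidAlgebra F (Equiv.Perm (Fin d))) (x : S), a • x = iota F d a • x :=
    fun _ _ => rfl
  have : Nontrivial S := IsSimpleModule.nontrivial (WreathSuper F d) S
  have : IsSimpleModule (MonoidAlgebra F (Equiv.Perm (Fin d))) S := by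
    refine isSimpleModule_iff_toSpanSingleton_surjective.2 ⟨this, fun y hy x => ?_⟩
    obtain ⟨a, ha⟩ := exists_surjective_of_isSimpleModule (WreathSuper F d) S hy x
    refine ⟨aug F d a, ?_⟩
    change aug F d a • y = x
    rw [hsm, ← smul_eq_iota_aug_smul, ha]
  obtain ⟨f⟩ := hS S hx
  refine ⟨{ (f : S ≃+ W) with map_smul' := fun r x => ?_ }⟩
  change f (r • x) = aug F d r • f x
  rw [smul_eq_iota_aug_smul, ← hsm, map_smul]

end WreathSuper

/-! ## The induced module and its maps -/

namespace WreathSuper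

noncomputable section

variable {F : Type*} [Field F] {d : ℕ}

lemma basis_ext {M : Type*} [AddCommMonoid M] [Module F M] {φ ψ : WreathSuper F d →ₗ[F] M}
    (h : ∀ e σ, φ (basis F (e, σ)) = ψ (basis F (e, σ))) : φ = ψ :=
  Finsupp.lhom_ext' fun a => LinearMap.ext_ring (h a.1 a.2)

lemma groupAlgebra_ext {M : Type*} [AddCommMonoid M] [Module F M]
    {φ ψ : MonoidAlgebra F (Equiv.Perm (Fin d)) →ₗ[F] M}
    (h : ∀ σ, φ (MonoidAlgebra.of F _ σ) = ψ (MonoidAlgebra.of F _ σ)) : φ = ψ := by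
  ext σ : 2
  exact h σ

lemma mono_zero_mul_basis (σ : Equiv.Perm (Fin d)) (e : Fin d → Fin 3) (π : Equiv.Perm (Fin d)) :
    mono F 0 σ * basis F (e, π) =
      (-1 : F) ^ permSign σ (fun i => e i) • basis F (e ∘ ⇑(σ⁻¹), σ * π) := by
  rw [basis_eq_mono, mono_zero_mul_mono, basis_eq_mono]
  rfl

lemma basis_mul_mono_zero (e : Fin d → Fin 3) (π σ : Equiv.Perm (Fin d)) :
    basis F (e, π) * mono F 0 σ = basis F (e, π * σ) := by
  rw [basis_eq_mono, mono_mul_mono_zero, basis_eq_mono]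

variable {W : Type*} [AddCommGroup W] [Module (MonoidAlgebra F (Equiv.Perm (Fin d))) W]

/-- The left ideal of the wreath superproduct generated by the annihilator of `w` in the group
algebra. The quotient by it is the module induced from the module generated by `w`. -/
def annIdeal (w : W) : Submodule (WreathSuper F d) (WreathSuper F d) :=
  Submodule.span _ {x | ∃ l : MonoidAlgebra F (Equiv.Perm (Fin d)), l • w = 0 ∧ x = iota F d l}

variable [Module F W] {Y : Type*} [AddCommGroup Y] [Module F Y]

/-- The linear map `(u^e ; σ) ↦ A_e (σ w)`. -/
def coeffMap (w : W) (A : (Fin d → Fin 3) → W →ₗ[F] Y) : WreathSuper F d →ₗ[F] Y :=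
  lift fun a => A a.1 (MonoidAlgebra.of F _ a.2 • w)

lemma coeffMap_basis (w : W) (A : (Fin d → Fin 3) → W →ₗ[F] Y) (e : Fin d → Fin 3)
    (σ : Equiv.Perm (Fin d)) :
    coeffMap w A (basis F (e, σ)) = A e (MonoidAlgebra.of F _ σ • w) :=
  lift_basis _ _

variable [IsScalarTower F (MonoidAlgebra F (Equiv.Perm (Fin d))) W]

lemma coeffMap_basis_mul_iota (w : W) (A : (Fin d → Fin 3) → W →ₗ[F] Y) (e : Fin d → Fin 3)
    (σ : Equiv.Perm (Fin d)) (l : MonoidAlgebra F (Equiv.Perm (Fin d))) :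
    coeffMap w A (basis F (e, σ) * iota F d l) = A e (MonoidAlgebra.of F _ σ • l • w) := by
  have : coeffMap w A ∘ₗ LinearMap.mulLeft F (basis F (e, σ)) ∘ₗ (iota F d).toLinearMap =
      A e ∘ₗ Algebra.lsmul F F W (MonoidAlgebra.of F _ σ) ∘ₗ
        (LinearMap.toSpanSingleton (MonoidAlgebra F (Equiv.Perm (Fin d))) W w).restrictScalars F := by
    refine groupAlgebra_ext fun π => ?_
    change coeffMap w A (basis F (e, σ) * iota F d (MonoidAlgebra.of F _ π)) =
      A e (MonoidAlgebra.of F _ σ • MonoidAlgebra.of F _ π • w)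
    rw [iota_of, basis_mul_mono_zero, coeffMap_basis, map_mul, mul_smul]
  exact congrArg (fun f => f l) this

/-- Right multiplication by l in the group algebra replaces w by l • w and leaves the exponents
alone, so generators of `annIdeal w` and all their left multiples go to 0. -/
lemma coeffMap_eq_zero_of_mem (w : W) (A : (Fin d → Fin 3) → W →ₗ[F] Y) {x : WreathSuper F d}
    (hx : x ∈ annIdeal (F := F) w) : coeffMap w A x = 0 := by
  -- Since `coeffMap` is only F-linear, the induction must carry along all left multiples of x.
  have key : ∀ r, coeffMap w A (r * x) = 0 := by
    induction hx using Submodule.span_induction with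
    | mem x hx =>
      obtain ⟨l, hl, rfl⟩ := hx
      have : coeffMap w A ∘ₗ LinearMap.mulRight F (iota F d l) = 0 := by
        refine basis_ext fun e σ => ?_
        change coeffMap w A (basis F (e, σ) * iota F d l) = 0
        rw [coeffMap_basis_mul_iota, hl, smul_zero, map_zero]
      exact fun r => congrArg (fun f => f r) this
    | zero => simp
    | add x y _ _ hx hy => intro r; rw [mul_add, map_add, hx, hy, add_zero]
    | smul a x _ hx => intro r; rw [smul_eq_mul, ← mul_assoc, hx]
  simpa using key 1

/-- The map `coeffMap` on the quotient by `annIdeal w`. -/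
def coeffMapQ (w : W) (A : (Fin d → Fin 3) → W →ₗ[F] Y) :
    (WreathSuper F d ⧸ annIdeal (F := F) w) →ₗ[F] Y :=
  ((annIdeal (F := F) w).restrictScalars F).liftQ (coeffMap w A)
      (fun _ hx => coeffMap_eq_zero_of_mem w A hx) ∘ₗ
    (Submodule.Quotient.restrictScalarsEquiv F (annIdeal (F := F) w)).symm.toLinearMap

lemma coeffMapQ_mk (w : W) (A : (Fin d → Fin 3) → W →ₗ[F] Y) (x : WreathSuper F d) :
    coeffMapQ w A (Submodule.Quotient.mk x) = coeffMap w A x := rfl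

/-- The range of `coeffMapQ` contains the range of every `A e`. -/
lemma mem_range_coeffMapQ [IsSimpleModule (MonoidAlgebra F (Equiv.Perm (Fin d))) W] {w : W}
    (hw : w ≠ 0) (A : (Fin d → Fin 3) → W →ₗ[F] Y) (e : Fin d → Fin 3) (x : W) :
    A e x ∈ LinearMap.range (coeffMapQ w A) := by
  obtain ⟨l, rfl⟩ := exists_surjective_of_isSimpleModule
    (MonoidAlgebra F (Equiv.Perm (Fin d))) W hw x
  refine ⟨Submodule.Quotient.mk (basis F (e, 1) * iota F d l), ?_⟩
  rw [coeffMapQ_mk, coeffMap_basis_mul_iota, map_one, one_smul]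

section Equivariant

variable [Module (MonoidAlgebra F (Equiv.Perm (Fin d))) Y]
  [IsScalarTower F (MonoidAlgebra F (Equiv.Perm (Fin d))) Y]

/-- Families of maps for which `coeffMap` is equivariant. -/
def IsEquivariant (A : (Fin d → Fin 3) → W →ₗ[F] Y) : Prop :=
  ∀ (σ : Equiv.Perm (Fin d)) (e : Fin d → Fin 3) (x : W),
    (-1 : F) ^ permSign σ (fun i => e i) • A (e ∘ ⇑(σ⁻¹)) (MonoidAlgebra.of F _ σ • x) =
      MonoidAlgebra.of F _ σ • A e x

omit [IsScalarTower F (MonoidAlgebra F (Equiv.Perm (Fin d))) W] in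
lemma coeffMap_iota_mul (w : W) {A : (Fin d → Fin 3) → W →ₗ[F] Y} (hA : IsEquivariant A)
    (l : MonoidAlgebra F (Equiv.Perm (Fin d))) (x : WreathSuper F d) :
    coeffMap w A (iota F d l * x) = l • coeffMap w A x := by
  have h1 : ∀ σ, coeffMap w A ∘ₗ LinearMap.mulLeft F (mono F 0 σ) =
      Algebra.lsmul F F Y (MonoidAlgebra.of F _ σ) ∘ₗ coeffMap w A := by
    intro σ
    refine basis_ext fun e π => ?_
    change coeffMap w A (mono F 0 σ * basis F (e, π)) =
      MonoidAlgebra.of F _ σ • coeffMap w A (basis F (e, π))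
    rw [mono_zero_mul_basis, map_smul, coeffMap_basis, coeffMap_basis, map_mul, mul_smul, hA]
  have h2 : coeffMap w A ∘ₗ LinearMap.mulRight F x ∘ₗ (iota F d).toLinearMap =
      (LinearMap.toSpanSingleton (MonoidAlgebra F (Equiv.Perm (Fin d))) Y
        (coeffMap w A x)).restrictScalars F := by
    refine groupAlgebra_ext fun σ => ?_
    change coeffMap w A (iota F d (MonoidAlgebra.of F _ σ) * x) =
      MonoidAlgebra.of F _ σ • coeffMap w A x
    rw [iota_of]
    exact congrArg (fun f => f x) (h1 σ)
  exact congrArg (fun f => f l) h2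

lemma coeffMapQ_iota_smul (w : W) {A : (Fin d → Fin 3) → W →ₗ[F] Y} (hA : IsEquivariant A)
    (l : MonoidAlgebra F (Equiv.Perm (Fin d))) (x : WreathSuper F d ⧸ annIdeal (F := F) w) :
    coeffMapQ w A (iota F d l • x) = l • coeffMapQ w A x := by
  obtain ⟨x, rfl⟩ := Submodule.Quotient.mk_surjective _ x
  rw [← Submodule.Quotient.mk_smul, coeffMapQ_mk, coeffMapQ_mk, smul_eq_mul,
    coeffMap_iota_mul w hA]

end Equivariant

/-- Every projective cover of `T(F, W)` surjects onto the induced module. -/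
lemma exists_surjective_of_projectiveCover {F : Type u} [Field F] {W : Type u} [AddCommGroup W]
    [Module (MonoidAlgebra F (Equiv.Perm (Fin d))) W]
    [IsSimpleModule (MonoidAlgebra F (Equiv.Perm (Fin d))) W] {w : W} (hw : w ≠ 0)
    (P : ProjectiveCover (WreathSuper F d) (TTriv F d W)) :
    ∃ f : P.carrier →ₗ[WreathSuper F d] WreathSuper F d ⧸ annIdeal (F := F) w,
      Function.Surjective f := by
  have := P.projective
  let q : (WreathSuper F d ⧸ annIdeal (F := F) w) →ₗ[WreathSuper F d] TTriv F d W :=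
    (annIdeal (F := F) w).liftQ (LinearMap.toSpanSingleton _ _ (TTriv.mk w)) (by
      rw [annIdeal, Submodule.span_le]
      rintro _ ⟨l, hl, rfl⟩
      change iota F d l • (TTriv.mk w : TTriv F d W) = 0
      rw [TTriv.smul_mk, aug_iota, hl]
      rfl)
  have hq1 : q (Submodule.Quotient.mk 1) = TTriv.mk w :=
    one_smul (WreathSuper F d) (TTriv.mk w : TTriv F d W)
  have hq : Function.Surjective q := by
    intro t
    have hw' : (TTriv.mk w : TTriv F d W) ≠ 0 := hw
    obtain ⟨l, hl⟩ := exists_surjective_of_isSimpleModule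
      (WreathSuper F d) (TTriv F d W) hw' t
    exact ⟨Submodule.Quotient.mk l, hl⟩
  obtain ⟨f, hf⟩ := Module.projective_lifting_property q P.toFun hq
  refine ⟨f, ?_⟩
  obtain ⟨p, hp⟩ := P.surjective (TTriv.mk w)
  obtain ⟨r, hr⟩ := Submodule.Quotient.mk_surjective _ (f p)
  have hrw : aug F d r • w = w := by
    have : q (f p) = TTriv.mk w := by rw [← hp, ← hf]; rfl
    rw [← hr] at this
    exact this
  -- As 1 - aug r annihilates w, it may be added to r without changing the class. The result is 1
  -- plus a nilpotent element, a unit, so f p generates the induced module just as the class of 1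
  -- does.
  have h1 : (Submodule.Quotient.mk r : WreathSuper F d ⧸ annIdeal (F := F) w) =
      (1 - (iota F d (aug F d r) - r)) • Submodule.Quotient.mk 1 := by
    rw [← Submodule.Quotient.mk_smul, eq_comm, Submodule.Quotient.eq]
    refine Submodule.subset_span ⟨1 - aug F d r, ?_, ?_⟩
    · rw [sub_smul, one_smul, hrw, sub_self]
    · rw [map_sub, map_one, smul_eq_mul, mul_one]
      abel
  have hu : IsUnit (1 - (iota F d (aug F d r) - r)) :=
    (isNilpotent_of_aug_eq_zero (by rw [map_sub, aug_iota, sub_self])).isUnit_one_sub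
  obtain ⟨b, hb⟩ := hu.exists_left_inv
  intro y
  obtain ⟨a, rfl⟩ := Submodule.Quotient.mk_surjective _ y
  refine ⟨(a * b) • p, ?_⟩
  rw [map_smul, ← hr, h1, smul_smul, mul_assoc, hb, ← Submodule.Quotient.mk_smul, mul_one,
    smul_eq_mul, mul_one]

end

end WreathSuper

/-! ## Lower bounds for the diagonal Cartan invariants -/

namespace WreathSuper

noncomputable section

open Module

lemma finrank_idemPart_le_of_surjective {F : Type*} [Field F] {A : Type*} [Ring A] [Algebra F A]
    {M : Type*} [AddCommGroup M] [Module F M] [Module A M] [IsScalarTower F A M]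
    {M' : Type*} [AddCommGroup M'] [Module F M'] [Module A M'] [IsScalarTower F A M']
    [Module.Finite F M] (e : A) (f : M →ₗ[A] M') (hf : Function.Surjective f) :
    finrank F (idemPart F e M') ≤ finrank F (idemPart F e M) := by
  have : idemPart F e M' = (idemPart F e M).map (f.restrictScalars F) := by
    ext y
    constructor
    · rintro ⟨y, rfl⟩
      obtain ⟨x, rfl⟩ := hf y
      exact ⟨e • x, ⟨x, rfl⟩, by simp⟩
    · rintro ⟨_, ⟨x, rfl⟩, rfl⟩
      exact ⟨f x, by simp⟩
  rw [this]
  exact Submodule.finrank_map_le _ _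

lemma finrank_idemPart_pi {F : Type*} [Field F] {A : Type*} [Ring A] [Algebra F A]
    {M : Type*} [AddCommGroup M] [Module F M] [Module A M] [IsScalarTower F A M]
    [Module.Finite F M] {e : A} (he : IsIdempotentElem e) (ι : Type*) [Fintype ι] :
    finrank F (idemPart F e (ι → M)) = Fintype.card ι * finrank F (idemPart F e M) := by
  let f : idemPart F e (ι → M) ≃ₗ[F] (ι → idemPart F e M) :=
    { toFun := fun x i => ⟨x.1 i, (mem_idemPart he).2
        (congrFun ((mem_idemPart he).1 x.2) i)⟩
      map_add' := fun _ _ => rfl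
      map_smul' := fun _ _ => rfl
      invFun := fun y => ⟨fun i => (y i).1, (mem_idemPart he).2
        (funext fun i => (mem_idemPart he).1 (y i).2)⟩
      left_inv := fun _ => rfl
      right_inv := fun _ => rfl }
  rw [f.finrank_eq, Module.finrank_pi_fintype]
  simp

lemma nonempty_projectiveCover {F : Type u} [Field F] {d : ℕ} (W : Type u) [AddCommGroup W]
    [Module (MonoidAlgebra F (Equiv.Perm (Fin d))) W]
    [IsSimpleModule (MonoidAlgebra F (Equiv.Perm (Fin d))) W] :
    Nonempty (ProjectiveCover (WreathSuper F d) (TTriv F d W)) := by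
  have : IsArtinianRing (WreathSuper F d) := IsArtinianRing.of_finite F _
  have := IsSimpleModule.nontrivial (WreathSuper F d) (TTriv F d W)
  obtain ⟨w, hw⟩ := exists_ne (0 : TTriv F d W)
  exact exists_projectiveCover (LinearMap.toSpanSingleton (WreathSuper F d) (TTriv F d W) w)
    fun t => exists_surjective_of_isSimpleModule _ _ hw t

/-- Since T is simple, p generates P modulo the superfluous kernel, hence generates P. -/
lemma span_eq_top_of_projectiveCover {A : Type u} [Ring A] {T : Type u} [AddCommGroup T]
    [Module A T] [IsSimpleModule A T] (P : ProjectiveCover A T) {p : P.carrier}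
    (hp : P.toFun p ≠ 0) (x : P.carrier) : ∃ a : A, a • p = x := by
  have : Submodule.span A {p} = ⊤ := by
    refine P.superfluous _ (eq_top_iff.2 fun x _ => ?_)
    obtain ⟨a, ha⟩ := exists_surjective_of_isSimpleModule A T hp (P.toFun x)
    refine Submodule.mem_sup.2 ⟨a • p, Submodule.smul_mem _ _ (Submodule.mem_span_singleton_self p),
      x - a • p, ?_, by abel⟩
    rw [LinearMap.mem_ker, map_sub, map_smul, ha, sub_self]
  exact Submodule.mem_span_singleton.1 (this ▸ Submodule.mem_top)

lemma finite_of_projectiveCover (F : Type u) [Field F] {A : Type u} [Ring A] [Algebra F A]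
    [Module.Finite F A] {T : Type u} [AddCommGroup T]
    [Module A T] [IsSimpleModule A T] (P : ProjectiveCover A T)
    [Module F P.carrier] [IsScalarTower F A P.carrier] : Module.Finite F P.carrier := by
  have := IsSimpleModule.nontrivial A T
  obtain ⟨t, ht⟩ := exists_ne (0 : T)
  obtain ⟨p, rfl⟩ := P.surjective t
  exact Module.Finite.of_surjective
    ((LinearMap.toSpanSingleton A P.carrier p).restrictScalars F)
    fun x => span_eq_top_of_projectiveCover P ht x

variable {F : Type u} [Field F] {d : ℕ} {W : Type u} [AddCommGroup W]
  [Module (MonoidAlgebra F (Equiv.Perm (Fin d))) W] [Module F W]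
  [IsScalarTower F (MonoidAlgebra F (Equiv.Perm (Fin d))) W]

instance : Module F (TTriv F d W) := inferInstanceAs (Module F W)

instance : IsScalarTower F (WreathSuper F d) (TTriv F d W) := by
  refine ⟨fun c r w => ?_⟩
  let w' : W := w
  change aug F d (c • r) • w' = c • (aug F d r • w')
  rw [aug_smul, smul_assoc]

lemma finrank_idemPart_TTriv (a : MonoidAlgebra F (Equiv.Perm (Fin d))) :
    finrank F (idemPart F (iota F d a) (TTriv F d W)) = finrank F (idemPart F a W) := by
  have : Algebra.lsmul F F (TTriv F d W) (iota F d a) = Algebra.lsmul F F W a := by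
    refine LinearMap.ext fun w => ?_
    let w' : W := w
    change aug F d (iota F d a) • w' = a • w'
    rw [aug_iota]
  exact congrArg (fun f : W →ₗ[F] W => finrank F (LinearMap.range f)) this

variable [IsSimpleModule (MonoidAlgebra F (Equiv.Perm (Fin d))) W]

omit [Module F W] [IsScalarTower F (MonoidAlgebra F (Equiv.Perm (Fin d))) W] in
lemma exists_cartanInvariant_eq :
    ∃ P : ProjectiveCover (WreathSuper F d) (TTriv F d W),
      cartanInvariant (WreathSuper F d) (TTriv F d W) (TTriv F d W) =
        compositionMultiplicity (WreathSuper F d) P.carrier (TTriv F d W) := by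
  have h := nonempty_projectiveCover (F := F) (d := d) W
  exact ⟨h.some, by rw [cartanInvariant, dif_pos h]⟩

omit [IsSimpleModule (MonoidAlgebra F (Equiv.Perm (Fin d))) W] in
lemma finite_of_isSimpleModule [IsSimpleModule (MonoidAlgebra F (Equiv.Perm (Fin d))) W] :
    Module.Finite F W := by
  have := IsSimpleModule.nontrivial (MonoidAlgebra F (Equiv.Perm (Fin d))) W
  obtain ⟨w, hw⟩ := exists_ne (0 : W)
  exact Module.Finite.of_surjective
    ((LinearMap.toSpanSingleton (MonoidAlgebra F (Equiv.Perm (Fin d))) W w).restrictScalars F)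
    fun x => exists_surjective_of_isSimpleModule (MonoidAlgebra F (Equiv.Perm (Fin d))) W hw x

/-- The invariant times dim eW is the dimension of the e-part of the projective cover, and the cover
maps onto the induced module. Lower bounds can thus be read off the induced module alone. -/
theorem exists_idempotent_finrank_le {w : W} (hw : w ≠ 0) :
    ∃ e : MonoidAlgebra F (Equiv.Perm (Fin d)), IsIdempotentElem e ∧
      0 < finrank F (idemPart F e W) ∧
      finrank F (idemPart F (iota F d e) (WreathSuper F d ⧸ annIdeal (F := F) w)) ≤
        cartanInvariant (WreathSuper F d) (TTriv F d W) (TTriv F d W) *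
          finrank F (idemPart F e W) := by
  obtain ⟨e, he, ⟨x, hx⟩, hS⟩ := exists_idempotent (F := F) (d := d) W
  obtain ⟨P, hP⟩ := exists_cartanInvariant_eq (F := F) (d := d) (W := W)
  have : Module.Finite F W := finite_of_isSimpleModule (d := d)
  let _ : Module F P.carrier := Module.compHom P.carrier (algebraMap F (WreathSuper F d))
  have : IsScalarTower F (WreathSuper F d) P.carrier :=
    IsScalarTower.of_algebraMap_smul fun _ _ => rfl
  have := finite_of_projectiveCover F P
  have hei : IsIdempotentElem (iota F d e) := he.map (iota F d)
  refine ⟨e, he, ?_, ?_⟩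
  · have : Nontrivial (idemPart F e W) := ⟨⟨e • x, ⟨x, rfl⟩⟩, 0, fun h =>
      hx (congrArg Subtype.val h)⟩
    exact finrank_pos
  · obtain ⟨f, hf⟩ := exists_surjective_of_projectiveCover hw P
    rw [hP, ← finrank_idemPart_TTriv, compositionMultiplicity_mul_eq hei hS]
    exact finrank_idemPart_le_of_surjective _ f hf

/-- A surjective equivariant map to a power of `W` gives a lower bound. -/
lemma mul_finrank_le_of_surjective {w : W} {ι : Type} [Fintype ι]
    {A : (Fin d → Fin 3) → W →ₗ[F] (ι → W)} (hA : IsEquivariant A)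
    (hs : LinearMap.range (coeffMapQ w A) = ⊤)
    {e : MonoidAlgebra F (Equiv.Perm (Fin d))} (he : IsIdempotentElem e) :
    Fintype.card ι * finrank F (idemPart F e W) +
      finrank F (LinearMap.ker (coeffMapQ w A ∘ₗ (idemPart F (iota F d e)
        (WreathSuper F d ⧸ annIdeal (F := F) w)).subtype)) =
      finrank F (idemPart F (iota F d e) (WreathSuper F d ⧸ annIdeal (F := F) w)) := by
  have : Module.Finite F W := finite_of_isSimpleModule (d := d)
  -- Rank-nullity on the e-parts. The kernel term is retained because it supplies the strict
  -- inequality in characteristic 3.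
  rw [← finrank_idemPart_pi he ι, ← LinearMap.finrank_range_add_finrank_ker
    (coeffMapQ w A ∘ₗ (idemPart F (iota F d e)
        (WreathSuper F d ⧸ annIdeal (F := F) w)).subtype)]
  have : idemPart F e (ι → W) = LinearMap.range (coeffMapQ w A ∘ₗ (idemPart F (iota F d e)
        (WreathSuper F d ⧸ annIdeal (F := F) w)).subtype) := by
    ext y
    constructor
    · rintro ⟨y, rfl⟩
      obtain ⟨x, rfl⟩ := LinearMap.range_eq_top.1 hs y
      exact ⟨⟨iota F d e • x, ⟨x, rfl⟩⟩, coeffMapQ_iota_smul w hA e x⟩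
    · rintro ⟨⟨_, ⟨x, rfl⟩⟩, rfl⟩
      exact ⟨coeffMapQ w A x, (coeffMapQ_iota_smul w hA e x).symm⟩
  rw [this]

end

end WreathSuper

/-! ### Equivariant families: one copy of W in each degree, and the transposition component. -/

namespace WreathSuper

noncomputable section

open Module

section Families

open scoped Classical

variable {F : Type u} [Field F] {d : ℕ} {W : Type u} [AddCommGroup W]
  [Module (MonoidAlgebra F (Equiv.Perm (Fin d))) W] [Module F W]
  [IsScalarTower F (MonoidAlgebra F (Equiv.Perm (Fin d))) W]

/-- At most one exponent is odd. -/
def AtMostOneOdd (e : Fin d → Fin 3) : Prop :=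
  ∀ i j, Odd (e i : ℕ) → Odd (e j : ℕ) → i = j

lemma AtMostOneOdd.permSign_eq_zero {e : Fin d → Fin 3} (he : AtMostOneOdd e)
    (σ : Equiv.Perm (Fin d)) : permSign σ (fun i => e i) = 0 := by
  rw [permSign, Finset.card_eq_zero, Finset.filter_eq_empty_iff]
  rintro p - ⟨h1, -, h2, h3⟩
  exact h1.ne (he _ _ h2 h3)

lemma atMostOneOdd_comp {e : Fin d → Fin 3} (σ : Equiv.Perm (Fin d)) :
    AtMostOneOdd (e ∘ σ) ↔ AtMostOneOdd e := by
  constructor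
  · intro h i j hi hj
    have := h (σ.symm i) (σ.symm j) (by simpa using hi) (by simpa using hj)
    simpa using this
  · intro h i j hi hj
    exact σ.injective (h _ _ hi hj)

lemma sum_comp_perm (e : Fin d → Fin 3) (σ : Equiv.Perm (Fin d)) :
    ∑ i, ((e ∘ σ) i : ℕ) = ∑ i, (e i : ℕ) :=
  Equiv.sum_comp σ fun i => (e i : ℕ)

omit [IsScalarTower F (MonoidAlgebra F (Equiv.Perm (Fin d))) W] in
lemma isEquivariant_pi {ι : Type*} {A : ι → (Fin d → Fin 3) → W →ₗ[F] W}
    (hA : ∀ i, IsEquivariant (A i)) : IsEquivariant fun e => LinearMap.pi fun i => A i e :=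
  fun σ e x => funext fun i => hA i σ e x

/-- The projection to the component of degree `k` with at most one odd factor. -/
def degComp (k : ℕ) (e : Fin d → Fin 3) : W →ₗ[F] W :=
  if AtMostOneOdd e ∧ ∑ i, (e i : ℕ) = k then LinearMap.id else 0

omit [IsScalarTower F (MonoidAlgebra F (Equiv.Perm (Fin d))) W] in
-- A sign needs two odd factors, so none occurs here, and both the degree and the number of odd
-- factors are invariant under permutation.
lemma isEquivariant_degComp (k : ℕ) :
    IsEquivariant (degComp k : (Fin d → Fin 3) → W →ₗ[F] W) := by
  intro σ e x
  rw [degComp, degComp, atMostOneOdd_comp, sum_comp_perm]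
  split_ifs with h
  · rw [h.1.permSign_eq_zero, pow_zero, one_smul]
    rfl
  · simp

/-- The exponents `0` at `i` and `j` and `2` elsewhere. -/
def twoZeros (i j : Fin d) : Fin d → Fin 3 := fun k => if k = i ∨ k = j then 0 else 2

lemma atMostOneOdd_twoZeros (i j : Fin d) : AtMostOneOdd (twoZeros i j) := by
  intro k l hk
  rw [twoZeros] at hk
  split_ifs at hk
  · simp at hk
  · exact absurd hk (by decide)

/-- The exponents determine only the unordered pair of zeros, which is all the transposition depends
on. This makes the choice in `swapComp` harmless. -/
lemma swap_eq_of_twoZeros_eq {i j k l : Fin d} (hij : i ≠ j)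
    (h : twoZeros i j = twoZeros k l) : Equiv.swap i j = Equiv.swap k l := by
  have hi : i = k ∨ i = l := by
    by_contra hc
    have := congrFun h i
    simp [twoZeros, hc] at this
  have hj : j = k ∨ j = l := by
    by_contra hc
    have := congrFun h j
    simp [twoZeros, hc] at this
  rcases hi with rfl | rfl <;> rcases hj with rfl | rfl
  · exact absurd rfl hij
  · rfl
  · exact Equiv.swap_comm _ _
  · exact absurd rfl hij

/-- The transposition of the two zeros on the components with two exponents `0` and no exponent
`1`. -/
def swapComp (e : Fin d → Fin 3) : W →ₗ[F] W :=
  if h : ∃ p : Fin d × Fin d, p.1 ≠ p.2 ∧ e = twoZeros p.1 p.2 then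
    Algebra.lsmul F F W (MonoidAlgebra.of F _ (Equiv.swap h.choose.1 h.choose.2)) else 0

lemma swapComp_twoZeros {i j : Fin d} (hij : i ≠ j) (x : W) :
    swapComp (F := F) (twoZeros i j) x = MonoidAlgebra.of F _ (Equiv.swap i j) • x := by
  have h : ∃ p : Fin d × Fin d, p.1 ≠ p.2 ∧ twoZeros i j = twoZeros p.1 p.2 :=
    ⟨(i, j), hij, rfl⟩
  rw [swapComp, dif_pos h, swap_eq_of_twoZeros_eq hij h.choose_spec.2]
  rfl

lemma twoZeros_comp (σ : Equiv.Perm (Fin d)) (i j : Fin d) :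
    twoZeros i j ∘ ⇑(σ⁻¹) = twoZeros (σ i) (σ j) := by
  funext k
  simp [twoZeros, Equiv.symm_apply_eq]

/-- This is the conjugation rule σ (i j) = (σ i σ j) σ; no signs arise as all exponents are even. -/
lemma isEquivariant_swapComp :
    IsEquivariant (swapComp : (Fin d → Fin 3) → W →ₗ[F] W) := by
  intro σ e x
  by_cases h : ∃ p : Fin d × Fin d, p.1 ≠ p.2 ∧ e = twoZeros p.1 p.2
  · obtain ⟨⟨i, j⟩, hij, rfl⟩ := h
    rw [(atMostOneOdd_twoZeros i j).permSign_eq_zero, pow_zero, one_smul, twoZeros_comp,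
      swapComp_twoZeros (σ.injective.ne hij), swapComp_twoZeros hij, smul_smul, smul_smul,
      ← map_mul, ← map_mul, Equiv.mul_swap_eq_swap_mul]
  · have h' : ¬ ∃ p : Fin d × Fin d, p.1 ≠ p.2 ∧ e ∘ ⇑(σ⁻¹) = twoZeros p.1 p.2 := by
      rintro ⟨⟨i, j⟩, hij, he⟩
      refine h ⟨(σ⁻¹ i, σ⁻¹ j), (σ⁻¹).injective.ne hij, ?_⟩
      rw [← twoZeros_comp, ← he]
      funext k
      simp
    rw [swapComp, swapComp, dif_neg h, dif_neg h']
    simp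

/-- Exponents of degree `k` with at most one odd entry. -/
def stdExp (d k : ℕ) : Fin d → Fin 3 := fun i =>
  -- The entries are filled with 2 from the left; truncated subtraction leaves a single 1 at the
  -- break if k is odd, and 0 afterwards.
  ⟨min 2 (k - 2 * i), by omega⟩

lemma atMostOneOdd_stdExp (d k : ℕ) : AtMostOneOdd (stdExp d k) := by
  intro i j hi hj
  have hi' : Odd (min 2 (k - 2 * (i : ℕ))) := hi
  have hj' : Odd (min 2 (k - 2 * (j : ℕ))) := hj
  rw [Nat.odd_iff] at hi' hj'
  ext
  omega

lemma sum_stdExp {d k : ℕ} (hk : k ≤ 2 * d) : ∑ i, (stdExp d k i : ℕ) = k := by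
  have : ∀ n, ∑ i : Fin n, min 2 (k - 2 * (i : ℕ)) = min (2 * n) k := by
    intro n
    induction n with
    | zero => simp
    | succ n ih =>
      rw [Fin.sum_univ_castSucc]
      simp only [Fin.val_castSucc, Fin.val_last]
      rw [ih]
      omega
  exact (this d).trans (min_eq_right hk)

lemma sum_le_two_mul (e : Fin d → Fin 3) : ∑ i, (e i : ℕ) ≤ 2 * d := by
  refine (Finset.sum_le_sum fun i _ => Nat.le_of_lt_succ (e i).isLt).trans ?_
  simp [mul_comm]

/-- The map to `2d + 1` copies of `W`, one in every degree. -/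
def degFamily (F : Type u) [Field F] (d : ℕ) (W : Type u) [AddCommGroup W] [Module F W]
    (e : Fin d → Fin 3) : W →ₗ[F] (Fin (2 * d + 1) → W) :=
  LinearMap.pi fun k => degComp k e

lemma degFamily_apply {F : Type u} [Field F] {d : ℕ} {W : Type u} [AddCommGroup W] [Module F W]
    {e : Fin d → Fin 3} (he : AtMostOneOdd e) {k : Fin (2 * d + 1)} (hk : ∑ i, (e i : ℕ) = k)
    (x : W) : degFamily F d W e x = Pi.single k x := by
  funext l
  by_cases h : l = k
  · subst h
    simp [degFamily, degComp, he, hk]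
  · have : (k : ℕ) ≠ l := fun h' => h (Fin.ext h'.symm)
    simp [degFamily, degComp, hk, this, h]

/-- The map to `2d + 2` copies of `W`, one in every degree and a further one. -/
def degSwapFamily (F : Type u) [Field F] (d : ℕ) (W : Type u) [AddCommGroup W]
    [Module (MonoidAlgebra F (Equiv.Perm (Fin d))) W] [Module F W]
    [IsScalarTower F (MonoidAlgebra F (Equiv.Perm (Fin d))) W]
    (e : Fin d → Fin 3) : W →ₗ[F] (Option (Fin (2 * d + 1)) → W) :=
  LinearMap.pi fun o => o.elim (swapComp e) fun k => degComp k e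

omit [IsScalarTower F (MonoidAlgebra F (Equiv.Perm (Fin d))) W] in
lemma isEquivariant_degFamily : IsEquivariant (degFamily F d W) :=
  isEquivariant_pi fun k => isEquivariant_degComp (k : ℕ)

lemma isEquivariant_degSwapFamily : IsEquivariant (degSwapFamily F d W) := by
  refine isEquivariant_pi fun o => ?_
  cases o with
  | none => exact isEquivariant_swapComp
  | some k => exact isEquivariant_degComp (k : ℕ)

variable [IsSimpleModule (MonoidAlgebra F (Equiv.Perm (Fin d))) W]

lemma range_degFamily {w : W} (hw : w ≠ 0) :
    LinearMap.range (coeffMapQ w (degFamily F d W)) = ⊤ := by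
  rw [eq_top_iff]
  intro y _
  rw [← Finset.univ_sum_single y]
  refine Submodule.sum_mem _ fun k _ => ?_
  rw [← degFamily_apply (F := F) (atMostOneOdd_stdExp d k)
    (sum_stdExp (Nat.le_of_lt_succ k.isLt))]
  exact mem_range_coeffMapQ hw _ _ _

/-- The monomial with zeros at i and j contributes the pairs (x, s • x) in its degree and the extra
coordinate. If the image met the extra copy of W trivially, comparing a • (x, s • x) with (a • x, s
• a • x) would show that s commutes with the whole group algebra on W. Its eigenspaces would then be
submodules, forcing s = ±1. -/
lemma range_degSwapFamily {w : W} (hw : w ≠ 0) {i j : Fin d} (hij : i ≠ j)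
    (h1 : ∃ x : W, MonoidAlgebra.of F _ (Equiv.swap i j) • x ≠ x)
    (h2 : ∃ x : W, MonoidAlgebra.of F _ (Equiv.swap i j) • x ≠ -x) :
    LinearMap.range (coeffMapQ w (degSwapFamily F d W)) = ⊤ := by
  set s := MonoidAlgebra.of F _ (Equiv.swap i j) with hs
  have hss : s * s = 1 := by rw [hs, ← map_mul, Equiv.swap_mul_self, map_one]
  set U := LinearMap.range (coeffMapQ w (degSwapFamily F d W)) with hU
  have hUG : ∀ (a : MonoidAlgebra F (Equiv.Perm (Fin d))) {y}, y ∈ U → a • y ∈ U := by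
    rintro a _ ⟨x, rfl⟩
    exact ⟨_, coeffMapQ_iota_smul w isEquivariant_degSwapFamily a x⟩
  have hA : ∀ e x, degSwapFamily F d W e x ∈ U := fun e x => mem_range_coeffMapQ hw _ e x
  let k0 : Fin (2 * d + 1) :=
    ⟨∑ k, (twoZeros i j k : ℕ), Nat.lt_succ_of_le (sum_le_two_mul _)⟩
  have hsome : ∀ (k : Fin (2 * d + 1)) (e : Fin d → Fin 3) (x : W), AtMostOneOdd e →
      ∑ i, (e i : ℕ) = k → degSwapFamily F d W e x =
        Pi.single (some k) x + Pi.single none (swapComp (F := F) e x) := by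
    intro k e x he hk
    funext o
    cases o with
    | none => simp [degSwapFamily]
    | some l =>
      have := congrFun (degFamily_apply (F := F) he hk x) l
      rw [Pi.add_apply, Pi.single_eq_of_ne (by simp : (some l) ≠ none), add_zero]
      refine this.trans ?_
      simp [Pi.single_apply]
  have hk0 : ∀ x, Pi.single (some k0) x + Pi.single none (s • x) ∈ U := by
    intro x
    have := hA (twoZeros i j) x
    rwa [hsome k0 _ x (atMostOneOdd_twoZeros i j) rfl, swapComp_twoZeros hij] at this
  -- N is the part of the image concentrated in the extra coordinate. It is a submodule of the
  -- simple module W, so it suffices to exclude N = ⊥.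
  let N : Submodule (MonoidAlgebra F (Equiv.Perm (Fin d))) W :=
    { carrier := {y | Pi.single none y ∈ U}
      zero_mem' := by simp
      add_mem' := fun {x y} hx hy => by
        change Pi.single none (x + y) ∈ U
        rw [Pi.single_add]
        exact U.add_mem hx hy
      smul_mem' := fun a x hx => by
        change Pi.single none (a • x) ∈ U
        rw [Pi.single_smul]
        exact hUG a hx }
  have hN : N = ⊤ := by
    refine (eq_bot_or_eq_top N).resolve_left fun hbot => ?_
    have hcomm : ∀ (a : MonoidAlgebra F (Equiv.Perm (Fin d))) (x : W),
        s • a • x = a • s • x := by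
      intro a x
      have hmem : s • a • x - a • s • x ∈ N := by
        change Pi.single none (s • a • x - a • s • x) ∈ U
        have := U.sub_mem (hk0 (a • x)) (hUG a (hk0 x))
        rwa [smul_add, ← Pi.single_smul, ← Pi.single_smul, add_sub_add_left_eq_sub,
          ← Pi.single_sub] at this
      rw [hbot, Submodule.mem_bot] at hmem
      exact sub_eq_zero.1 hmem
    let E : Submodule (MonoidAlgebra F (Equiv.Perm (Fin d))) W :=
      { carrier := {x | s • x = x}
        zero_mem' := smul_zero _
        add_mem' := fun {x y} hx hy => by
          change s • (x + y) = x + y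
          rw [smul_add, hx, hy]
        smul_mem' := fun a x hx => by
          change s • a • x = a • x
          rw [hcomm, hx] }
    rcases eq_bot_or_eq_top E with hE | hE
    · obtain ⟨x, hx⟩ := h2
      -- Since s² = 1, every s • x + x is fixed by s; if s has no nonzero fixed vectors, it acts as
      -- -1.
      have hmem : s • x + x ∈ E := by
        change s • (s • x + x) = s • x + x
        rw [smul_add, smul_smul, hss, one_smul, add_comm]
      rw [hE, Submodule.mem_bot] at hmem
      exact hx (eq_neg_of_add_eq_zero_left hmem)
    · obtain ⟨x, hx⟩ := h1
      have hmem : x ∈ E := hE ▸ Submodule.mem_top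
      exact hx hmem
  have hnone : ∀ y, Pi.single none y ∈ U := fun y => by
    have : y ∈ N := hN ▸ Submodule.mem_top
    exact this
  rw [eq_top_iff]
  intro y _
  rw [← Finset.univ_sum_single y]
  refine Submodule.sum_mem _ fun o _ => ?_
  cases o with
  | none => exact hnone _
  | some k =>
    -- Once the extra copy of W lies in the image, the contribution of `swapComp` can be subtracted
    -- off in every degree.
    have := U.sub_mem (hA (stdExp d k) (y (some k)))
      (hnone (swapComp (F := F) (stdExp d k) (y (some k))))
    rwa [hsome k _ _ (atMostOneOdd_stdExp d k) (sum_stdExp (Nat.le_of_lt_succ k.isLt)),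
      add_sub_cancel_right] at this

omit [Module F W] [IsScalarTower F (MonoidAlgebra F (Equiv.Perm (Fin d))) W] in
/-- Every diagonal Cartan invariant is at least `2d + 1`. -/
theorem le_cartanInvariant :
    2 * d + 1 ≤ cartanInvariant (WreathSuper F d) (TTriv F d W) (TTriv F d W) := by
  let _ : Module F W := Module.compHom W (algebraMap F (MonoidAlgebra F (Equiv.Perm (Fin d))))
  have : IsScalarTower F (MonoidAlgebra F (Equiv.Perm (Fin d))) W :=
    IsScalarTower.of_algebraMap_smul fun _ _ => rfl
  have := IsSimpleModule.nontrivial (MonoidAlgebra F (Equiv.Perm (Fin d))) W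
  obtain ⟨w, hw⟩ := exists_ne (0 : W)
  obtain ⟨e, he, hpos, hle⟩ := exists_idempotent_finrank_le (F := F) (d := d) hw
  rw [← mul_finrank_le_of_surjective isEquivariant_degFamily (range_degFamily hw) he,
    Fintype.card_fin] at hle
  exact Nat.le_of_mul_le_mul_right (le_of_add_le_left hle) hpos

omit [Module F W] [IsScalarTower F (MonoidAlgebra F (Equiv.Perm (Fin d))) W] in
/-- If some transposition acts neither as `1` nor as `-1`, the diagonal Cartan invariant is larger
than `2d + 1`. -/
theorem lt_cartanInvariant_of_swap {i j : Fin d} (hij : i ≠ j)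
    (h1 : ∃ x : W, MonoidAlgebra.of F _ (Equiv.swap i j) • x ≠ x)
    (h2 : ∃ x : W, MonoidAlgebra.of F _ (Equiv.swap i j) • x ≠ -x) :
    2 * d + 1 < cartanInvariant (WreathSuper F d) (TTriv F d W) (TTriv F d W) := by
  let _ : Module F W := Module.compHom W (algebraMap F (MonoidAlgebra F (Equiv.Perm (Fin d))))
  have : IsScalarTower F (MonoidAlgebra F (Equiv.Perm (Fin d))) W :=
    IsScalarTower.of_algebraMap_smul fun _ _ => rfl
  have := IsSimpleModule.nontrivial (MonoidAlgebra F (Equiv.Perm (Fin d))) W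
  obtain ⟨w, hw⟩ := exists_ne (0 : W)
  obtain ⟨e, he, hpos, hle⟩ := exists_idempotent_finrank_le (F := F) (d := d) hw
  rw [← mul_finrank_le_of_surjective isEquivariant_degSwapFamily
    (range_degSwapFamily hw hij h1 h2) he, Fintype.card_option, Fintype.card_fin] at hle
  exact Nat.le_of_mul_le_mul_right (le_of_add_le_left hle) hpos

end Families

end

end WreathSuper

/-! ### Linear characters in characteristic 3: an extra vector killed by the degree maps. -/

namespace WreathSuper

noncomputable section

open Module

lemma _root_.Submodule.finrank_pos_of_mem {K V : Type*} [Field K] [AddCommGroup V] [Module K V]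
    [Module.Finite K V] {U : Submodule K V} {x : V} (hx : x ∈ U) (h0 : x ≠ 0) :
    0 < finrank K U := by
  have : Nontrivial U := ⟨⟨x, hx⟩, 0, fun h => h0 (congrArg Subtype.val h)⟩
  exact finrank_pos

section Scalar

variable {F : Type u} [Field F] {d : ℕ} {W : Type u} [AddCommGroup W]
  [Module (MonoidAlgebra F (Equiv.Perm (Fin d))) W] [Module F W]
  [IsScalarTower F (MonoidAlgebra F (Equiv.Perm (Fin d))) W]

/-- Every transposition acts as `1` or `-1`. -/
def SwapsActAsSign (F : Type u) [Field F] (d : ℕ) (W : Type u) [AddCommGroup W]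
    [Module (MonoidAlgebra F (Equiv.Perm (Fin d))) W] : Prop :=
  ∀ i j : Fin d, i ≠ j → (∀ x : W, MonoidAlgebra.of F _ (Equiv.swap i j) • x = x) ∨
    ∀ x : W, MonoidAlgebra.of F _ (Equiv.swap i j) • x = -x

omit [IsScalarTower F (MonoidAlgebra F (Equiv.Perm (Fin d))) W] in
lemma SwapsActAsSign.exists_scalar (h : SwapsActAsSign F d W) (σ : Equiv.Perm (Fin d)) :
    ∃ c : F, c * c = 1 ∧ ∀ x : W, MonoidAlgebra.of F _ σ • x = c • x := by
  induction σ using Equiv.Perm.swap_induction_on with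
  | one => exact ⟨1, by simp, fun x => by rw [map_one, one_smul, one_smul]⟩
  | swap_mul τ i j hij ih =>
    obtain ⟨c, hc, hx⟩ := ih
    rcases h i j hij with h | h
    · exact ⟨c, hc, fun x => by rw [map_mul, mul_smul, hx, h]⟩
    · exact ⟨-c, by simpa using hc, fun x => by rw [map_mul, mul_smul, hx, h, neg_smul]⟩

/-- Two exponents `0`, one exponent `1`, and otherwise exponents `2`. -/
def IsTwoOne (e : Fin d → Fin 3) : Prop :=
  (Finset.univ.filter fun i => e i = 0).card = 2 ∧ (Finset.univ.filter fun i => e i = 1).card = 1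

instance : DecidablePred (IsTwoOne (d := d)) := fun _ => inferInstanceAs (Decidable (_ ∧ _))

lemma IsTwoOne.comp {e : Fin d → Fin 3} (he : IsTwoOne e) (σ : Equiv.Perm (Fin d)) :
    IsTwoOne (e ∘ σ) := by
  have key : ∀ a : Fin 3, (Finset.univ.filter fun i => (e ∘ σ) i = a).card =
      (Finset.univ.filter fun i => e i = a).card := by
    intro a
    rw [← Fintype.card_subtype, ← Fintype.card_subtype]
    exact Fintype.card_congr (σ.subtypeEquiv fun _ => Iff.rfl)
  exact ⟨(key 0).trans he.1, (key 1).trans he.2⟩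

lemma IsTwoOne.atMostOneOdd {e : Fin d → Fin 3} (he : IsTwoOne e) : AtMostOneOdd e := by
  obtain ⟨k, hk⟩ := Finset.card_eq_one.1 he.2
  have h : ∀ i, Odd (e i : ℕ) → i = k := by
    intro i hi
    have : i ∈ Finset.univ.filter fun i => e i = 1 := by
      refine Finset.mem_filter.2 ⟨Finset.mem_univ _, ?_⟩
      generalize e i = a at hi
      revert hi
      revert a
      decide
    rw [hk] at this
    exact Finset.mem_singleton.1 this
  intro i j hi hj
  rw [h i hi, h j hj]

lemma IsTwoOne.sum {e : Fin d → Fin 3} (he : IsTwoOne e) : ∑ i, (e i : ℕ) + 5 = 2 * d := by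
  have h : ∀ a : Fin 3, (a : ℕ) + (2 * (if a = 0 then 1 else 0) + if a = 1 then 1 else 0) = 2 := by
    decide
  have h2 : ∑ i, ((e i : ℕ) + (2 * (if e i = 0 then 1 else 0) + if e i = 1 then 1 else 0)) =
      2 * d := by
    rw [Finset.sum_congr rfl fun i _ => h (e i)]
    simp [mul_comm]
  rw [Finset.sum_add_distrib, Finset.sum_add_distrib, ← Finset.mul_sum, ← Finset.card_filter,
    ← Finset.card_filter, he.1, he.2] at h2
  exact h2

/-- Choosing the three positions with exponent other than 2, and then the place of the exponent 1
among them, gives 3·C(d,3) such exponents. -/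
lemma three_dvd_card_isTwoOne :
    3 ∣ (Finset.univ.filter fun e : Fin d → Fin 3 => IsTwoOne e).card := by
  let T : Finset (Finset (Fin d)) := Finset.powersetCard 3 Finset.univ
  let supp : (Fin d → Fin 3) → Finset (Fin d) := fun e => Finset.univ.filter fun i => e i ≠ 2
  have hmaps : ∀ e ∈ Finset.univ.filter fun e : Fin d → Fin 3 => IsTwoOne e, supp e ∈ T := by
    intro e he
    have he := (Finset.mem_filter.1 he).2
    refine Finset.mem_powersetCard.2 ⟨Finset.subset_univ _, ?_⟩
    have h : ∀ a : Fin 3, (if a ≠ 2 then 1 else 0) =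
        (if a = 0 then 1 else 0) + if a = 1 then 1 else 0 := by decide
    rw [Finset.card_filter, Finset.sum_congr rfl fun i _ => h (e i), Finset.sum_add_distrib,
      ← Finset.card_filter, ← Finset.card_filter, he.1, he.2]
  rw [Finset.card_eq_sum_card_fiberwise hmaps]
  refine Finset.dvd_sum fun S hS => ?_
  have hS3 : S.card = 3 := (Finset.mem_powersetCard.1 hS).2
  have : (Finset.filter (fun e => supp e = S)
      (Finset.univ.filter fun e : Fin d → Fin 3 => IsTwoOne e)).card = S.card := by
    symm
    refine Finset.card_bij (fun i _ j => if j = i then 1 else if j ∈ S then 0 else 2) ?_ ?_ ?_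
    · intro i hi
      refine Finset.mem_filter.2 ⟨Finset.mem_filter.2 ⟨Finset.mem_univ _, ?_, ?_⟩, ?_⟩
      · have : (Finset.univ.filter fun j => (if j = i then (1 : Fin 3) else
            if j ∈ S then 0 else 2) = 0) = S.erase i := by
          ext j
          by_cases hj : j = i <;> by_cases hjS : j ∈ S <;> simp [hj, hjS]
        rw [this, Finset.card_erase_of_mem hi, hS3]
      · have : (Finset.univ.filter fun j => (if j = i then (1 : Fin 3) else
            if j ∈ S then 0 else 2) = 1) = {i} := by
          ext j
          by_cases hj : j = i <;> by_cases hjS : j ∈ S <;> simp [hj, hjS]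
        rw [this, Finset.card_singleton]
      · ext j
        by_cases hj : j = i <;> by_cases hjS : j ∈ S <;> simp [supp, hj, hjS]
        · exact hi
        · exact hi
    · intro i hi j hj h
      by_contra hne
      have := congrFun h i
      simp [hne, hi] at this
    · intro e he
      obtain ⟨he, heS⟩ := Finset.mem_filter.1 he
      obtain ⟨-, he0, he1⟩ := Finset.mem_filter.1 he
      obtain ⟨i, hi⟩ := Finset.card_eq_one.1 he1
      have hi1 : ∀ j, e j = 1 ↔ j = i := by
        intro j
        have : j ∈ (Finset.univ.filter fun i => e i = 1) ↔ j ∈ ({i} : Finset (Fin d)) := by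
          rw [hi]
        simpa using this
      have hS2 : ∀ j, e j ≠ 2 ↔ j ∈ S := by
        intro j
        rw [← heS]
        simp [supp]
      refine ⟨i, ?_, ?_⟩
      · rw [← hS2, (hi1 i).2 rfl]
        decide
      · funext j
        by_cases hj : j = i
        · simp [hj, (hi1 i).2 rfl]
        · by_cases hjS : j ∈ S
          · have h1 := (hi1 j).not.2 hj
            have h2 := (hS2 j).2 hjS
            simp only [hj, hjS, if_true, if_false]
            generalize e j = a at h1 h2
            revert h1 h2
            revert a
            decide
          · have h2 := (hS2 j).not.2 hjS
            simp only [hj, hjS, if_false]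
            exact (not_not.1 h2).symm
  rw [this, hS3]

lemma exists_isTwoOne (hd : 3 ≤ d) : ∃ e : Fin d → Fin 3, IsTwoOne e := by
  refine ⟨fun i => if (i : ℕ) = 0 then 1 else if (i : ℕ) < 3 then 0 else 2, ?_, ?_⟩
  · rw [Finset.card_eq_two]
    refine ⟨⟨1, by omega⟩, ⟨2, by omega⟩, by simp, ?_⟩
    ext i
    simp only [Finset.mem_filter, Finset.mem_univ, true_and, Finset.mem_insert,
      Finset.mem_singleton, Fin.ext_iff]
    split_ifs <;> simp <;> omega
  · rw [Finset.card_eq_one]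
    refine ⟨⟨0, by omega⟩, ?_⟩
    ext i
    simp only [Finset.mem_filter, Finset.mem_univ, true_and, Finset.mem_singleton, Fin.ext_iff]
    split_ifs <;> simp <;> omega

/-- The sum of the elements `u^e ⊗ w` over the exponents with two entries `0` and one entry `1`. -/
def twoOneSum (w : W) : WreathSuper F d ⧸ annIdeal (F := F) w :=
  ∑ e ∈ Finset.univ.filter fun e : Fin d → Fin 3 => IsTwoOne e,
    Submodule.Quotient.mk (basis F (e, 1))

lemma coeffMapQ_twoOneSum {Y : Type*} [AddCommGroup Y] [Module F Y] (w : W)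
    (A : (Fin d → Fin 3) → W →ₗ[F] Y) : coeffMapQ w A (twoOneSum w) =
      ∑ e ∈ Finset.univ.filter fun e : Fin d → Fin 3 => IsTwoOne e, A e w := by
  rw [twoOneSum, map_sum]
  refine Finset.sum_congr rfl fun e _ => ?_
  rw [coeffMapQ_mk, coeffMap_basis, map_one, one_smul]

lemma twoOneSum_ne_zero (hd : 3 ≤ d) {w : W} (hw : w ≠ 0) : twoOneSum (F := F) (d := d) w ≠ 0 := by
  classical
  obtain ⟨e₀, he₀⟩ := exists_isTwoOne hd
  intro h
  apply hw
  -- The coefficient map at the single exponent e₀ returns w. Equivariance is not needed for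
  -- coefficient maps to descend to the quotient.
  have := coeffMapQ_twoOneSum (F := F) w fun e => if e = e₀ then LinearMap.id else 0
  rw [h, map_zero, Finset.sum_eq_single e₀] at this
  · simpa using this.symm
  · intro e _ he
    simp [he]
  · intro h
    exact absurd (Finset.mem_filter.2 ⟨Finset.mem_univ _, he₀⟩) h

lemma coeffMapQ_degFamily_twoOneSum [CharP F 3] (w : W) :
    coeffMapQ w (degFamily F d W) (twoOneSum w) = 0 := by
  rw [coeffMapQ_twoOneSum]
  have : ∀ e ∈ Finset.univ.filter fun e : Fin d → Fin 3 => IsTwoOne e,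
      -- The top degree 2d drops by 2 for each exponent 0 and by 1 for the exponent 1. For d < 3
      -- there are no such exponents, so the truncated subtraction is harmless.
      degFamily F d W e w = Pi.single ⟨2 * d - 5, by omega⟩ w := by
    intro e he
    have he := (Finset.mem_filter.1 he).2
    refine degFamily_apply he.atMostOneOdd ?_ w
    have := he.sum
    simp only
    omega
  rw [Finset.sum_congr rfl this, Finset.sum_const, ← Nat.cast_smul_eq_nsmul F,
    (CharP.cast_eq_zero_iff F 3 _).2 three_dvd_card_isTwoOne, zero_smul]

lemma iota_of_smul_twoOneSum {w : W} {σ : Equiv.Perm (Fin d)} {c : F}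
    (hc : MonoidAlgebra.of F _ σ • w = c • w) :
    iota F d (MonoidAlgebra.of F _ σ) • twoOneSum (F := F) w = c • twoOneSum (F := F) (d := d) w := by
  rw [twoOneSum, Finset.smul_sum, Finset.smul_sum]
  refine Finset.sum_bij (fun e _ => e ∘ ⇑(σ⁻¹)) ?_ ?_ ?_ ?_
  · intro e he
    exact Finset.mem_filter.2 ⟨Finset.mem_univ _, (Finset.mem_filter.1 he).2.comp _⟩
  · intro e _ f _ h
    exact (σ⁻¹).surjective.injective_comp_right h
  · intro e he
    refine ⟨e ∘ σ, Finset.mem_filter.2 ⟨Finset.mem_univ _, (Finset.mem_filter.1 he).2.comp _⟩, ?_⟩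
    funext i
    simp
  · intro e he
    have he := (Finset.mem_filter.1 he).2
    rw [← Submodule.Quotient.mk_smul, ← Submodule.Quotient.mk_smul, Submodule.Quotient.eq, iota_of,
      smul_eq_mul, mono_zero_mul_basis, he.atMostOneOdd.permSign_eq_zero, pow_zero, one_smul,
      mul_one]
    -- The difference is a left multiple of σ - c, which annihilates w.
    have : basis F (e ∘ ⇑(σ⁻¹), σ) - c • basis F (e ∘ ⇑(σ⁻¹), 1) =
        basis F (e ∘ ⇑(σ⁻¹), 1) * iota F d (MonoidAlgebra.of F _ σ - algebraMap F _ c) := by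
      rw [map_sub, iota_of, mul_sub, basis_mul_mono_zero, one_mul, AlgHom.commutes,
        Algebra.algebraMap_eq_smul_one, mul_smul_comm, mul_one]
    rw [this]
    refine Submodule.smul_mem _ _ (Submodule.subset_span ⟨_, ?_, rfl⟩)
    rw [sub_smul, hc, algebraMap_smul, sub_self]

lemma SwapsActAsSign.idempotent_smul_twoOneSum (h : SwapsActAsSign F d W) (w : W)
    {e : MonoidAlgebra F (Equiv.Perm (Fin d))} (he : IsIdempotentElem e) (hx : ∃ x : W, e • x ≠ 0) :
    iota F d e • twoOneSum (F := F) w = twoOneSum (F := F) (d := d) w := by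
  -- Each group algebra element acts on W and on `twoOneSum w` by one and the same scalar. For an
  -- idempotent that is nonzero on W this scalar is 1.
  have key : ∀ a : MonoidAlgebra F (Equiv.Perm (Fin d)), ∃ c : F, (∀ x : W, a • x = c • x) ∧
      iota F d a • twoOneSum (F := F) w = c • twoOneSum (F := F) (d := d) w := by
    intro a
    induction a using MonoidAlgebra.induction_on with
    | of σ =>
      obtain ⟨c, -, hc⟩ := h.exists_scalar σ
      exact ⟨c, hc, iota_of_smul_twoOneSum (hc w)⟩
    | add a b ha hb =>
      obtain ⟨c, hc, hc'⟩ := ha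
      obtain ⟨c₂, hc₂, hc₂'⟩ := hb
      exact ⟨c + c₂, fun x => by rw [add_smul, add_smul, hc, hc₂],
        by rw [map_add, add_smul, add_smul, hc', hc₂']⟩
    | smul r a ha =>
      obtain ⟨c, hc, hc'⟩ := ha
      exact ⟨r * c, fun x => by rw [smul_assoc, hc, mul_smul],
        by rw [map_smul, smul_assoc, hc', mul_smul]⟩
  obtain ⟨c, hc, hc'⟩ := key e
  obtain ⟨x, hx⟩ := hx
  have hc1 : c • x = x := by
    have h1 : e • e • x = e • x := by rw [smul_smul, he.eq]
    rw [hc, hc] at h1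
    have hc0 : c ≠ 0 := by
      rintro rfl
      exact hx (by rw [hc, zero_smul])
    exact smul_right_injective W hc0 h1
  have hx0 : x ≠ 0 := by
    rintro rfl
    exact hx (smul_zero _)
  have : c = 1 := smul_left_injective F hx0 (hc1.trans (one_smul F x).symm)
  rw [hc', this, one_smul]

variable [IsSimpleModule (MonoidAlgebra F (Equiv.Perm (Fin d))) W]

omit [Module F W] [IsScalarTower F (MonoidAlgebra F (Equiv.Perm (Fin d))) W] in
/-- In characteristic `3` the diagonal Cartan invariant of a one-dimensional module is larger than
`2d + 1`. -/
theorem SwapsActAsSign.lt_cartanInvariant [CharP F 3] (hd : 3 ≤ d) (h : SwapsActAsSign F d W) :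
    2 * d + 1 < cartanInvariant (WreathSuper F d) (TTriv F d W) (TTriv F d W) := by
  let _ : Module F W := Module.compHom W (algebraMap F (MonoidAlgebra F (Equiv.Perm (Fin d))))
  have : IsScalarTower F (MonoidAlgebra F (Equiv.Perm (Fin d))) W :=
    IsScalarTower.of_algebraMap_smul fun _ _ => rfl
  have := IsSimpleModule.nontrivial (MonoidAlgebra F (Equiv.Perm (Fin d))) W
  obtain ⟨w, hw⟩ := exists_ne (0 : W)
  obtain ⟨e, he, hpos, hle⟩ := exists_idempotent_finrank_le (F := F) (d := d) hw
  rw [← mul_finrank_le_of_surjective isEquivariant_degFamily (range_degFamily hw) he,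
    Fintype.card_fin] at hle
  have hx : ∃ x : W, e • x ≠ 0 := by
    by_contra! hx
    have : idemPart F e W = ⊥ := LinearMap.range_eq_bot.2 (LinearMap.ext hx)
    rw [this, finrank_bot] at hpos
    exact hpos.false
  have hv := h.idempotent_smul_twoOneSum w he hx
  have hker : 0 < finrank F (LinearMap.ker (coeffMapQ w (degFamily F d W) ∘ₗ
      (idemPart F (iota F d e) (WreathSuper F d ⧸ annIdeal (F := F) w)).subtype)) := by
    have : (⟨twoOneSum w, ⟨_, hv⟩⟩ : idemPart F (iota F d e)
        (WreathSuper F d ⧸ annIdeal (F := F) w)) ≠ 0 :=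
      fun h0 => twoOneSum_ne_zero hd hw (congrArg Subtype.val h0)
    exact Submodule.finrank_pos_of_mem (coeffMapQ_degFamily_twoOneSum w) this
  exact lt_of_mul_lt_mul_right (lt_of_lt_of_le (Nat.lt_add_of_pos_right hker) hle) (Nat.zero_le _)

end Scalar

end

end WreathSuper

/-! ## The diagonal Cartan invariants of one-dimensional modules in characteristic zero -/

namespace WreathSuper

noncomputable section

open Module

section UpperBound

/-- With at most one exponent 1, the parity of the degree decides whether it occurs; the degree then
fixes the number of 2s and hence of 0s. Equal multiplicities mean the same orbit. -/
lemma exists_perm_of_sum_eq {d : ℕ} {f g : Fin d → Fin 3} (hf : AtMostOneOdd f)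
    (hg : AtMostOneOdd g) (h : ∑ i, (f i : ℕ) = ∑ i, (g i : ℕ)) :
    ∃ σ : Equiv.Perm (Fin d), g ∘ σ = f := by
  have count : ∀ {f : Fin d → Fin 3}, AtMostOneOdd f →
      (Finset.univ.filter fun i => f i = 1).card ≤ 1 ∧
      (Finset.univ.filter fun i => f i = 0).card + (Finset.univ.filter fun i => f i = 1).card +
        (Finset.univ.filter fun i => f i = 2).card = d ∧
      (Finset.univ.filter fun i => f i = 1).card +
        2 * (Finset.univ.filter fun i => f i = 2).card = ∑ i, (f i : ℕ) := by
    intro f hf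
    refine ⟨?_, ?_, ?_⟩
    · refine Finset.card_le_one.2 fun i hi j hj => ?_
      refine hf i j ?_ ?_
      · simp [(Finset.mem_filter.1 hi).2]
      · simp [(Finset.mem_filter.1 hj).2]
    · have h1 : ∀ a : Fin 3, (if a = 0 then 1 else 0) + (if a = 1 then 1 else 0) +
          (if a = 2 then 1 else 0) = 1 := by decide
      rw [Finset.card_filter, Finset.card_filter, Finset.card_filter, ← Finset.sum_add_distrib,
        ← Finset.sum_add_distrib, Finset.sum_congr rfl fun i _ => h1 (f i)]
      simp
    · have h1 : ∀ a : Fin 3, (if a = 1 then 1 else 0) + 2 * (if a = 2 then 1 else 0) =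
          (a : ℕ) := by decide
      rw [Finset.card_filter, Finset.card_filter, Finset.mul_sum, ← Finset.sum_add_distrib]
      exact Finset.sum_congr rfl fun i _ => h1 (f i)
  obtain ⟨a1, a2, a3⟩ := count hf
  obtain ⟨b1, b2, b3⟩ := count hg
  have key : ∀ a : Fin 3, (Finset.univ.filter fun i => f i = a).card =
      (Finset.univ.filter fun i => g i = a).card := by
    rw [← h] at b3
    intro a
    fin_cases a <;> simp only [Fin.zero_eta, Fin.mk_one, Fin.reduceFinMk] <;> omega
  have e : ∀ a : Fin 3, Nonempty ({i // f i = a} ≃ {i // g i = a}) := fun a =>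
    Fintype.card_eq.1 (by rw [Fintype.card_subtype, Fintype.card_subtype, key])
  exact ⟨Equiv.ofFiberEquiv fun a => (e a).some, funext fun i => Equiv.ofFiberEquiv_map _ i⟩

lemma exists_swap_of_not_atMostOneOdd {d : ℕ} {f : Fin d → Fin 3} (hf : ¬ AtMostOneOdd f) :
    ∃ i j, f ∘ ⇑(Equiv.swap i j) = f ∧ permSign (Equiv.swap i j) (fun i => f i) = 1 := by
  have h1 : ∀ {i}, Odd (f i : ℕ) → f i = 1 := by
    intro i hi
    generalize f i = a at hi
    revert hi
    revert a
    decide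
  obtain ⟨i, j, hi, hj, hij⟩ : ∃ i j, Odd (f i : ℕ) ∧ Odd (f j : ℕ) ∧ i < j := by
    simp only [AtMostOneOdd, not_forall] at hf
    obtain ⟨i, j, hi, hj, hij⟩ := hf
    rcases lt_or_gt_of_ne hij with h | h
    · exact ⟨i, j, hi, hj, h⟩
    · exact ⟨j, i, hj, hi, h⟩
  -- The odd position i is exchanged with the next odd position k. No odd factor lies between them,
  -- so (i, k) is the only inverted pair of odd factors and the sign is exactly -1.
  let S := Finset.univ.filter fun k => i < k ∧ Odd (f k : ℕ)
  have hS : S.Nonempty := ⟨j, by simp [S, hij, hj]⟩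
  obtain ⟨k, hk⟩ : ∃ k, k = S.min' hS := ⟨_, rfl⟩
  have hkS : i < k ∧ Odd (f k : ℕ) := by
    have := S.min'_mem hS
    rw [← hk] at this
    simpa [S] using this
  have hmin : ∀ l, i < l → Odd (f l : ℕ) → k ≤ l := fun l h h' => by
    rw [hk]
    exact S.min'_le l (by simp [S, h, h'])
  refine ⟨i, k, ?_, ?_⟩
  · funext l
    simp only [Function.comp_apply, Equiv.swap_apply_def]
    split_ifs with h h'
    · rw [h, h1 hkS.2, h1 hi]
    · rw [h', h1 hkS.2, h1 hi]
    · rfl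
  · rw [permSign, Finset.card_eq_one]
    refine ⟨(i, k), ?_⟩
    ext ⟨a, b⟩
    rw [Finset.mem_filter, Finset.mem_singleton, Prod.mk.injEq]
    simp only [Finset.mem_univ, true_and, Equiv.swap_apply_def]
    constructor
    · rintro ⟨hab, hs, ha, hb⟩
      have h2 := hmin b
      have h3 := hmin a
      have hik := hkS.1
      by_cases hai : a = i
      · subst hai
        refine ⟨rfl, le_antisymm ?_ (h2 hab hb)⟩
        by_contra hlt
        rw [if_pos rfl, if_neg hab.ne', if_neg (not_le.1 hlt).ne'] at hs
        exact hlt hs.le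
      · exfalso
        rw [if_neg hai] at hs
        by_cases hak : a = k
        · subst hak
          rw [if_pos rfl, if_neg (hik.trans hab).ne', if_neg hab.ne'] at hs
          exact (hs.trans (hik.trans hab)).false
        · rw [if_neg hak] at hs
          by_cases hbi : b = i
          · subst hbi
            rw [if_pos rfl] at hs
            exact (hs.trans (hab.trans hik)).false
          · rw [if_neg hbi] at hs
            by_cases hbk : b = k
            · subst hbk
              rw [if_pos rfl] at hs
              exact (h3 hs ha).not_gt hab
            · rw [if_neg hbk] at hs
              exact (hs.trans hab).false
    · rintro ⟨rfl, rfl⟩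
      refine ⟨hkS.1, ?_, hi, hkS.2⟩
      rw [if_neg hkS.1.ne', if_pos rfl, if_pos rfl]
      exact hkS.1

variable {F : Type u} [Field F] {d : ℕ}

/-- The idempotent of a linear character with values `±1`. -/
def charIdem (c : Equiv.Perm (Fin d) → F) : MonoidAlgebra F (Equiv.Perm (Fin d)) :=
  ((d.factorial : ℕ) : F)⁻¹ • ∑ σ, c σ • MonoidAlgebra.of F _ σ

lemma of_mul_charIdem {c : Equiv.Perm (Fin d) → F} (hc : ∀ σ, c σ * c σ = 1)
    (hm : ∀ σ τ, c (σ * τ) = c σ * c τ) (τ : Equiv.Perm (Fin d)) :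
    MonoidAlgebra.of F _ τ * charIdem c = c τ • charIdem c := by
  rw [charIdem, mul_smul_comm,
    smul_comm (c τ) _ (∑ σ, c σ • MonoidAlgebra.of F (Equiv.Perm (Fin d)) σ),
    Finset.mul_sum, Finset.smul_sum (r := c τ)]
  refine congrArg _ ?_
  refine Fintype.sum_equiv (Equiv.mulLeft τ) _ _ fun σ => ?_
  rw [mul_smul_comm, ← map_mul, Equiv.coe_mulLeft, hm, smul_smul, ← mul_assoc, hc, one_mul]

lemma charIdem_mul_of {c : Equiv.Perm (Fin d) → F} (hc : ∀ σ, c σ * c σ = 1)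
    (hm : ∀ σ τ, c (σ * τ) = c σ * c τ) (τ : Equiv.Perm (Fin d)) :
    charIdem c * MonoidAlgebra.of F _ τ = c τ • charIdem c := by
  rw [charIdem, smul_mul_assoc,
    smul_comm (c τ) _ (∑ σ, c σ • MonoidAlgebra.of F (Equiv.Perm (Fin d)) σ),
    Finset.sum_mul, Finset.smul_sum (r := c τ)]
  refine congrArg _ ?_
  refine Fintype.sum_equiv (Equiv.mulRight τ) _ _ fun σ => ?_
  rw [smul_mul_assoc, ← map_mul, Equiv.coe_mulRight, hm, smul_smul, mul_comm (c σ), ← mul_assoc,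
    hc, one_mul]

lemma charIdem_smul [CharZero F] {c : Equiv.Perm (Fin d) → F} (hc : ∀ σ, c σ * c σ = 1)
    {M : Type*} [AddCommGroup M] [Module (MonoidAlgebra F (Equiv.Perm (Fin d))) M]
    [Module F M] [IsScalarTower F (MonoidAlgebra F (Equiv.Perm (Fin d))) M] {x : M}
    (hx : ∀ σ, MonoidAlgebra.of F _ σ • x = c σ • x) : charIdem c • x = x := by
  rw [charIdem, smul_assoc, Finset.sum_smul]
  have : ∀ σ ∈ Finset.univ, (c σ • MonoidAlgebra.of F (Equiv.Perm (Fin d)) σ) • x = x := by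
    intro σ _
    rw [smul_assoc, hx, smul_smul, hc, one_smul]
  rw [Finset.sum_congr rfl this, Finset.sum_const, Finset.card_univ, Fintype.card_perm,
    Fintype.card_fin, ← Nat.cast_smul_eq_nsmul F, smul_smul,
    inv_mul_cancel₀ (Nat.cast_ne_zero.2 d.factorial_ne_zero), one_smul]

lemma isIdempotentElem_charIdem [CharZero F] {c : Equiv.Perm (Fin d) → F}
    (hc : ∀ σ, c σ * c σ = 1) (hm : ∀ σ τ, c (σ * τ) = c σ * c τ) :
    IsIdempotentElem (charIdem c) := by
  rw [IsIdempotentElem, ← smul_eq_mul]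
  exact charIdem_smul hc fun σ => of_mul_charIdem hc hm σ

section Generated

variable {c : Equiv.Perm (Fin d) → F} (hc : ∀ σ, c σ * c σ = 1)
  (hm : ∀ σ τ, c (σ * τ) = c σ * c τ)
  {M : Type u} [AddCommGroup M] [Module (WreathSuper F d) M] [Module F M]
  [IsScalarTower F (WreathSuper F d) M] {p : M} (hp : iota F d (charIdem c) • p = p)

include hc hm hp

lemma mono_zero_smul_eq (σ : Equiv.Perm (Fin d)) : mono F 0 σ • p = c σ • p := by
  rw [← hp, ← iota_of, smul_smul, ← map_mul, of_mul_charIdem hc hm, map_smul, smul_assoc]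

/-- Insert σ between the idempotent and u^f. Absorbed to the left it gives c σ; moved to the right
it permutes f with a sign and then acts on p, again as c σ. The two scalars cancel. -/
lemma charIdem_smul_basis_comp (f : Fin d → Fin 3) (σ : Equiv.Perm (Fin d)) :
    iota F d (charIdem c) • basis F (f, 1) • p =
      (-1 : F) ^ permSign σ (fun i => f i) •
        iota F d (charIdem c) • basis F (f ∘ ⇑(σ⁻¹), 1) • p := by
  have h1 : (iota F d (charIdem c) * mono F 0 σ) • basis F (f, 1) • p =
      c σ • iota F d (charIdem c) • basis F (f, 1) • p := by
    rw [← iota_of, ← map_mul, charIdem_mul_of hc hm, map_smul, smul_assoc]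
  have h2 : (iota F d (charIdem c) * mono F 0 σ) • basis F (f, 1) • p =
      c σ • (-1 : F) ^ permSign σ (fun i => f i) •
        iota F d (charIdem c) • basis F (f ∘ ⇑(σ⁻¹), 1) • p := by
    rw [mul_smul, ← mul_smul (mono F 0 σ), mono_zero_mul_basis, mul_one, ← one_mul σ,
      ← basis_mul_mono_zero, one_mul, smul_assoc, mul_smul, mono_zero_smul_eq hc hm hp,
      smul_comm (basis F (f ∘ ⇑(σ⁻¹), 1)) (c σ) p, smul_comm _ (c σ),
      smul_comm (iota F d (charIdem c)) (c σ), smul_comm (iota F d (charIdem c))]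
  have hc0 : c σ ≠ 0 := left_ne_zero_of_mul_eq_one (hc σ)
  exact smul_right_injective M hc0 (h1.symm.trans h2)

/-- With at most one odd exponent, f can be permuted to the standard exponent of its degree.
Otherwise exchanging two odd factors shows the vector equals its own negative, so it vanishes. -/
lemma charIdem_smul_basis_mem [CharZero F] (f : Fin d → Fin 3) :
    iota F d (charIdem c) • basis F (f, 1) • p ∈ Submodule.span F (Set.range
      fun k : Fin (2 * d + 1) => iota F d (charIdem c) • basis F (stdExp d k, 1) • p) := by
  by_cases hf : AtMostOneOdd f
  · obtain ⟨σ, hσ⟩ := exists_perm_of_sum_eq hf (atMostOneOdd_stdExp d (∑ i, (f i : ℕ)))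
      (sum_stdExp (sum_le_two_mul f)).symm
    have : f ∘ ⇑(σ⁻¹) = stdExp d (∑ i, (f i : ℕ)) := by
      funext i
      have := congrFun hσ (σ⁻¹ i)
      simpa using this.symm
    rw [charIdem_smul_basis_comp hc hm hp f σ, this]
    exact Submodule.smul_mem _ _ (Submodule.subset_span
      ⟨⟨∑ i, (f i : ℕ), Nat.lt_succ_of_le (sum_le_two_mul f)⟩, rfl⟩)
  · obtain ⟨i, j, hij, hs⟩ := exists_swap_of_not_atMostOneOdd hf
    have := charIdem_smul_basis_comp hc hm hp f (Equiv.swap i j)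
    rw [hs, pow_one, Equiv.swap_inv, hij, neg_smul, one_smul] at this
    have h2 := add_eq_zero_iff_eq_neg.2 this
    rw [← two_smul F] at h2
    rw [(smul_eq_zero.1 h2).resolve_left two_ne_zero]
    exact Submodule.zero_mem _

lemma finrank_idemPart_charIdem_le [CharZero F] [Module.Finite F M]
    (hgen : ∀ x : M, ∃ r : WreathSuper F d, r • p = x) :
    finrank F (idemPart F (iota F d (charIdem c)) M) ≤ 2 * d + 1 := by
  set V := Submodule.span F (Set.range
      fun k : Fin (2 * d + 1) => iota F d (charIdem c) • basis F (stdExp d k, 1) • p) with hV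
  have hle : idemPart F (iota F d (charIdem c)) M ≤ V := by
    rintro _ ⟨x, rfl⟩
    obtain ⟨r, rfl⟩ := hgen x
    have : V.mkQ ∘ₗ Algebra.lsmul F F M (iota F d (charIdem c)) ∘ₗ
        (LinearMap.toSpanSingleton (WreathSuper F d) M p).restrictScalars F = 0 := by
      refine basis_ext fun f σ => ?_
      change V.mkQ (iota F d (charIdem c) • basis F (f, σ) • p) = 0
      rw [Submodule.mkQ_apply, Submodule.Quotient.mk_eq_zero, ← one_mul σ, ← basis_mul_mono_zero,
        mul_smul, mono_zero_smul_eq hc hm hp, smul_comm (basis F (f, 1)) (c σ) p,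
        smul_comm (iota F d (charIdem c)) (c σ)]
      exact Submodule.smul_mem _ _ (charIdem_smul_basis_mem hc hm hp f)
    exact (Submodule.Quotient.mk_eq_zero V).1 (congrArg (fun f => f r) this)
  refine (Submodule.finrank_mono hle).trans ?_
  exact (finrank_range_le_card _).trans (Fintype.card_fin _).le

end Generated

/-- In characteristic zero the diagonal Cartan invariant of a one-dimensional module is at most
`2d + 1`. -/
theorem SwapsActAsSign.cartanInvariant_le [CharZero F] {W : Type u} [AddCommGroup W]
    [Module (MonoidAlgebra F (Equiv.Perm (Fin d))) W]
    [IsSimpleModule (MonoidAlgebra F (Equiv.Perm (Fin d))) W] (h : SwapsActAsSign F d W) :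
    cartanInvariant (WreathSuper F d) (TTriv F d W) (TTriv F d W) ≤ 2 * d + 1 := by
  let _ : Module F W := Module.compHom W (algebraMap F (MonoidAlgebra F (Equiv.Perm (Fin d))))
  have : IsScalarTower F (MonoidAlgebra F (Equiv.Perm (Fin d))) W :=
    IsScalarTower.of_algebraMap_smul fun _ _ => rfl
  have := IsSimpleModule.nontrivial (MonoidAlgebra F (Equiv.Perm (Fin d))) W
  have : Module.Finite F W := finite_of_isSimpleModule (d := d)
  obtain ⟨w, hw⟩ := exists_ne (0 : W)
  choose c hc hcx using h.exists_scalar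
  have hm : ∀ σ τ, c (σ * τ) = c σ * c τ := fun σ τ => by
    refine smul_left_injective F hw ?_
    change c (σ * τ) • w = (c σ * c τ) • w
    rw [← hcx, map_mul, mul_smul, hcx, hcx, mul_smul]
  obtain ⟨P, hP⟩ := exists_cartanInvariant_eq (F := F) (d := d) (W := W)
  let _ : Module F P.carrier := Module.compHom P.carrier (algebraMap F (WreathSuper F d))
  have : IsScalarTower F (WreathSuper F d) P.carrier :=
    IsScalarTower.of_algebraMap_smul fun _ _ => rfl
  have := finite_of_projectiveCover F P
  have he := isIdempotentElem_charIdem hc hm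
  have hei : IsIdempotentElem (iota F d (charIdem c)) := he.map (iota F d)
  obtain ⟨p, hp⟩ := P.surjective (TTriv.mk w)
  -- The idempotent fixes w, so its multiple of p still maps to w and therefore still generates the
  -- cover.
  have hP0 : P.toFun (iota F d (charIdem c) • p) ≠ 0 := by
    rw [map_smul, hp, TTriv.smul_mk, aug_iota, charIdem_smul hc fun σ => hcx σ w]
    exact hw
  have hle := finrank_idemPart_charIdem_le hc hm (p := iota F d (charIdem c) • p)
    (by rw [smul_smul, hei.eq]) fun x => span_eq_top_of_projectiveCover P hP0 x
  have hmul := compositionMultiplicity_mul_le (F := F) (M := P.carrier) (M' := TTriv F d W) hei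
  have hpos : 0 < finrank F (idemPart F (iota F d (charIdem c)) (TTriv F d W)) := by
    rw [finrank_idemPart_TTriv]
    have : Nontrivial (idemPart F (charIdem c) W) :=
      ⟨⟨w, ⟨w, charIdem_smul hc fun σ => hcx σ w⟩⟩, 0, fun h => hw (congrArg Subtype.val h)⟩
    exact finrank_pos
  rw [hP]
  exact (Nat.le_mul_of_pos_right _ hpos).trans (hmul.trans hle)

end UpperBound

end

end WreathSuper

/-! ## Specht modules and James' submodule theorem -/

namespace Nat.Partition

variable {d : ℕ} {ν : Nat.Partition d}

lemma Tableau.col_lt (t : ν.Tableau) (x : Fin d) : t.col x < ν.rowLength (t.row x) :=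
  (t.symm x).2

lemma Tableau.ext_row_col (t : ν.Tableau) {x y : Fin d} (hr : t.row x = t.row y)
    (hc : t.col x = t.col y) : x = y :=
  t.symm.injective (Subtype.ext (Prod.ext hr hc))

lemma Tableau.row_apply (t : ν.Tableau) (p : ν.Node) : t.row (t p) = p.1.1 := by
  simp [Tableau.row]

lemma Tableau.col_apply (t : ν.Tableau) (p : ν.Node) : t.col (t p) = p.1.2 := by
  simp [Tableau.col]

lemma tabloid_smul_apply (σ : Equiv.Perm (Fin d)) (r : ν.Tabloid) (x : Fin d) :
    (σ • r).1 x = r.1 (σ⁻¹ x) := rfl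

/-- A set of `n` natural numbers has sum at least `0 + 1 + ⋯ + (n - 1)`, with equality only for the
initial segment. -/
lemma sum_range_add_card_sdiff_le (S : Finset ℕ) :
    ∑ i ∈ Finset.range S.card, i + (Finset.range S.card \ S).card ≤ ∑ i ∈ S, i := by
  set R := Finset.range S.card with hR
  have hcard : (S \ R).card = (R \ S).card := by
    have h1 := Finset.card_sdiff_add_card_inter S R
    have h2 := Finset.card_sdiff_add_card_inter R S
    rw [Finset.inter_comm] at h2
    have : R.card = S.card := Finset.card_range _
    omega
  have h1 : (S \ R).card * S.card ≤ ∑ i ∈ S \ R, i := by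
    rw [← smul_eq_mul]
    refine Finset.card_nsmul_le_sum _ _ _ fun i hi => ?_
    have := (Finset.mem_sdiff.1 hi).2
    rw [hR, Finset.mem_range] at this
    omega
  -- Missing elements are smaller than |S| while their equally many replacements are at least |S|,
  -- so each replacement costs at least 1.
  have h2 : ∑ i ∈ R \ S, i + (R \ S).card ≤ (R \ S).card * S.card := by
    rw [Finset.card_eq_sum_ones, ← Finset.sum_add_distrib, Finset.sum_mul]
    refine Finset.sum_le_sum fun i hi => ?_
    have := (Finset.mem_sdiff.1 hi).1
    rw [hR, Finset.mem_range] at this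
    omega
  have h3 := Finset.sum_inter_add_sum_sdiff S R (fun i => i)
  have h4 := Finset.sum_inter_add_sum_sdiff R S (fun i => i)
  rw [Finset.inter_comm] at h4
  rw [hcard] at h1
  omega

lemma Tableau.image_col_row (t : ν.Tableau) (i : ℕ) :
    (Finset.univ.filter fun x => t.row x = i).image t.col = Finset.range (ν.rowLength i) := by
  ext c
  simp only [Finset.mem_image, Finset.mem_filter, Finset.mem_univ, true_and, Finset.mem_range]
  constructor
  · rintro ⟨x, rfl, rfl⟩
    exact t.col_lt x
  · intro h
    exact ⟨t ⟨(i, c), h⟩, t.row_apply _, t.col_apply _⟩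

/-- If no row of a tabloid meets a column of the tableau twice, the columns of the letters in row
`i` are `0, …, ν_i - 1`. -/
lemma Tableau.col_lt_of_injective (t : ν.Tableau) (r : ν.Tabloid)
    (h : ∀ x y, t.col x = t.col y → r.1 x = r.1 y → x = y) (x : Fin d) :
    t.col x < ν.rowLength (r.1 x) := by
  let S : ℕ → Finset ℕ := fun i => (Finset.univ.filter fun x => r.1 x = i).image t.col
  let I : Finset ℕ := Finset.univ.image r.1 ∪ Finset.univ.image t.row
  have hinj : ∀ i, Set.InjOn t.col (Finset.univ.filter fun x => r.1 x = i : Finset (Fin d)) := by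
    intro i a ha b hb hab
    have ha := (Finset.mem_filter.1 (Finset.mem_coe.1 ha)).2
    have hb := (Finset.mem_filter.1 (Finset.mem_coe.1 hb)).2
    exact h a b hab (ha.trans hb.symm)
  have hcard : ∀ i, (S i).card = ν.rowLength i := fun i => by
    rw [Finset.card_image_of_injOn (hinj i), r.2 i]
  have h1 : ∑ i ∈ I, ∑ c ∈ S i, c = ∑ x, t.col x := by
    rw [← Finset.sum_fiberwise_of_maps_to (t := I) (g := r.1)
      (fun x _ => Finset.mem_union_left _ (Finset.mem_image_of_mem _ (Finset.mem_univ x)))]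
    exact Finset.sum_congr rfl fun i _ => Finset.sum_image (hinj i)
  have h2 : ∑ i ∈ I, ∑ c ∈ Finset.range (ν.rowLength i), c = ∑ x, t.col x := by
    rw [← Finset.sum_fiberwise_of_maps_to (t := I) (g := t.row)
      (fun x _ => Finset.mem_union_right _ (Finset.mem_image_of_mem _ (Finset.mem_univ x)))]
    refine Finset.sum_congr rfl fun i _ => ?_
    rw [← t.image_col_row]
    refine Finset.sum_image fun a ha b hb hab => ?_
    have ha := (Finset.mem_filter.1 (Finset.mem_coe.1 ha)).2
    have hb := (Finset.mem_filter.1 (Finset.mem_coe.1 hb)).2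
    exact t.ext_row_col (ha.trans hb.symm) hab
  -- The rows of r and the rows of t both exhaust the letters, so their column indices have the same
  -- total. For t this total is the least possible, hence no row of r has a defect.
  have h3 : ∑ i ∈ I, (Finset.range (ν.rowLength i) \ S i).card = 0 := by
    have : ∑ i ∈ I, (∑ c ∈ Finset.range (ν.rowLength i), c +
        (Finset.range (ν.rowLength i) \ S i).card) ≤ ∑ i ∈ I, ∑ c ∈ S i, c := by
      refine Finset.sum_le_sum fun i _ => ?_
      have := sum_range_add_card_sdiff_le (S i)
      rwa [hcard] at this
    rw [Finset.sum_add_distrib, h1, h2] at this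
    omega
  have h4 := Finset.sum_eq_zero_iff.1 h3 (r.1 x)
    (Finset.mem_union_left _ (Finset.mem_image_of_mem _ (Finset.mem_univ x)))
  rw [Finset.card_eq_zero, Finset.sdiff_eq_empty_iff_subset] at h4
  have h5 := Finset.eq_of_subset_of_card_le h4 (by rw [hcard, Finset.card_range])
  have : t.col x ∈ S (r.1 x) := Finset.mem_image_of_mem _ (by simp)
  rwa [← h5, Finset.mem_range] at this

/-- If no row of a tabloid meets a column of `t` twice, the tabloid is obtained from the tabloid of
`t` by a column permutation. -/
lemma Tableau.exists_smul_tabloid_eq (t : ν.Tableau) (r : ν.Tabloid)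
    (h : ∀ x y, t.col x = t.col y → r.1 x = r.1 y → x = y) :
    ∃ π : Equiv.Perm (Fin d), (∀ x, t.col (π x) = t.col x) ∧ π • t.tabloid = r := by
  let f : Fin d → Fin d := fun x => t ⟨(r.1 x, t.col x), t.col_lt_of_injective r h x⟩
  have hrow : ∀ x, t.row (f x) = r.1 x := fun x => t.row_apply _
  have hcol : ∀ x, t.col (f x) = t.col x := fun x => t.col_apply _
  have hf : Function.Injective f := fun x y hxy =>
    h x y (by rw [← hcol, hxy, hcol]) (by rw [← hrow, hxy, hrow])
  let π₀ : Equiv.Perm (Fin d) := Equiv.ofBijective f (Finite.injective_iff_bijective.1 hf)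
  have hπ : ∀ x, π₀ x = f x := fun _ => rfl
  refine ⟨π₀⁻¹, fun x => ?_, Subtype.ext (funext fun x => ?_)⟩
  · rw [← hcol (π₀⁻¹ x), ← hπ]
    simp
  · rw [tabloid_smul_apply, inv_inv, hπ]
    exact hrow x

noncomputable section

variable (F : Type*) [Field F]

instance (ν : Nat.Partition d) : IsScalarTower F (MonoidAlgebra F (Equiv.Perm (Fin d)))
    (PermModule F ν) := by
  refine ⟨fun c a x => ?_⟩
  change (tabloidRep F ν).asAlgebraHom (c • a) x = c • (tabloidRep F ν).asAlgebraHom a x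
  rw [map_smul]
  rfl

/-- The tabloid `r` as an element of the permutation module. -/
def tab (r : ν.Tabloid) : PermModule F ν := (Finsupp.single r (1 : F) : ν.Tabloid →₀ F)

lemma permModule_ext {M : Type*} [AddCommMonoid M] [Module F M] {f g : PermModule F ν →ₗ[F] M}
    (h : ∀ r, f (tab F r) = g (tab F r)) : f = g :=
  Finsupp.lhom_ext' fun r => LinearMap.ext_ring (h r)

lemma of_smul_eq (g : Equiv.Perm (Fin d)) (x : PermModule F ν) :
    MonoidAlgebra.of F _ g • x = (tabloidRep F ν g x : ν.Tabloid →₀ F) :=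
  congrArg (fun T => T x) ((tabloidRep F ν).asAlgebraHom_of g)

lemma of_smul_tab (g : Equiv.Perm (Fin d)) (r : ν.Tabloid) :
    MonoidAlgebra.of F _ g • tab F r = tab F (g • r) := by
  rw [of_smul_eq]
  exact Finsupp.mapDomain_single

/-- The column stabiliser. -/
def Tableau.colStab (t : ν.Tableau) : Finset (Equiv.Perm (Fin d)) :=
  Finset.univ.filter fun π => ∀ x, t.col (π x) = t.col x

lemma Tableau.mem_colStab {t : ν.Tableau} {π : Equiv.Perm (Fin d)} :
    π ∈ t.colStab ↔ ∀ x, t.col (π x) = t.col x := by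
  simp [Tableau.colStab]

lemma Tableau.mul_mem_colStab {t : ν.Tableau} {π ρ : Equiv.Perm (Fin d)} (hπ : π ∈ t.colStab)
    (hρ : ρ ∈ t.colStab) : π * ρ ∈ t.colStab := by
  rw [mem_colStab] at *
  intro x
  rw [Equiv.Perm.mul_apply, hπ, hρ]

lemma Tableau.inv_mem_colStab {t : ν.Tableau} {π : Equiv.Perm (Fin d)} (hπ : π ∈ t.colStab) :
    π⁻¹ ∈ t.colStab := by
  rw [mem_colStab] at *
  intro x
  rw [← hπ (π⁻¹ x)]
  simp

/-- The signed column sum. -/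
def kappa (t : ν.Tableau) : MonoidAlgebra F (Equiv.Perm (Fin d)) :=
  ∑ π ∈ t.colStab, ((Equiv.Perm.sign π : ℤ) : F) • MonoidAlgebra.of F _ π

lemma kappa_smul_tab (t : ν.Tableau) : kappa F t • tab F t.tabloid = polytabloid F t := by
  rw [kappa, Finset.sum_smul]
  refine Finset.sum_congr rfl fun π _ => ?_
  rw [smul_assoc, of_smul_tab]
  exact Finsupp.smul_single_one _ _

lemma sign_mul_self (π : Equiv.Perm (Fin d)) :
    ((Equiv.Perm.sign π : ℤ) : F) * ((Equiv.Perm.sign π : ℤ) : F) = 1 := by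
  rw [← Int.cast_mul, ← Units.val_mul, Int.units_mul_self]
  simp

lemma kappa_mul_of {t : ν.Tableau} {π : Equiv.Perm (Fin d)} (hπ : π ∈ t.colStab) :
    kappa F t * MonoidAlgebra.of F _ π = ((Equiv.Perm.sign π : ℤ) : F) • kappa F t := by
  rw [kappa, Finset.sum_mul, Finset.smul_sum]
  refine Finset.sum_bij (fun ρ _ => ρ * π) (fun ρ hρ => Tableau.mul_mem_colStab hρ hπ)
    (fun _ _ _ _ h => mul_right_cancel h)
    (fun ρ hρ => ⟨ρ * π⁻¹, Tableau.mul_mem_colStab hρ (Tableau.inv_mem_colStab hπ), by simp⟩)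
    fun ρ _ => ?_
  rw [smul_mul_assoc, ← map_mul, smul_smul, Equiv.Perm.sign_mul, Units.val_mul, Int.cast_mul,
    mul_left_comm, sign_mul_self, mul_one]

lemma of_mul_kappa {t : ν.Tableau} {π : Equiv.Perm (Fin d)} (hπ : π ∈ t.colStab) :
    MonoidAlgebra.of F _ π * kappa F t = ((Equiv.Perm.sign π : ℤ) : F) • kappa F t := by
  rw [kappa, Finset.mul_sum, Finset.smul_sum]
  refine Finset.sum_bij (fun ρ _ => π * ρ) (fun ρ hρ => Tableau.mul_mem_colStab hπ hρ)
    (fun _ _ _ _ h => mul_left_cancel h)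
    (fun ρ hρ => ⟨π⁻¹ * ρ, Tableau.mul_mem_colStab (Tableau.inv_mem_colStab hπ) hρ, by simp⟩)
    fun ρ _ => ?_
  rw [mul_smul_comm, ← map_mul, smul_smul, Equiv.Perm.sign_mul, Units.val_mul, Int.cast_mul,
    ← mul_assoc, sign_mul_self, one_mul]

lemma of_smul_polytabloid {t : ν.Tableau} {π : Equiv.Perm (Fin d)} (hπ : π ∈ t.colStab) :
    MonoidAlgebra.of F _ π • polytabloid F t = ((Equiv.Perm.sign π : ℤ) : F) • polytabloid F t := by
  rw [← kappa_smul_tab, smul_smul, of_mul_kappa F hπ, smul_assoc]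

/-- The signed column sum maps the permutation module onto the line of the polytabloid. -/
lemma exists_kappa_smul_eq (h2 : (2 : F) ≠ 0) (t : ν.Tableau) (x : PermModule F ν) :
    ∃ c : F, kappa F t • x = c • polytabloid F t := by
  have htab : ∀ r : ν.Tabloid, ∃ c : F, kappa F t • tab F r = c • polytabloid F t := by
    intro r
    by_cases h : ∀ x y, t.col x = t.col y → r.1 x = r.1 y → x = y
    · obtain ⟨π, hπ, rfl⟩ := t.exists_smul_tabloid_eq r h
      refine ⟨((Equiv.Perm.sign π : ℤ) : F), ?_⟩
      rw [← of_smul_tab, smul_smul, kappa_mul_of F (Tableau.mem_colStab.2 hπ), smul_assoc,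
        kappa_smul_tab]
    · push Not at h
      obtain ⟨x, y, hc, hr, hxy⟩ := h
      refine ⟨0, ?_⟩
      have hs : Equiv.swap x y ∈ t.colStab := by
        rw [Tableau.mem_colStab]
        intro z
        rw [Equiv.swap_apply_def]
        split_ifs with h1 h2
        · rw [h1, hc]
        · rw [h2, hc]
        · rfl
      have hfix : Equiv.swap x y • r = r := by
        refine Subtype.ext (funext fun z => ?_)
        rw [tabloid_smul_apply, Equiv.swap_inv, Equiv.swap_apply_def]
        split_ifs with h1 h2
        · rw [h1, hr]
        · rw [h2, hr]
        · rfl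
      -- The two letters share a row of r and a column of t. Their transposition fixes r and negates
      -- the signed column sum, so the product equals its negative and vanishes because 2 ≠ 0.
      have h := congrArg (fun a => a • tab F r) (kappa_mul_of F hs)
      simp only [Equiv.Perm.sign_swap hxy, mul_smul, of_smul_tab, hfix, smul_assoc] at h
      have h3 : (2 : F) • (kappa F t • tab F r) = 0 := by
        rw [two_smul]
        nth_rewrite 1 [h]
        simp
      rw [(smul_eq_zero.1 h3).resolve_left h2, zero_smul]
  let L : PermModule F ν →ₗ[F] PermModule F ν := Algebra.lsmul F F _ (kappa F t)
  have hL : ∀ x, L x ∈ Submodule.span F {polytabloid F t} := by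
    have : (Submodule.span F {polytabloid F t}).mkQ ∘ₗ L = 0 := by
      refine permModule_ext F fun r => ?_
      obtain ⟨c, hc⟩ := htab r
      change (Submodule.span F {polytabloid F t}).mkQ (kappa F t • tab F r) = 0
      rw [hc, Submodule.mkQ_apply, Submodule.Quotient.mk_eq_zero]
      exact Submodule.smul_mem _ _ (Submodule.mem_span_singleton_self _)
    exact fun x => (Submodule.Quotient.mk_eq_zero _).1 (congrArg (fun f => f x) this)
  obtain ⟨c, hc⟩ := Submodule.mem_span_singleton.1 (hL x)
  exact ⟨c, hc.symm⟩

lemma form_comm (x y : PermModule F ν) : form F ν x y = form F ν y x := by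
  have : form F ν = (form F ν).flip := by
    refine permModule_ext F fun r => permModule_ext F fun s => ?_
    change form F ν (tab F r) (tab F s) = form F ν (tab F s) (tab F r)
    rw [tab, tab, form_single, form_single]
    simp only [eq_comm]
  exact congrArg (fun f => f x y) this

lemma form_of_smul (g : Equiv.Perm (Fin d)) (x y : PermModule F ν) :
    form F ν (MonoidAlgebra.of F _ g • x) y = form F ν x (MonoidAlgebra.of F _ g⁻¹ • y) := by
  rw [of_smul_eq, of_smul_eq]
  exact form_rep ν g x y

lemma form_kappa_smul (t : ν.Tableau) (x y : PermModule F ν) :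
    form F ν (kappa F t • x) y = form F ν x (kappa F t • y) := by
  rw [kappa, Finset.sum_smul, Finset.sum_smul, map_sum, LinearMap.sum_apply, map_sum]
  refine Finset.sum_bij (fun π _ => π⁻¹) (fun π hπ => Tableau.inv_mem_colStab hπ)
    (fun _ _ _ _ h => inv_injective h)
    (fun π hπ => ⟨π⁻¹, Tableau.inv_mem_colStab hπ, inv_inv π⟩) fun π _ => ?_
  rw [smul_assoc, smul_assoc, LinearMap.map_smul, LinearMap.smul_apply, LinearMap.map_smul,
    form_of_smul, Equiv.Perm.sign_inv]

/-- Relabelling by g conjugates the column stabiliser, and conjugation preserves signs. -/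
lemma polytabloid_trans (t : ν.Tableau) (g : Equiv.Perm (Fin d)) :
    polytabloid F (ν := ν) (t.trans g) = MonoidAlgebra.of F _ g • polytabloid F t := by
  have hrow : ∀ x, Tableau.row (ν := ν) (t.trans g) x = t.row (g⁻¹ x) := fun _ => rfl
  have hcol : ∀ x, Tableau.col (ν := ν) (t.trans g) x = t.col (g⁻¹ x) := fun _ => rfl
  have htab : Tableau.tabloid (ν := ν) (t.trans g) = g • t.tabloid := rfl
  rw [← kappa_smul_tab, ← kappa_smul_tab, htab, ← of_smul_tab, smul_smul, smul_smul]
  congr 1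
  rw [kappa, kappa, Finset.sum_mul, Finset.mul_sum]
  refine Finset.sum_bij (fun π _ => g⁻¹ * π * g) ?_ ?_ ?_ ?_
  · intro π hπ
    rw [Tableau.mem_colStab] at *
    intro x
    have := hπ (g x)
    rw [hcol, hcol] at this
    simpa using this
  · intro π _ ρ _ h
    simpa using h
  · intro π hπ
    refine ⟨g * π * g⁻¹, ?_, by group⟩
    rw [Tableau.mem_colStab] at *
    intro x
    rw [hcol, hcol]
    simpa using hπ (g⁻¹ x)
  · intro π _
    rw [smul_mul_assoc, mul_smul_comm, ← map_mul, ← map_mul]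
    have h1 : Equiv.Perm.sign (g⁻¹ * π * g) = Equiv.Perm.sign π := by
      rw [Equiv.Perm.sign_mul, Equiv.Perm.sign_mul, mul_right_comm, ← Equiv.Perm.sign_mul]
      simp
    rw [h1, ← mul_assoc, ← mul_assoc, mul_inv_cancel, one_mul]

lemma specht_le_of_polytabloid_mem {U : Submodule (MonoidAlgebra F (Equiv.Perm (Fin d)))
    (PermModule F ν)} {t : ν.Tableau} (h : polytabloid F t ∈ U) : specht F ν ≤ U := by
  rw [specht, Submodule.span_le]
  rintro _ ⟨t', rfl⟩
  have : t' = t.trans (t.symm.trans t') := by ext; simp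
  rw [this, polytabloid_trans]
  exact U.smul_mem _ h

lemma mem_spechtPerp_of_forall {x : PermModule F ν}
    (h : ∀ t : ν.Tableau, form F ν x (polytabloid F t) = 0) : x ∈ spechtPerp F ν := by
  have key : ∀ y ∈ specht F ν, ∀ a : MonoidAlgebra F (Equiv.Perm (Fin d)),
      form F ν x (a • y) = 0 := by
    intro y hy
    induction hy using Submodule.span_induction with
    | mem y hy =>
      obtain ⟨t, rfl⟩ := hy
      intro a
      induction a using MonoidAlgebra.induction_on with
      | of g => rw [← polytabloid_trans, h]
      | add a b ha hb => rw [add_smul, map_add, ha, hb, add_zero]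
      | smul c a ha => rw [smul_assoc, map_smul, ha, smul_zero]
    | zero => simp
    | add y z _ _ hy hz => intro a; rw [smul_add, map_add, hy, hz, add_zero]
    | smul b y _ hy => intro a; rw [smul_smul, hy]
  intro y hy
  simpa using key y hy 1

/-- James' submodule theorem. -/
theorem specht_le_or_le_spechtPerp (h2 : (2 : F) ≠ 0)
    (U : Submodule (MonoidAlgebra F (Equiv.Perm (Fin d))) (PermModule F ν)) :
    specht F ν ≤ U ∨ U ≤ spechtPerp F ν := by
  -- Either some signed column sum is nonzero on U, and then U contains a polytabloid, which
  -- generates S^ν; or all of them vanish on U, and self-adjointness gives ⟨u, e_t⟩ = ⟨κ_t u, {t}⟩ =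
  -- 0.
  by_cases h : ∃ u ∈ U, ∃ t : ν.Tableau, kappa F t • u ≠ 0
  · left
    obtain ⟨u, hu, t, ht⟩ := h
    obtain ⟨c, hc⟩ := exists_kappa_smul_eq F h2 t u
    have hc0 : c ≠ 0 := by
      rintro rfl
      exact ht (by rw [hc, zero_smul])
    refine specht_le_of_polytabloid_mem F (t := t) ?_
    have : polytabloid F t = (algebraMap F (MonoidAlgebra F (Equiv.Perm (Fin d))) c⁻¹) •
        kappa F t • u := by
      rw [algebraMap_smul, hc, smul_smul, inv_mul_cancel₀ hc0, one_smul]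
    rw [this]
    exact U.smul_mem _ (U.smul_mem _ hu)
  · right
    push Not at h
    intro u hu
    refine mem_spechtPerp_of_forall F fun t => ?_
    rw [← kappa_smul_tab, ← form_kappa_smul, h u hu t, map_zero, LinearMap.zero_apply]

/-- The James module is simple as soon as it is nonzero. -/
theorem isSimpleModule_james (h2 : (2 : F) ≠ 0) (h : ¬ specht F ν ≤ spechtPerp F ν) :
    IsSimpleModule (MonoidAlgebra F (Equiv.Perm (Fin d))) (ν.James F) := by
  rw [isSimpleModule_iff_isCoatom]
  refine ⟨fun htop => h (Submodule.comap_subtype_eq_top.1 htop), fun V hV => ?_⟩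
  rcases specht_le_or_le_spechtPerp F h2 (V.map (specht F ν).subtype) with h1 | h1
  · rw [eq_top_iff]
    intro x _
    obtain ⟨y, hy, hyx⟩ := h1 x.2
    rwa [← Subtype.ext hyx]
  · exact absurd (Submodule.map_le_iff_le_comap.1 h1) hV.not_ge

/-- By Maschke, S ∩ S⊥ has a complement V. The submodule theorem for V ∩ S leaves two cases: S ≤ V,
so S ∩ S⊥ = 0 and S is its own James quotient; or V ∩ S ≤ S⊥, and the modular law gives the excluded
S ≤ S⊥. -/
theorem isSimpleModule_specht [CharZero F] (h : ¬ specht F ν ≤ spechtPerp F ν) :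
    IsSimpleModule (MonoidAlgebra F (Equiv.Perm (Fin d))) (specht F ν) := by
  have : NeZero (Nat.card (Equiv.Perm (Fin d)) : F) := ⟨Nat.cast_ne_zero.2 Nat.card_pos.ne'⟩
  have hd : Disjoint (specht F ν) (spechtPerp F ν) := by
    obtain ⟨V, hV⟩ := exists_isCompl (specht F ν ⊓ spechtPerp F ν)
    rcases specht_le_or_le_spechtPerp F two_ne_zero (V ⊓ specht F ν) with h1 | h1
    · rw [disjoint_iff, ← le_bot_iff, ← hV.inf_eq_bot]
      exact le_inf le_rfl (inf_le_left.trans (h1.trans inf_le_left))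
    · exfalso
      apply h
      have : specht F ν ≤ (specht F ν ⊓ spechtPerp F ν) ⊔ V ⊓ specht F ν := by
        rw [← sup_inf_assoc_of_le V inf_le_left, hV.sup_eq_top, top_inf_eq]
      exact this.trans (sup_le inf_le_right h1)
  have hbot : (spechtPerp F ν).comap (specht F ν).subtype = ⊥ := by
    rw [← Submodule.disjoint_iff_comap_eq_bot]
    exact hd
  have := isSimpleModule_james F two_ne_zero h
  exact IsSimpleModule.congr (Submodule.quotEquivOfEqBot _ hbot).symm

end

end Nat.Partition

/-! ### Rows of a partition, and nonzero values of the form on Specht modules. -/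

namespace Nat.Partition

variable {d : ℕ} {ν : Nat.Partition d}

/-- The parts of a partition in weakly decreasing order. -/
def rows (ν : Nat.Partition d) : List ℕ := ν.parts.sort (· ≥ ·)

lemma coe_rows (ν : Nat.Partition d) : (ν.rows : Multiset ℕ) = ν.parts := Multiset.sort_eq _ _

lemma rowLength_of_lt {i : ℕ} (h : i < ν.rows.length) : ν.rowLength i = ν.rows[i] :=
  List.getD_eq_getElem _ _ h

lemma rowLength_of_le {i : ℕ} (h : ν.rows.length ≤ i) : ν.rowLength i = 0 :=
  List.getD_eq_default _ _ h

lemma lt_length_of_rowLength_pos {i : ℕ} (h : 0 < ν.rowLength i) : i < ν.rows.length := by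
  by_contra hi
  rw [rowLength_of_le (not_lt.1 hi)] at h
  exact h.false

lemma rows_pos {i : ℕ} (h : i < ν.rows.length) : 0 < ν.rows[i] := by
  apply ν.parts_pos
  rw [← coe_rows, Multiset.mem_coe]
  exact List.getElem_mem h

lemma sum_rowLength (ν : Nat.Partition d) : ∑ i : Fin ν.rows.length, ν.rowLength i = d := by
  have h1 : ∑ i : Fin ν.rows.length, ν.rowLength i = ν.rows.sum := by
    rw [← Fin.sum_univ_getElem]
    exact Finset.sum_congr rfl fun i _ => rowLength_of_lt i.2
  rw [h1, ← Multiset.sum_coe, coe_rows, ν.parts_sum]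

lemma nonempty_tableau (ν : Nat.Partition d) : Nonempty ν.Tableau := by
  let e : ν.Node ≃ Σ i : Fin ν.rows.length, Fin (ν.rowLength i) :=
    { toFun := fun p => ⟨⟨p.1.1, lt_length_of_rowLength_pos (Nat.zero_lt_of_lt p.2)⟩, ⟨p.1.2, p.2⟩⟩
      invFun := fun q => ⟨(q.1, q.2), q.2.2⟩
      left_inv := fun _ => rfl
      right_inv := fun _ => rfl }
  have hcard : Fintype.card (Σ i : Fin ν.rows.length, Fin (ν.rowLength i)) = Fintype.card (Fin d) := by
    rw [Fintype.card_sigma, Fintype.card_fin]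
    simp only [Fintype.card_fin]
    exact sum_rowLength ν
  exact ⟨e.trans (Fintype.equivOfCardEq hcard)⟩

/-- In a partition in `countRestricted d 3` no three rows have the same positive length. -/
lemma not_three_rows_of_mem_countRestricted (h : ν ∈ countRestricted d 3) {i j k l : ℕ}
    (hij : i ≠ j) (hjk : j ≠ k) (hik : i ≠ k) (hl : 0 < l) (hi : ν.rowLength i = l)
    (hj : ν.rowLength j = l) (hk : ν.rowLength k = l) : False := by
  have hi' := lt_length_of_rowLength_pos (hl.trans_eq hi.symm)
  have hj' := lt_length_of_rowLength_pos (hl.trans_eq hj.symm)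
  have hk' := lt_length_of_rowLength_pos (hl.trans_eq hk.symm)
  rw [rowLength_of_lt hi'] at hi
  rw [rowLength_of_lt hj'] at hj
  rw [rowLength_of_lt hk'] at hk
  have hmem : l ∈ ν.parts := by
    rw [← coe_rows, Multiset.mem_coe, ← hi]
    exact List.getElem_mem hi'
  have hcount := (Finset.mem_filter.1 h).2 l hmem
  rw [← coe_rows, Multiset.coe_count] at hcount
  have h3 := Fin.card_filter_univ_eq_vector_get_eq_count l (⟨ν.rows, rfl⟩ : List.Vector ℕ _)
  have hle : ({⟨i, hi'⟩, ⟨j, hj'⟩, ⟨k, hk'⟩} : Finset (Fin ν.rows.length)) ⊆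
      Finset.univ.filter fun x => List.Vector.get (⟨ν.rows, rfl⟩ : List.Vector ℕ ν.rows.length) x = l := by
    intro x hx
    simp only [Finset.mem_insert, Finset.mem_singleton] at hx
    refine Finset.mem_filter.2 ⟨Finset.mem_univ _, ?_⟩
    rcases hx with rfl | rfl | rfl
    · exact hi
    · exact hj
    · exact hk
  have h4 := Finset.card_le_card hle
  have h5 : ({⟨i, hi'⟩, ⟨j, hj'⟩, ⟨k, hk'⟩} : Finset (Fin ν.rows.length)).card = 3 :=
    Finset.card_eq_three.2 ⟨⟨i, hi'⟩, ⟨j, hj'⟩, ⟨k, hk'⟩, by simpa using hij, by simpa using hik,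
      by simpa using hjk, rfl⟩
  have h6 : List.Vector.toList (⟨ν.rows, rfl⟩ : List.Vector ℕ ν.rows.length) = ν.rows := rfl
  rw [h6] at h3
  omega

noncomputable section

variable (F : Type*) [Field F]

/-- A letter is determined by its row and column. The tabloid records the row of the preimage, and
column permutations preserve the column. -/
lemma Tableau.eq_of_smul_tabloid_eq {t : ν.Tableau} {π ρ : Equiv.Perm (Fin d)}
    (hπ : π ∈ t.colStab) (hρ : ρ ∈ t.colStab) (h : π • t.tabloid = ρ • t.tabloid) : π = ρ := by
  apply inv_injective
  ext1 x
  refine t.ext_row_col (congrFun (congrArg Subtype.val h) x) ?_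
  rw [Tableau.mem_colStab.1 (Tableau.inv_mem_colStab hπ),
    Tableau.mem_colStab.1 (Tableau.inv_mem_colStab hρ)]

lemma form_polytabloid (t : ν.Tableau) (x : PermModule F ν) :
    form F ν (polytabloid F t) x =
      ∑ π ∈ t.colStab, ((Equiv.Perm.sign π : ℤ) : F) * form F ν (tab F (π • t.tabloid)) x := by
  rw [← kappa_smul_tab, kappa, Finset.sum_smul, map_sum, LinearMap.sum_apply]
  refine Finset.sum_congr rfl fun π _ => ?_
  rw [smul_assoc, LinearMap.map_smul, LinearMap.smul_apply, of_smul_tab, smul_eq_mul]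

lemma form_tab_tab (r s : ν.Tabloid) :
    form F ν (tab F r) (tab F s) = if s = r then 1 else 0 := by
  rw [tab, tab, form_single, mul_one]

lemma form_tab_polytabloid (t : ν.Tableau) (r : ν.Tabloid) :
    form F ν (tab F r) (polytabloid F t) =
      ∑ π ∈ t.colStab, if r = π • t.tabloid then ((Equiv.Perm.sign π : ℤ) : F) else 0 := by
  rw [form_comm, form_polytabloid]
  refine Finset.sum_congr rfl fun π _ => ?_
  rw [form_tab_tab, mul_ite, mul_one, mul_zero]

/-- The coefficients of a polytabloid are the signs of the column permutations. -/
lemma form_tab_polytabloid_of_mem {t : ν.Tableau} {π : Equiv.Perm (Fin d)} (hπ : π ∈ t.colStab) :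
    form F ν (tab F (π • t.tabloid)) (polytabloid F t) = ((Equiv.Perm.sign π : ℤ) : F) := by
  rw [form_tab_polytabloid, Finset.sum_eq_single π]
  · rw [if_pos rfl]
  · intro ρ hρ hne
    rw [if_neg]
    exact fun h => hne (Tableau.eq_of_smul_tabloid_eq hρ hπ h.symm)
  · exact fun h => absurd hπ h

lemma Tableau.one_mem_colStab (t : ν.Tableau) : (1 : Equiv.Perm (Fin d)) ∈ t.colStab :=
  Tableau.mem_colStab.2 fun _ => rfl

lemma form_tab_tabloid_polytabloid (t : ν.Tableau) :
    form F ν (tab F t.tabloid) (polytabloid F t) = 1 := by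
  have := form_tab_polytabloid_of_mem F t.one_mem_colStab
  rwa [one_smul, Equiv.Perm.sign_one, Units.val_one, Int.cast_one] at this

lemma polytabloid_ne_zero (t : ν.Tableau) : polytabloid F t ≠ 0 := by
  intro h
  have := form_tab_tabloid_polytabloid F t
  rw [h, map_zero] at this
  exact zero_ne_one this

lemma polytabloid_mem_specht (t : ν.Tableau) : polytabloid F t ∈ specht F ν :=
  Submodule.subset_span ⟨t, rfl⟩

/-- The number of column permutations. -/
lemma form_polytabloid_self (t : ν.Tableau) :
    form F ν (polytabloid F t) (polytabloid F t) = t.colStab.card := by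
  rw [form_polytabloid, Finset.sum_congr rfl fun π hπ => by
    rw [form_tab_polytabloid_of_mem F hπ, sign_mul_self]]
  simp

theorem not_specht_le_spechtPerp_of_charZero [CharZero F] (ν : Nat.Partition d) :
    ¬ specht F ν ≤ spechtPerp F ν := by
  intro h
  obtain ⟨t⟩ := ν.nonempty_tableau
  have := h (polytabloid_mem_specht F t) _ (polytabloid_mem_specht F t)
  rw [form_polytabloid_self, Nat.cast_eq_zero, Finset.card_eq_zero] at this
  exact Finset.notMem_empty _ (this ▸ t.one_mem_colStab)

/-- Reversal of the rows of the Young diagram. -/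
def nodeRev (ν : Nat.Partition d) : ν.Node ≃ ν.Node where
  toFun p := ⟨(p.1.1, ν.rowLength p.1.1 - 1 - p.1.2), by have := p.2; simp only; omega⟩
  invFun p := ⟨(p.1.1, ν.rowLength p.1.1 - 1 - p.1.2), by have := p.2; simp only; omega⟩
  left_inv p := Subtype.ext (Prod.ext rfl (by have := p.2; simp only; omega))
  right_inv p := Subtype.ext (Prod.ext rfl (by have := p.2; simp only; omega))

/-- The tableau with reversed rows. -/
def Tableau.rev (t : ν.Tableau) : ν.Tableau := ν.nodeRev.trans t

lemma Tableau.rev_col (t : ν.Tableau) (x : Fin d) :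
    t.rev.col x + t.col x + 1 = ν.rowLength (t.row x) := by
  have h1 : t.rev.col x = ν.rowLength (t.row x) - 1 - t.col x := rfl
  have := t.col_lt x
  omega

lemma Tableau.rev_tabloid (t : ν.Tableau) : t.rev.tabloid = t.tabloid := rfl

/-- A tabloid which occurs in the polytabloids of `t` and of the row reversal of `t` arises from
the tabloid of `t` by permuting rows of equal lengths within the columns. -/
lemma Tableau.rowLength_row_eq {t : ν.Tableau} {π ρ : Equiv.Perm (Fin d)} (hπ : π ∈ t.colStab)
    (hρ : ρ ∈ t.rev.colStab) (h : π • t.tabloid = ρ • t.rev.tabloid) (x : Fin d) :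
    ν.rowLength (t.row (π x)) = ν.rowLength (t.row x) := by
  let n : Fin d → ℤ := fun x => ν.rowLength (t.row x)
  have hr : ∀ x, t.row (π⁻¹ x) = t.row (ρ⁻¹ x) := fun x => congrFun (congrArg Subtype.val h) x
  have hπ' : ∀ x, t.col (π⁻¹ x) = t.col x :=
    Tableau.mem_colStab.1 (Tableau.inv_mem_colStab hπ)
  have hρ' : ∀ x, t.rev.col (ρ⁻¹ x) = t.rev.col x :=
    Tableau.mem_colStab.1 (Tableau.inv_mem_colStab hρ)
  have hn : ∀ x, n x = t.rev.col x + t.col x + 1 := fun x => by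
    have := t.rev_col x
    simp only [n]
    exact_mod_cast this.symm
  have hnr : ∀ x, n (π⁻¹ x) = n (ρ⁻¹ x) := fun x => by simp only [n, hr]
  -- Split the row length of x as reversed column + column + 1. The first summand is invariant under
  -- ρ, the others under π, and the row lengths at π⁻¹ x and ρ⁻¹ x agree, so both pieces can be
  -- reindexed.
  have h1 : ∑ x, n (π⁻¹ x) * n x = ∑ x, n x * n x := by
    have e1 : ∀ x, n (π⁻¹ x) * n x = n (ρ⁻¹ x) * t.rev.col (ρ⁻¹ x) +
        (n (π⁻¹ x) * t.col (π⁻¹ x) + n (π⁻¹ x)) := fun x => by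
      rw [hρ', hπ', ← hnr, hn x]
      ring
    have e2 : ∀ x, n x * n x = n x * t.rev.col x + (n x * t.col x + n x) := fun x => by
      nth_rewrite 2 [hn x]
      ring
    rw [Finset.sum_congr rfl fun x _ => e1 x, Finset.sum_congr rfl fun x _ => e2 x,
      Finset.sum_add_distrib, Finset.sum_add_distrib (f := fun x => n x * (t.rev.col x : ℤ))]
    refine congrArg₂ _ ?_ ?_
    · exact Equiv.sum_comp ρ⁻¹ fun x => n x * t.rev.col x
    · exact Equiv.sum_comp π⁻¹ fun x => n x * t.col x + n x
  have h2 : ∑ x, n (π⁻¹ x) * n (π⁻¹ x) = ∑ x, n x * n x :=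
    Equiv.sum_comp π⁻¹ fun x => n x * n x
  -- This is equality in Cauchy-Schwarz: n and n ∘ π⁻¹ have the same norm, and their inner product
  -- is its square.
  have h3 : ∑ x, (n (π⁻¹ x) - n x) ^ 2 = 0 := by
    have e : ∀ x, (n (π⁻¹ x) - n x) ^ 2 =
        n (π⁻¹ x) * n (π⁻¹ x) - 2 * (n (π⁻¹ x) * n x) + n x * n x := fun x => by ring
    rw [Finset.sum_congr rfl fun x _ => e x, Finset.sum_add_distrib, Finset.sum_sub_distrib,
      ← Finset.mul_sum, h1, h2]
    ring
  have h4 := (Finset.sum_eq_zero_iff_of_nonneg fun x _ => sq_nonneg _).1 h3 (π x)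
    (Finset.mem_univ _)
  have h5 : n x - n (π x) = 0 := by simpa using h4
  have h6 : n (π x) = n x := (sub_eq_zero.1 h5).symm
  exact Nat.cast_injective (R := ℤ) h6

/-- The column permutations which permute rows of equal lengths. -/
def Tableau.equalRowStab (t : ν.Tableau) : Subgroup (Equiv.Perm (Fin d)) where
  carrier := {π | (∀ x, t.col (π x) = t.col x) ∧
    ∀ x, ν.rowLength (t.row (π x)) = ν.rowLength (t.row x)}
  one_mem' := ⟨fun _ => rfl, fun _ => rfl⟩
  mul_mem' := fun {π ρ} hπ hρ => ⟨fun x => by rw [Equiv.Perm.mul_apply, hπ.1, hρ.1],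
    fun x => by rw [Equiv.Perm.mul_apply, hπ.2, hρ.2]⟩
  inv_mem' := fun {π} hπ => ⟨fun x => by rw [← hπ.1 (π⁻¹ x)]; simp,
    fun x => by rw [← hπ.2 (π⁻¹ x)]; simp⟩

lemma Tableau.mem_rev_colStab {t : ν.Tableau} {π : Equiv.Perm (Fin d)} (h : π ∈ t.equalRowStab) :
    π ∈ t.rev.colStab := by
  rw [mem_colStab]
  intro x
  have h1 := t.rev_col (π x)
  have h2 := t.rev_col x
  rw [h.1, h.2] at h1
  omega

/-- Row reversal keeps the tabloid of t. The common tabloids of both polytabloids come from the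
column permutations that preserve row lengths; these preserve reversed columns too, so each appears
with the same sign on both sides and contributes 1. -/
lemma form_polytabloid_rev (t : ν.Tableau) :
    form F ν (polytabloid F t) (polytabloid F t.rev) = Nat.card t.equalRowStab := by
  classical
  have hsub : Finset.univ.filter (fun π => π ∈ t.equalRowStab) ⊆ t.colStab := fun π hπ =>
    Tableau.mem_colStab.2 (Finset.mem_filter.1 hπ).2.1
  rw [form_polytabloid, ← Finset.sum_subset hsub]
  · have : ∀ π ∈ Finset.univ.filter (fun π => π ∈ t.equalRowStab),
        ((Equiv.Perm.sign π : ℤ) : F) *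
          form F ν (tab F (π • t.tabloid)) (polytabloid F t.rev) = 1 := by
      intro π hπ
      rw [← t.rev_tabloid, form_tab_polytabloid_of_mem F
        (Tableau.mem_rev_colStab (Finset.mem_filter.1 hπ).2), sign_mul_self]
    rw [Finset.sum_congr rfl this, Finset.sum_const, nsmul_eq_mul, mul_one, Nat.card_eq_fintype_card,
      Fintype.card_subtype]
  · intro π hπ hn
    rw [form_tab_polytabloid, Finset.sum_eq_zero, mul_zero]
    intro ρ hρ
    refine if_neg fun h => hn (Finset.mem_filter.2 ⟨Finset.mem_univ _, ?_⟩)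
    exact ⟨Tableau.mem_colStab.1 hπ, Tableau.rowLength_row_eq hπ hρ h⟩

/-- By Cauchy there would be an element of order 3. A letter it moves has an orbit of three letters
in one column, hence in three different rows of equal length, which 3-regularity forbids. -/
lemma not_three_dvd_card_equalRowStab (h : ν ∈ countRestricted d 3) (t : ν.Tableau) :
    ¬ 3 ∣ Nat.card t.equalRowStab := by
  intro h3
  have : Fact (Nat.Prime 3) := ⟨Nat.prime_three⟩
  obtain ⟨⟨g, hg⟩, hord⟩ := exists_prime_orderOf_dvd_card' 3 h3
  rw [Subgroup.orderOf_mk] at hord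
  have hg3 : g * (g * g) = 1 := by
    have := pow_orderOf_eq_one g
    rw [hord] at this
    rw [← this]
    simp [pow_succ, mul_assoc]
  have hg1 : g ≠ 1 := by
    rintro rfl
    simp at hord
  obtain ⟨x, hx⟩ : ∃ x, g x ≠ x := by
    by_contra! hall
    exact hg1 (Equiv.ext hall)
  have hggg : g (g (g x)) = x := congrArg (fun f => f x) hg3
  have hgg : g (g x) ≠ x := fun hh => hx (by rw [hh] at hggg; exact hggg)
  have hrow : ∀ {a b}, t.col a = t.col b → a ≠ b → t.row a ≠ t.row b :=
    fun hc hab hr => hab (t.ext_row_col hr hc)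
  refine not_three_rows_of_mem_countRestricted h (l := ν.rowLength (t.row x))
    (hrow (hg.1 x).symm hx.symm) (hrow (hg.1 (g x)).symm fun hh => hx (g.injective hh.symm))
    (hrow ((hg.1 (g x)).trans (hg.1 x)).symm hgg.symm) (Nat.zero_lt_of_lt (t.col_lt x)) rfl
    (hg.2 x) ((hg.2 (g x)).trans (hg.2 x))

theorem not_specht_le_spechtPerp_of_charThree [CharP F 3] (h : ν ∈ countRestricted d 3) :
    ¬ specht F ν ≤ spechtPerp F ν := by
  intro hle
  obtain ⟨t⟩ := ν.nonempty_tableau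
  have := hle (polytabloid_mem_specht F t) _ (polytabloid_mem_specht F t.rev)
  rw [form_polytabloid_rev, CharP.cast_eq_zero_iff F 3] at this
  exact not_three_dvd_card_equalRowStab h t this

end

end Nat.Partition

/-! ### Specht modules on which every transposition acts as 1 or -1. -/

namespace Nat.Partition

variable {d : ℕ} {ν : Nat.Partition d}

lemma length_rows (ν : Nat.Partition d) : ν.rows.length = ν.parts.card := by
  rw [← coe_rows, Multiset.coe_card]

lemma rowLength_le_of_parts_eq_replicate (h : ν.parts = Multiset.replicate d 1) (i : ℕ) :
    ν.rowLength i ≤ 1 := by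
  by_cases hi : i < ν.rows.length
  · rw [rowLength_of_lt hi]
    have : ν.rows[i] ∈ ν.parts := by
      rw [← coe_rows, Multiset.mem_coe]
      exact List.getElem_mem hi
    rw [h] at this
    exact (Multiset.eq_of_mem_replicate this).le
  · rw [rowLength_of_le (not_lt.1 hi)]
    exact Nat.zero_le _

lemma rowLength_indiscrete {i : ℕ} (hd : d ≠ 0) (hi : i ≠ 0) :
    (indiscrete d).rowLength i = 0 := by
  refine rowLength_of_le ?_
  rw [length_rows, indiscrete_parts hd, Multiset.card_singleton]
  omega

lemma rowLength_one_pos (h : ν ≠ indiscrete d) : 0 < ν.rowLength 1 := by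
  by_contra h0
  have hlen : ν.rows.length ≤ 1 := by
    by_contra hl
    have := rows_pos (not_le.1 hl)
    rw [← rowLength_of_lt] at this
    exact h0 this
  rw [length_rows] at hlen
  apply h
  rcases Nat.le_one_iff_eq_zero_or_eq_one.1 hlen with hc | hc
  · have hd : d = 0 := by rw [← ν.parts_sum, Multiset.card_eq_zero.1 hc, Multiset.sum_zero]
    subst hd
    exact Subsingleton.elim _ _
  · obtain ⟨a, ha⟩ := Multiset.card_eq_one.1 hc
    have had : a = d := by rw [← ν.parts_sum, ha, Multiset.sum_singleton]
    subst had
    have ha0 : a ≠ 0 := (ν.parts_pos (by rw [ha]; exact Multiset.mem_singleton_self a)).ne'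
    exact Nat.Partition.ext (by rw [ha, indiscrete_parts ha0])

lemma one_lt_rowLength_zero (h : ν.parts ≠ Multiset.replicate d 1) : 1 < ν.rowLength 0 := by
  by_contra h0
  have hall : ∀ a ∈ ν.parts, a = 1 := by
    intro a ha
    refine le_antisymm ?_ (ν.parts_pos ha)
    rw [← coe_rows, Multiset.mem_coe] at ha
    obtain ⟨i, hi, rfl⟩ := List.getElem_of_mem ha
    have hsort : ν.rows.Pairwise (· ≥ ·) := Multiset.pairwise_sort _ _
    have h1 : ν.rows[i] ≤ ν.rows[0]'(Nat.zero_lt_of_lt hi) := by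
      rcases Nat.eq_zero_or_pos i with rfl | hpos
      · exact le_rfl
      · exact List.pairwise_iff_getElem.1 hsort 0 i _ hi hpos
    rw [← rowLength_of_lt (Nat.zero_lt_of_lt hi)] at h1
    exact h1.trans (not_lt.1 h0)
  apply h
  have hrep := Multiset.eq_replicate_card.2 hall
  have hsum := ν.parts_sum
  rw [hrep, Multiset.sum_replicate, smul_eq_mul, mul_one] at hsum
  rw [hrep, hsum]

noncomputable section

variable (F : Type*) [Field F]

lemma of_smul_eq_self_of_indiscrete (hd : d ≠ 0) (g : Equiv.Perm (Fin d))
    (x : PermModule F (indiscrete d)) : MonoidAlgebra.of F _ g • x = x := by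
  have h0 : ∀ (r : (indiscrete d).Tabloid) y, r.1 y = 0 := by
    intro r y
    by_contra hy
    have := r.2 (r.1 y)
    rw [rowLength_indiscrete hd hy, Finset.card_eq_zero, Finset.filter_eq_empty_iff] at this
    exact this (Finset.mem_univ y) rfl
  have : Algebra.lsmul F F (PermModule F (indiscrete d)) (MonoidAlgebra.of F _ g) =
      LinearMap.id := by
    refine permModule_ext F fun r => ?_
    change MonoidAlgebra.of F _ g • tab F r = tab F r
    rw [of_smul_tab]
    exact congrArg _ (Subtype.ext (funext fun y => by rw [h0, h0]))
  exact congrArg (fun f => f x) this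

/-- All letters lie in column 0, so the column stabiliser is the whole symmetric group. -/
lemma of_smul_eq_sign_of_replicate (h : ν.parts = Multiset.replicate d 1)
    (g : Equiv.Perm (Fin d)) {x : PermModule F ν} (hx : x ∈ specht F ν) :
    MonoidAlgebra.of F _ g • x = ((Equiv.Perm.sign g : ℤ) : F) • x := by
  have hmem : ∀ (t : ν.Tableau) (π : Equiv.Perm (Fin d)), π ∈ t.colStab := by
    intro t π
    have h0 : ∀ y, t.col y = 0 := fun y =>
      Nat.lt_one_iff.1 ((t.col_lt y).trans_le (rowLength_le_of_parts_eq_replicate h _))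
    exact Tableau.mem_colStab.2 fun y => by rw [h0, h0]
  have key : ∀ g : Equiv.Perm (Fin d),
      MonoidAlgebra.of F _ g • x = ((Equiv.Perm.sign g : ℤ) : F) • x := by
    induction hx using Submodule.span_induction with
    | mem x hx =>
      obtain ⟨t, rfl⟩ := hx
      exact fun g => of_smul_polytabloid F (hmem t g)
    | zero => simp
    | add x y _ _ hx hy => intro g; rw [smul_add, smul_add, hx, hy]
    | smul a x _ hx =>
      have ha : ∃ c : F, a • x = c • x := by
        induction a using MonoidAlgebra.induction_on with
        | of g => exact ⟨_, hx g⟩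
        | add a b ha hb =>
          obtain ⟨c, hc⟩ := ha
          obtain ⟨c', hc'⟩ := hb
          exact ⟨c + c', by rw [add_smul, add_smul, hc, hc']⟩
        | smul r a ha =>
          obtain ⟨c, hc⟩ := ha
          exact ⟨r * c, by rw [smul_assoc, hc, mul_smul]⟩
      obtain ⟨c, hc⟩ := ha
      intro g
      rw [hc, smul_comm _ c, hx, smul_comm c]
  exact key g

lemma exists_conj_swap {i j k l : Fin d} (hij : i ≠ j) (hkl : k ≠ l) :
    ∃ g : Equiv.Perm (Fin d), Equiv.swap k l = g * Equiv.swap i j * g⁻¹ := by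
  obtain ⟨g, hg⟩ := isConj_iff.1 (Equiv.Perm.isConj_swap hij hkl)
  exact ⟨g, hg.symm⟩

/-- All transpositions act on a Specht module as `1` or `-1` only for the trivial and the sign
module. -/
theorem swapsActAsSign_specht_iff [CharZero F] (ν : Nat.Partition d) :
    WreathSuper.SwapsActAsSign F d (specht F ν) ↔
      ν = indiscrete d ∨ ν.parts = Multiset.replicate d 1 := by
  constructor
  · intro h
    by_contra hν
    rw [not_or] at hν
    obtain ⟨t⟩ := ν.nonempty_tableau
    have h00 : 0 < ν.rowLength 0 := Nat.zero_lt_of_lt (one_lt_rowLength_zero hν.2)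
    -- The letters a, b share the first column and a, c the first row; both further nodes exist
    -- because ν is neither a single row nor a single column.
    let a := t ⟨(0, 0), h00⟩
    let b := t ⟨(1, 0), rowLength_one_pos hν.1⟩
    let c := t ⟨(0, 1), one_lt_rowLength_zero hν.2⟩
    have hab : a ≠ b := fun h => by simpa using t.injective h
    have hac : a ≠ c := fun h => by simpa using t.injective h
    let p : specht F ν := ⟨polytabloid F t, polytabloid_mem_specht F t⟩
    have hcolab : t.col a = t.col b := by rw [t.col_apply, t.col_apply]
    have hrowac : t.row a = t.row c := by rw [t.row_apply, t.row_apply]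
    have hp : polytabloid F t ≠ 0 := polytabloid_ne_zero F t
    have hmem : Equiv.swap a b ∈ t.colStab := by
      rw [Tableau.mem_colStab]
      intro z
      rw [Equiv.swap_apply_def]
      split_ifs with h1 h2
      · rw [h1, hcolab]
      · rw [h2, hcolab]
      · rfl
    have hsab : MonoidAlgebra.of F _ (Equiv.swap a b) • polytabloid F t = -polytabloid F t := by
      rw [of_smul_polytabloid F hmem, Equiv.Perm.sign_swap hab]
      simp
    have hfix : Equiv.swap a c • t.tabloid = t.tabloid := by
      refine Subtype.ext (funext fun z => ?_)
      rw [tabloid_smul_apply, Equiv.swap_inv, Equiv.swap_apply_def]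
      change t.row _ = t.row z
      split_ifs with h1 h2
      · rw [h1, hrowac]
      · rw [h2, hrowac]
      · rfl
    -- The polytabloid is negated, which decides the sign on the whole Specht module; conjugacy then
    -- carries it over to the transposition of a and c.
    have hneg : ∀ x : specht F ν, MonoidAlgebra.of F _ (Equiv.swap a b) • x = -x := by
      rcases h a b hab with h | h
      · exfalso
        have h1 : MonoidAlgebra.of F _ (Equiv.swap a b) • polytabloid F t = polytabloid F t :=
          congrArg Subtype.val (h p)
        rw [hsab] at h1
        have h2 : (2 : F) • polytabloid F t = 0 := by
          rw [two_smul]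
          nth_rewrite 1 [← h1]
          exact neg_add_cancel _
        exact hp ((smul_eq_zero.1 h2).resolve_left two_ne_zero)
      · exact h
    obtain ⟨g, hg⟩ := exists_conj_swap hab hac
    have hneg' : MonoidAlgebra.of F _ (Equiv.swap a c) • p = -p := by
      rw [hg, map_mul, map_mul, mul_smul, mul_smul, hneg, smul_neg, smul_smul, ← map_mul,
        mul_inv_cancel, map_one, one_smul]
    have h1 : MonoidAlgebra.of F _ (Equiv.swap a c) • polytabloid F t = -polytabloid F t :=
      congrArg Subtype.val hneg'
    -- The transposition of a and c fixes the tabloid of t but negates its polytabloid. Moving it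
    -- across the form, whose value here is 1, yields 1 = -1.
    have h2 := form_of_smul F (Equiv.swap a c) (tab F t.tabloid) (polytabloid F t)
    rw [of_smul_tab, hfix, Equiv.swap_inv, h1, map_neg, form_tab_tabloid_polytabloid] at h2
    exact two_ne_zero (α := F) (by linear_combination h2)
  · rintro (rfl | h) i j hij
    · have hd : d ≠ 0 := (Fin.pos i).ne'
      exact Or.inl fun x => Subtype.ext (of_smul_eq_self_of_indiscrete F hd _ _)
    · refine Or.inr fun x => Subtype.ext ?_
      refine (of_smul_eq_sign_of_replicate F h _ x.2).trans ?_
      rw [Equiv.Perm.sign_swap hij]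
      simp

end

end Nat.Partition

/-! ### Conclusion. -/

lemma WreathSuper.lt_cartanInvariant_of_not_swapsActAsSign {F : Type u} [Field F] {d : ℕ}
    {W : Type u} [AddCommGroup W] [Module (MonoidAlgebra F (Equiv.Perm (Fin d))) W]
    [IsSimpleModule (MonoidAlgebra F (Equiv.Perm (Fin d))) W]
    (h : ¬ WreathSuper.SwapsActAsSign F d W) :
    2 * d + 1 < cartanInvariant (WreathSuper F d) (TTriv F d W) (TTriv F d W) := by
  simp only [WreathSuper.SwapsActAsSign, not_forall, not_or] at h
  obtain ⟨i, j, hij, h1, h2⟩ := h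
  exact WreathSuper.lt_cartanInvariant_of_swap hij h1 h2

theorem mainTheorem8 (d : ℕ) (F : Type u) [Field F] :
    (CharZero F → ∀ ν : Nat.Partition d,
      2 * d + 1 ≤ wreathCartan F ν ν ∧
      (wreathCartan F ν ν = 2 * d + 1 ↔
        ν = Nat.Partition.indiscrete d ∨ ν.parts = Multiset.replicate d 1)) ∧
    (CharP F 3 → 3 ≤ d → ∀ μ : Nat.Partition d, μ ∈ Nat.Partition.countRestricted d 3 →
      2 * d + 1 < wreathCartanModular F μ μ) := by
  refine ⟨fun _ ν => ?_, fun _ hd μ hμ => ?_⟩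
  · have := Nat.Partition.isSimpleModule_specht F
      (Nat.Partition.not_specht_le_spechtPerp_of_charZero F ν)
    refine ⟨WreathSuper.le_cartanInvariant, ?_⟩
    rw [← Nat.Partition.swapsActAsSign_specht_iff F ν]
    constructor
    · intro h
      by_contra hs
      exact (WreathSuper.lt_cartanInvariant_of_not_swapsActAsSign hs).ne' h
    · exact fun h => le_antisymm h.cartanInvariant_le WreathSuper.le_cartanInvariant
  · have h2 : (2 : F) ≠ 0 := fun h => by
      have := (CharP.cast_eq_zero_iff F 3 2).1 (by exact_mod_cast h)
      omega
    have := Nat.Partition.isSimpleModule_james F h2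
      (Nat.Partition.not_specht_le_spechtPerp_of_charThree F hμ)
    -- Both cases are strict in characteristic 3: the extra vector of degree 2d - 5 for linear
    -- characters, the transposition component otherwise.
    by_cases hs : WreathSuper.SwapsActAsSign F d (μ.James F)
    · exact hs.lt_cartanInvariant hd
    · exact WreathSuper.lt_cartanInvariant_of_not_swapsActAsSign hs
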